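/- A one-way transducer $T=(\Sigma,\Gamma,Q,I,E,F,L)$ has finite alphabets $\Sigma,\Gamma$, a finite state set $Q$, initial and final states $I,F\subseteq Q$, transition rules $E\subseteq Q\times\Sigma\times Q$, and a map $L$ that assigns a regular language over $\Gamma$ to every rule in $E$ and every final state in $F$. A successful run on $a_1\cdots a_n$ goes through states $q_0\in I,q_1,\dots,q_n\in F$ with $(q_{i-1},a_i,q_i)\in E$ and chooses outputs $v_i\in L(q_{i-1},a_i,q_i)$ and a final output $v_{n+1}\in L(q_n)$; $T$ then relates the input $a_1\cdots a_n$ to the output $v_1\cdots v_{n+1}$, and the origin graph of the run is represented by the synchronized word $a_1v_1\cdots a_nv_nv_{n+1}$ over the disjoint union $\Sigma\uplus\Gamma$. The transducer is functional if it relates every input to at most one output, and real-time if the lengths of the words in the languages assigned by $L$ are bounded. A rational resynchronizer is a one-way transducer $R$ with input and output alphabet $\Sigma\uplus\Gamma$ such that any two words related by $R$ have the same projection on $\Sigma$ and the same projection on $\Gamma$. Write $T_1\subseteq_o R(T_2)$ if for every synchronized word $w'$ of $T_1$ there is a synchronized word $w$ of $T_2$ such that $R$ relates $w$ to $w'$.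 A one-counter automaton (OCA) is a non-deterministic pushdown automaton (which may have $\varepsilon$-transitions and accepts by final states) with a single stack symbol besides the bottom symbol; the number of occurrences of that stack symbol on the stack is the value of the counter, which is $0$ initially. Consider the following decision problems. (S) Given two real-time one-way transducers $T_1,T_2$ with the same input alphabet and the same one-letter output alphabet, is there a rational resynchronizer $R$ such that $T_1\subseteq_o R(T_2)$? (B) Given an OCA $A$ over an alphabet $\Omega$ with $L(A)=\Omega^*$, is there a $k\in\mathbb N$ such that every word over $\Omega$ is accepted by $A$ with a run in which the counter never exceeds $k$? **Proposition.** Problems (S) and (B) are inter-reducible: there are computable many-one reductions, mapping admissible inputs to admissible inputs, from (S) to (B) and from (B) to (S). The same holds for (B) and the restriction of (S) to inputs in which $T_1$ is functional; in particular, (B) reduces to (S) by a reduction whose values always have a functional left-hand transducer $T_1$. -/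

import Mathlib

/-! ### One-way transducers -/

/-- A one-way transducer with input alphabet `α`, output alphabet `β` and state set `Q` (all three are
finite wherever transducers are used below).  A transition rule `(p, a, q)` consumes the letter `a`
and may output any word of the regular language `out p a q`; at the end of the input, a final
state `q` may output any word of the regular language `finalOut q`. -/
structure OneWayTransducer (α β Q : Type) where
  init : Set Q
  final : Set Q
  edges : Set (Q × α × Q)
  out : Q → α → Q → Language β
  finalOut : Q → Language β
  out_regular : ∀ p a q, (p, a, q) ∈ edges → (out p a q).IsRegular
  finalOut_regular : ∀ q ∈ final, (finalOut q).IsRegular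

namespace OneWayTransducer

variable {α β Q : Type}

/-- `T.Run p ρ q`: there is a run from `p` to `q` that consumes the letters and outputs the words
listed, pairwise, in `ρ`. -/
inductive Run (T : OneWayTransducer α β Q) : Q → List (α × List β) → Q → Prop
  | nil (q : Q) : Run T q [] q
  | cons {p q r : Q} {a : α} {v : List β} {ρ : List (α × List β)} :
      (p, a, q) ∈ T.edges → v ∈ T.out p a q → Run T q ρ r → Run T p ((a, v) :: ρ) r

/-- `ρ` and `v` are the trace and the final output of a successful run of `T`. -/
def Accepts (T : OneWayTransducer α β Q) (ρ : List (α × List β)) (v : List β) : Prop :=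
  ∃ p ∈ T.init, ∃ q ∈ T.final, T.Run p ρ q ∧ v ∈ T.finalOut q

/-- The relation between input and output words realized by `T` (classical semantics). -/
def relation (T : OneWayTransducer α β Q) : Set (List α × List β) :=
  {x | ∃ ρ v, T.Accepts ρ v ∧ x = (ρ.map Prod.fst, (ρ.map Prod.snd).flatten ++ v)}

/-- The synchronized word over `α ⊎ β` of a run: every input letter is followed by the output
produced when reading it, and the final output comes last. -/
def syncWord (ρ : List (α × List β)) (v : List β) : List (α ⊕ β) :=
  ρ.flatMap (fun x => Sum.inl x.1 :: x.2.map Sum.inr) ++ v.map Sum.inr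

/-- The origin semantics of `T`, every origin graph being presented by its synchronized word. -/
def originSemantics (T : OneWayTransducer α β Q) : Set (List (α ⊕ β)) :=
  {w | ∃ ρ v, T.Accepts ρ v ∧ w = syncWord ρ v}

/-- `T` associates at most one output with each input. -/
def Functional (T : OneWayTransducer α β Q) : Prop :=
  ∀ u v v', (u, v) ∈ T.relation → (u, v') ∈ T.relation → v = v'

/-- `T` produces outputs of bounded length at every step (the last one included). -/
def RealTime (T : OneWayTransducer α β Q) : Prop :=
  ∃ B : ℕ, (∀ p a q, (p, a, q) ∈ T.edges → ∀ v ∈ T.out p a q, v.length ≤ B) ∧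
    ∀ q ∈ T.final, ∀ v ∈ T.finalOut q, v.length ≤ B

end OneWayTransducer

/-! ### Rational resynchronizers -/

/-- The input word underlying a synchronized word. -/
def inputProj {α β : Type} (w : List (α ⊕ β)) : List α := w.filterMap Sum.getLeft?

/-- The output word underlying a synchronized word. -/
def outputProj {α β : Type} (w : List (α ⊕ β)) : List β := w.filterMap Sum.getRight?

/-- A rational resynchronizer is a one-way transducer over synchronized words that preserves the
projections on the input and on the output alphabet. -/
def IsRationalResynchronizer {α β Q : Type} (R : OneWayTransducer (α ⊕ β) (α ⊕ β) Q) : Prop :=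
  ∀ w w', (w, w') ∈ R.relation → inputProj w = inputProj w' ∧ outputProj w = outputProj w'

/-- `R(S)`: the origin graphs obtained from those in `S` by applying `R`. -/
def resynchronize {α β Q : Type} (R : OneWayTransducer (α ⊕ β) (α ⊕ β) Q)
    (S : Set (List (α ⊕ β))) : Set (List (α ⊕ β)) :=
  {w' | ∃ w ∈ S, (w, w') ∈ R.relation}

/-- There is a rational resynchronizer `R` such that `T₁` is contained in `R(T₂)` under the origin
semantics. -/
def HasRationalResynchronizer {α β Q₁ Q₂ : Type}
    (T₁ : OneWayTransducer α β Q₁) (T₂ : OneWayTransducer α β Q₂) : Prop :=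
  ∃ (Q : Type) (_ : Finite Q) (R : OneWayTransducer (α ⊕ β) (α ⊕ β) Q),
    IsRationalResynchronizer R ∧ T₁.originSemantics ⊆ resynchronize R T₂.originSemantics

/-! ### One-counter automata -/

/-- A one-counter automaton with input alphabet `Ω` and state set `Q`: a non-deterministic pushdown
automaton with one stack symbol `X` besides the bottom symbol.  A transition `(p, a, z, m, q)` leads
from `p` to `q`, reads `a` (`none` stands for the empty word), and applies only if the topmost
symbol is the bottom one (`z = true`) or only if it is `X` (`z = false`).  It replaces a topmost `X`
by `X ^ m`, and pushes `X ^ m` above the bottom symbol, which is never removed. -/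
structure OneCounterAutomaton (Ω Q : Type) where
  init : Set Q
  final : Set Q
  trans : Set (Q × Option Ω × Bool × ℕ × Q)
  trans_finite : trans.Finite

namespace OneCounterAutomaton

variable {Ω Q : Type}

/-- One move between configurations (a state and the value of the counter). -/
inductive Step (A : OneCounterAutomaton Ω Q) : Q × ℕ → Option Ω → Q × ℕ → Prop
  | zero {p q : Q} {a : Option Ω} {m : ℕ} :
      (p, a, true, m, q) ∈ A.trans → Step A (p, 0) a (q, m)
  | pos {p q : Q} {a : Option Ω} {m c : ℕ} :
      (p, a, false, m, q) ∈ A.trans → Step A (p, c + 1) a (q, c + m)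

/-- `A.Run S x w y`: there is a run from `x` to `y` that reads `w` and in which the counter
always has a value in `S`. -/
inductive Run (A : OneCounterAutomaton Ω Q) (S : Set ℕ) : Q × ℕ → List Ω → Q × ℕ → Prop
  | nil {x : Q × ℕ} : x.2 ∈ S → Run A S x [] x
  | cons {x y z : Q × ℕ} {a : Option Ω} {w : List Ω} :
      x.2 ∈ S → A.Step x a y → Run A S y w z → Run A S x (a.toList ++ w) z

/-- `A` accepts `w` with a run, from an initial state and an empty counter to a final state, in
which the counter always has a value in `S`. -/
def AcceptsWithin (A : OneCounterAutomaton Ω Q) (S : Set ℕ) (w : List Ω) : Prop :=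
  ∃ p ∈ A.init, ∃ q ∈ A.final, ∃ c, A.Run S (p, 0) w (q, c)

/-- The language recognized by `A`. -/
def language (A : OneCounterAutomaton Ω Q) : Language Ω := {w | A.AcceptsWithin Set.univ w}

/-- For some `k`, every word is accepted with a run in which the counter never exceeds `k`. -/
def LanguageBounded (A : OneCounterAutomaton Ω Q) : Prop :=
  ∃ k : ℕ, ∀ w : List Ω, A.AcceptsWithin (Set.Iic k) w

end OneCounterAutomaton

/-! ### Finite descriptions

Alphabets and state sets are `Fin m` and `Fin n`.  The descriptions use natural numbers, and entries
that mention a letter or a state outside the range are ignored. -/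

/-- A finite description of a real-time one-way transducer with a one-letter output alphabet.
An entry `(p, a, v, q)` of `trans` says that `v` belongs to the finite output language of the
transition rule `(p, a, q)`; an entry `(q, v)` of `final` says that `q` is final and that `v`
belongs to its finite output language. -/
structure TransducerCode where
  numStates : ℕ
  init : List ℕ
  final : List (ℕ × List Unit)
  trans : List (ℕ × ℕ × List Unit × ℕ)

/-- A finite description of a one-counter automaton. -/
structure OCACode where
  numStates : ℕ
  init : List ℕ
  final : List ℕ
  trans : List (ℕ × Option ℕ × Bool × ℕ × ℕ)

theorem Language.isRegular_of_finite {β : Type} {L : Language β} (h : Set.Finite (L : Set (List β))) :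
    L.IsRegular := by
  refine Language.IsRegular.of_finite_range_leftQuotient ?_
  have hs : Set.Finite {y : List β | ∃ w ∈ (L : Set (List β)), y ∈ w.tails} := by
    have : {y : List β | ∃ w ∈ (L : Set (List β)), y ∈ w.tails}
        = ⋃ w ∈ (L : Set (List β)), {y | y ∈ w.tails} := by ext; simp
    rw [this]
    exact h.biUnion fun w _ => w.tails.finite_toSet
  refine (hs.finite_subsets).subset ?_
  rintro _ ⟨x, rfl⟩
  intro y hy
  exact ⟨x ++ y, hy, by simp⟩

/-- The transducer with input alphabet `Fin m` given by a description. -/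
def TransducerCode.toTransducer (c : TransducerCode) (m : ℕ) :
    OneWayTransducer (Fin m) Unit (Fin c.numStates) where
  init := {q | (q : ℕ) ∈ c.init}
  final := {q | ∃ v, ((q : ℕ), v) ∈ c.final}
  edges := {e | ∃ v, ((e.1 : ℕ), (e.2.1 : ℕ), v, (e.2.2 : ℕ)) ∈ c.trans}
  out p a q := {v | ((p : ℕ), (a : ℕ), v, (q : ℕ)) ∈ c.trans}
  finalOut q := {v | ((q : ℕ), v) ∈ c.final}
  out_regular p a q _ := Language.isRegular_of_finite
    ((List.finite_toSet c.trans).preimage (f := fun v => ((p : ℕ), (a : ℕ), v, (q : ℕ)))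
      (fun v _ v' _ h => by simpa using h))
  finalOut_regular q _ := Language.isRegular_of_finite
    ((List.finite_toSet c.final).preimage (f := fun v => ((q : ℕ), v))
      (fun v _ v' _ h => by simpa using h))

/-- The one-counter automaton with input alphabet `Fin m` given by a description. -/
def OCACode.toOCA (c : OCACode) (m : ℕ) : OneCounterAutomaton (Fin m) (Fin c.numStates) where
  init := {q | (q : ℕ) ∈ c.init}
  final := {q | (q : ℕ) ∈ c.final}
  trans := {t | ((t.1 : ℕ), t.2.1.map Fin.val, t.2.2.1, t.2.2.2.1, (t.2.2.2.2 : ℕ)) ∈ c.trans}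
  trans_finite := (List.finite_toSet c.trans).preimage
    (f := fun t : Fin c.numStates × Option (Fin m) × Bool × ℕ × Fin c.numStates =>
      ((t.1 : ℕ), t.2.1.map Fin.val, t.2.2.1, t.2.2.2.1, (t.2.2.2.2 : ℕ))) (by
    rintro ⟨p, a, z, k, q⟩ _ ⟨p', a', z', k', q'⟩ _ h
    simp only [Prod.mk.injEq] at h
    obtain ⟨h1, h2, rfl, rfl, h5⟩ := h
    obtain rfl := Fin.ext h1
    obtain rfl := Fin.ext h5
    obtain rfl := Option.map_injective Fin.val_injective h2
    rfl)

/-- Every described transducer is real-time. -/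
theorem TransducerCode.realTime (c : TransducerCode) (m : ℕ) : (c.toTransducer m).RealTime := by
  refine ⟨(c.trans.map fun t => t.2.2.1.length).sum + (c.final.map fun t => t.2.length).sum,
    ?_, ?_⟩
  · intro p a q _ v hv
    have h : v.length ∈ c.trans.map fun t => t.2.2.1.length := List.mem_map.2 ⟨_, hv, rfl⟩
    exact (List.single_le_sum (fun _ _ => Nat.zero_le _) _ h).trans (Nat.le_add_right _ _)
  · intro q _ v hv
    have h : v.length ∈ c.final.map fun t => t.2.length := List.mem_map.2 ⟨_, hv, rfl⟩
    exact (List.single_le_sum (fun _ _ => Nat.zero_le _) _ h).trans (Nat.le_add_left _ _)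

/-- Every real-time transducer with a one-letter output alphabet has a description. -/
theorem TransducerCode.exists_code {m n : ℕ} (T : OneWayTransducer (Fin m) Unit (Fin n))
    (hT : T.RealTime) :
    ∃ c : TransducerCode, (c.toTransducer m).originSemantics = T.originSemantics ∧
      (c.toTransducer m).relation = T.relation := by
  classical
  obtain ⟨B, h₁, h₂⟩ := hT
  let W : Finset (List Unit) := (Finset.range (B + 1)).image fun k => List.replicate k ()
  have hW : ∀ v : List Unit, v.length ≤ B → v ∈ W := fun v hv =>
    Finset.mem_image.2 ⟨v.length, by simpa using Nat.lt_succ_of_le hv,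
      (List.eq_replicate_of_mem (fun _ _ => rfl)).symm⟩
  let E := (Finset.univ ×ˢ Finset.univ ×ˢ W ×ˢ Finset.univ :
    Finset (Fin n × Fin m × List Unit × Fin n)).filter
      fun t => (t.1, t.2.1, t.2.2.2) ∈ T.edges ∧ t.2.2.1 ∈ T.out t.1 t.2.1 t.2.2.2
  let G := (Finset.univ ×ˢ W : Finset (Fin n × List Unit)).filter
      fun t => t.1 ∈ T.final ∧ t.2 ∈ T.finalOut t.1
  let I := (Finset.univ : Finset (Fin n)).filter fun q => q ∈ T.init
  let c : TransducerCode :=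
    { numStates := n
      init := I.toList.map Fin.val
      final := G.toList.map fun t => ((t.1 : ℕ), t.2)
      trans := E.toList.map fun t => ((t.1 : ℕ), (t.2.1 : ℕ), t.2.2.1, (t.2.2.2 : ℕ)) }
  have hI : ∀ q : Fin n, (q : ℕ) ∈ c.init ↔ q ∈ T.init := by
    intro q
    simp [c, I, Fin.val_inj]
  have hG : ∀ (q : Fin n) v, ((q : ℕ), v) ∈ c.final ↔ q ∈ T.final ∧ v ∈ T.finalOut q := by
    intro q v
    simp only [c, G, List.mem_map, Finset.mem_toList, Finset.mem_filter, Finset.mem_product,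
      Finset.mem_univ, true_and, Prod.mk.injEq, Prod.exists, Fin.val_inj]
    constructor
    · rintro ⟨_, _, ⟨_, h, h'⟩, rfl, rfl⟩
      exact ⟨h, h'⟩
    · rintro ⟨h, h'⟩
      exact ⟨_, _, ⟨hW _ (h₂ _ h _ h'), h, h'⟩, rfl, rfl⟩
  have hE : ∀ (p q : Fin n) (a : Fin m) v, ((p : ℕ), (a : ℕ), v, (q : ℕ)) ∈ c.trans ↔
      (p, a, q) ∈ T.edges ∧ v ∈ T.out p a q := by
    intro p q a v
    simp only [c, E, List.mem_map, Finset.mem_toList, Finset.mem_filter, Finset.mem_product,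
      Finset.mem_univ, true_and, and_true, Prod.mk.injEq, Prod.exists, Fin.val_inj]
    constructor
    · rintro ⟨_, _, _, _, ⟨_, h, h'⟩, rfl, rfl, rfl, rfl⟩
      exact ⟨h, h'⟩
    · rintro ⟨h, h'⟩
      exact ⟨_, _, _, _, ⟨hW _ (h₁ _ _ _ h _ h'), h, h'⟩, rfl, rfl, rfl, rfl⟩
  have hrun : ∀ (ρ : List (Fin m × List Unit)) (p q : Fin n),
      (c.toTransducer m).Run p ρ q ↔ T.Run p ρ q := by
    intro ρ p q
    constructor
    · intro h
      induction h with
      | nil q => exact .nil q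
      | cons _ h' _ ih =>
        have := (hE _ _ _ _).1 h'
        exact .cons this.1 this.2 ih
    · intro h
      induction h with
      | nil q => exact .nil _
      | cons h h' _ ih =>
        have := (hE _ _ _ _).2 ⟨h, h'⟩
        exact .cons ⟨_, this⟩ this ih
  have hacc : ∀ ρ v, (c.toTransducer m).Accepts ρ v ↔ T.Accepts ρ v := by
    intro ρ v
    constructor
    · rintro ⟨p, hp, q, _, hr, hv⟩
      have := (hG q v).1 hv
      exact ⟨p, (hI p).1 hp, q, this.1, (hrun _ _ _).1 hr, this.2⟩
    · rintro ⟨p, hp, q, hq, hr, hv⟩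
      have := (hG q v).2 ⟨hq, hv⟩
      exact ⟨p, (hI p).2 hp, q, ⟨v, this⟩, (hrun _ _ _).2 hr, this⟩
  refine ⟨c, ?_, ?_⟩
  · simp only [OneWayTransducer.originSemantics, hacc]
  · simp only [OneWayTransducer.relation, hacc]

/-- Every one-counter automaton has a description. -/
theorem OCACode.exists_code {m n : ℕ} (A : OneCounterAutomaton (Fin m) (Fin n)) :
    ∃ (c : OCACode) (h : c.numStates = n), h ▸ c.toOCA m = A := by
  classical
  refine ⟨{ numStates := n
            init := ((Finset.univ : Finset (Fin n)).filter (· ∈ A.init)).toList.map Fin.val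
            final := ((Finset.univ : Finset (Fin n)).filter (· ∈ A.final)).toList.map Fin.val
            trans := A.trans_finite.toFinset.toList.map fun t =>
              ((t.1 : ℕ), t.2.1.map Fin.val, t.2.2.1, t.2.2.2.1, (t.2.2.2.2 : ℕ)) }, rfl, ?_⟩
  obtain ⟨I, F, E, hE⟩ := A
  simp only [OCACode.toOCA, OneCounterAutomaton.mk.injEq]
  refine ⟨?_, ?_, ?_⟩
  · ext q
    simp [Fin.val_inj]
  · ext q
    simp [Fin.val_inj]
  · ext ⟨p, a, z, k, q⟩
    simp only [Set.mem_ofPred_eq, List.mem_map, Finset.mem_toList, Set.Finite.mem_toFinset,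
      Prod.mk.injEq, Prod.exists]
    constructor
    · rintro ⟨p', a', z', k', q', h, h1, h2, rfl, rfl, h5⟩
      obtain rfl := Fin.ext h1
      obtain rfl := Fin.ext h5
      obtain rfl := Option.map_injective Fin.val_injective h2
      exact h
    · intro h
      exact ⟨_, _, _, _, _, h, rfl, rfl, rfl, rfl, rfl⟩

/-! ### The two decision problems -/

/-- An instance of the synthesis problem: the size of the common input alphabet, and
the two transducers. -/
structure SynthesisInstance where
  numLetters : ℕ
  left : TransducerCode
  right : TransducerCode

/-- An instance of the language-boundedness problem: the size of the alphabet, and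
the one-counter automaton. -/
structure BoundednessInstance where
  numLetters : ℕ
  automaton : OCACode

/-- The left-hand transducer of an instance. -/
def SynthesisInstance.leftTransducer (x : SynthesisInstance) :
    OneWayTransducer (Fin x.numLetters) Unit (Fin x.left.numStates) :=
  x.left.toTransducer x.numLetters

/-- The right-hand transducer of an instance. -/
def SynthesisInstance.rightTransducer (x : SynthesisInstance) :
    OneWayTransducer (Fin x.numLetters) Unit (Fin x.right.numStates) :=
  x.right.toTransducer x.numLetters

/-- The automaton of an instance. -/
def BoundednessInstance.oca (x : BoundednessInstance) :
    OneCounterAutomaton (Fin x.numLetters) (Fin x.automaton.numStates) :=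
  x.automaton.toOCA x.numLetters

/-- A promise problem: the admissible inputs, and those with answer "yes". -/
structure PromiseProblem (ι : Type) where
  promise : ι → Prop
  yes : ι → Prop

/-- Synthesis of rational resynchronizers for real-time one-way transducers with a
one-letter output alphabet. -/
def rationalSynthesis : PromiseProblem SynthesisInstance where
  promise x := x.leftTransducer.RealTime ∧ x.rightTransducer.RealTime
  yes x := HasRationalResynchronizer x.leftTransducer x.rightTransducer

/-- The same problem for instances whose left-hand transducer is functional. -/
def rationalSynthesisFunctional : PromiseProblem SynthesisInstance where
  promise x := x.leftTransducer.RealTime ∧ x.rightTransducer.RealTime ∧ x.leftTransducer.Functional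
  yes x := HasRationalResynchronizer x.leftTransducer x.rightTransducer

/-- Language-boundedness of one-counter automata that recognize the universal language. -/
def languageBoundedness : PromiseProblem BoundednessInstance where
  promise x := x.oca.language = (Set.univ : Set (List (Fin x.numLetters)))
  yes x := x.oca.LanguageBounded

/-! ### Reductions -/

/-- The fields of a transducer description as a tuple. -/
def TransducerCode.equivProd : TransducerCode ≃
    ℕ × List ℕ × List (ℕ × List Unit) × List (ℕ × ℕ × List Unit × ℕ) where
  toFun c := (c.numStates, c.init, c.final, c.trans)
  invFun t := ⟨t.1, t.2.1, t.2.2.1, t.2.2.2⟩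

/-- The fields of an automaton description as a tuple. -/
def OCACode.equivProd : OCACode ≃
    ℕ × List ℕ × List ℕ × List (ℕ × Option ℕ × Bool × ℕ × ℕ) where
  toFun c := (c.numStates, c.init, c.final, c.trans)
  invFun t := ⟨t.1, t.2.1, t.2.2.1, t.2.2.2⟩

instance : Primcodable TransducerCode := Primcodable.ofEquiv _ TransducerCode.equivProd

instance : Primcodable OCACode := Primcodable.ofEquiv _ OCACode.equivProd

/-- The fields of a synthesis instance as a tuple. -/
def SynthesisInstance.equivProd : SynthesisInstance ≃ ℕ × TransducerCode × TransducerCode where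
  toFun x := (x.numLetters, x.left, x.right)
  invFun t := ⟨t.1, t.2.1, t.2.2⟩

/-- The fields of a boundedness instance as a tuple. -/
def BoundednessInstance.equivProd : BoundednessInstance ≃ ℕ × OCACode where
  toFun x := (x.numLetters, x.automaton)
  invFun t := ⟨t.1, t.2⟩

instance : Primcodable SynthesisInstance := Primcodable.ofEquiv _ SynthesisInstance.equivProd

instance : Primcodable BoundednessInstance := Primcodable.ofEquiv _ BoundednessInstance.equivProd

/-- A computable many-one reduction between promise problems. -/
def PromiseProblem.ReducesTo {ι κ : Type} [Primcodable ι] [Primcodable κ]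
    (P : PromiseProblem ι) (P' : PromiseProblem κ) : Prop :=
  ∃ f : ι → κ, Computable f ∧ ∀ x, P.promise x → P'.promise (f x) ∧ (P.yes x ↔ P'.yes (f x))

/-- Computable many-one reductions in both directions. -/
def PromiseProblem.InterReducible {ι κ : Type} [Primcodable ι] [Primcodable κ]
    (P : PromiseProblem ι) (P' : PromiseProblem κ) : Prop :=
  P.ReducesTo P' ∧ P'.ReducesTo P

/-! Over a one-letter output alphabet an output word is just a length, so an origin graph is an
input word with a number attached to each position and to its end. The pivot is
`hasRationalResynchronizer_iff_lag`: a rational resynchronizer exists exactly when, for some `k`,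
every successful run of the left transducer has a partner run of the right one on the same input,
with the same total output, such that the outputs produced so far differ by at most `k` at every
letter boundary. A bounded difference fits into the state of a resynchronizer that copies input
letters and moves output letters. Conversely, the gap between what a resynchronizer has read and
written depends on its state alone, because every successful completion has to compensate it; so it
is bounded. Real-time outputs then turn a bounded offset in the input into a bounded offset in the
output.

From (S) to (B), the letters are the transitions and the final pairs of the left transducer `M`, so
that a word may spell a run, followed by arbitrary padding. The counter automaton has three modes.
It may count the letters, which makes it universal but is useless with a bounded counter on long
words. It may find, with an empty counter, that no run is spelled. Or it may simulate the right
transducer `N` with the counter holding the absolute value of the difference and the sign kept in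
the state. Hence a bounded counter amounts to bounded lag
(`LagAutomaton.lagBounded_iff_acceptsWithin`).

From (B) to (S), an input word is a list of blocks of cells separated by letters of the OCA. Cell
`n` of a block is a set of states, meant to contain those in which the OCA can be with counter `n`
after the separators read so far. The left transducer writes one letter per input letter, so it is
functional. The right one guesses why the word does not refute acceptance: an initial state is
missing from the first cell, a rule leads from a marked configuration to an unmarked one, a final
state is marked in the last block, or a block is short. The position reached by the rule is compared
with the unmarked position through the lag, which must return to zero; a short block is certified by
a lag that rises to about half its length. If all counters stay below `k`, then an accepting run
traced through blocks longer than `k` meets an error. If the lag is at most `k`, then the word whose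
blocks have length `2k + 2` and mark exactly the reachable configurations has neither an error nor a
short block, unless the OCA accepts with counter at most `2k + 1` (`ErrorAutomaton.lagBounded_iff`).

Both constructions are primitive recursive list manipulations, and the same two maps serve the
functional variant. -/

open OneWayTransducer

/-! ### Rational resynchronizers for a one-letter output alphabet -/

/-- `Lag k d ρ v ρ' v'`: the two traces consume the same input, and if `d` is the initial
advance of the first one, then its advance stays within `[-k, k]` and ends at zero. -/
inductive Lag {α : Type} (k : ℕ) :
    ℤ → List (α × List Unit) → List Unit → List (α × List Unit) → List Unit → Prop
  | nil {d : ℤ} {v v' : List Unit} : |d| ≤ k → d + v.length = v'.length → Lag k d [] v [] v'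
  | cons {d : ℤ} {a : α} {x y v v' : List Unit} {ρ ρ' : List (α × List Unit)} : |d| ≤ k →
      Lag k (d + x.length - y.length) ρ v ρ' v' → Lag k d ((a, x) :: ρ) v ((a, y) :: ρ') v'

/-- The total length of the outputs of a trace. -/
def traceLength {α : Type} (ρ : List (α × List Unit)) : ℕ := (ρ.map fun x => x.2.length).sum

/-- A resynchronizer yields bounds for all pairs of prefixes of equal length; the recursion behind
`Lag` absorbs the outputs of the first letter into `d`. -/
theorem Lag.of_prefixes {α : Type} {k : ℕ} : ∀ (ρ ρ' : List (α × List Unit)) (v v' : List Unit)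
    (d : ℤ), ρ.map Prod.fst = ρ'.map Prod.fst →
    d + traceLength ρ + v.length = traceLength ρ' + v'.length →
    (∀ ρ₁ ρ₂ ρ₁' ρ₂', ρ = ρ₁ ++ ρ₂ → ρ' = ρ₁' ++ ρ₂' → ρ₁.length = ρ₁'.length →
      |d + traceLength ρ₁ - traceLength ρ₁'| ≤ k) → Lag k d ρ v ρ' v'
  | [], [], v, v', d, _, ht, hp => by
    refine .nil ?_ ?_
    · simpa [traceLength] using hp [] [] [] [] rfl rfl rfl
    · simpa [traceLength] using ht
  | [], _ :: _, _, _, _, h, _, _ => by simp at h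
  | _ :: _, [], _, _, _, h, _, _ => by simp at h
  | (a, x) :: ρ, (b, y) :: ρ', v, v', d, h, ht, hp => by
    simp only [List.map_cons, List.cons.injEq] at h
    obtain ⟨rfl, h⟩ := h
    refine .cons ?_ (Lag.of_prefixes ρ ρ' v v' _ h ?_ ?_)
    · simpa [traceLength] using hp [] _ [] _ rfl rfl rfl
    · simp [traceLength] at ht ⊢
      omega
    · rintro ρ₁ ρ₂ ρ₁' ρ₂' rfl rfl hl
      have := hp ((a, x) :: ρ₁) ρ₂ ((a, y) :: ρ₁') ρ₂' rfl rfl (by simpa using hl)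
      simp only [traceLength, List.map_cons, List.sum_cons, Nat.cast_add] at this ⊢
      convert this using 2
      ring

theorem OneWayTransducer.Run.split {α β Q : Type} {T : OneWayTransducer α β Q} {p r : Q}
    {ρ₁ ρ₂ : List (α × List β)} (h : T.Run p (ρ₁ ++ ρ₂) r) :
    ∃ q, T.Run p ρ₁ q ∧ T.Run q ρ₂ r := by
  induction ρ₁ generalizing p with
  | nil => exact ⟨p, .nil p, h⟩
  | cons x ρ₁ ih =>
    cases h with
    | cons h h' h'' =>
      obtain ⟨q, h₁, h₂⟩ := ih h''
      exact ⟨q, .cons h h' h₁, h₂⟩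

theorem OneWayTransducer.Run.append {α β Q : Type} {T : OneWayTransducer α β Q} {p q r : Q}
    {ρ₁ ρ₂ : List (α × List β)} (h : T.Run p ρ₁ q) (h' : T.Run q ρ₂ r) :
    T.Run p (ρ₁ ++ ρ₂) r := by
  induction h with
  | nil => exact h'
  | cons h₁ h₂ _ ih => exact .cons h₁ h₂ (ih h')

/-! #### Resynchronizers from bounded lag -/

/-- The resynchronizer that shifts outputs as long as the advance of the given
word stays in `[-K, K]`; the advance is the state. -/
def lagResynchronizer (α : Type) (K : ℕ) :
    OneWayTransducer (α ⊕ Unit) (α ⊕ Unit) (Set.Icc (-K : ℤ) K) where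
  init := {q | q.1 = 0}
  final := {q | 0 ≤ q.1}
  edges := Set.univ
  out p a q := {w | match a with
    | .inl b => ∃ j : ℕ, p.1 = q.1 + j ∧ w = .inl b :: List.replicate j (.inr ())
    | .inr _ => q.1 = p.1 + 1 ∧ w = []}
  finalOut q := {w | w = List.replicate q.1.toNat (.inr ())}
  out_regular p a q _ := by
    refine Language.isRegular_of_finite ?_
    rcases a with b | b
    · refine Set.Finite.subset (Set.finite_singleton
        (Sum.inl b :: List.replicate (p.1 - q.1).toNat (.inr ()))) ?_
      rintro w ⟨j, hj, rfl⟩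
      have : (p.1 - q.1).toNat = j := by omega
      simp [this]
    · exact Set.Finite.subset (Set.finite_singleton []) fun w hw => hw.2
  finalOut_regular q _ := Language.isRegular_of_finite (Set.finite_singleton _)

@[simp] theorem inputProj_nil {α β : Type} : inputProj ([] : List (α ⊕ β)) = [] := rfl
@[simp] theorem outputProj_nil {α β : Type} : outputProj ([] : List (α ⊕ β)) = [] := rfl
@[simp] theorem inputProj_inl {α β : Type} (a : α) (w : List (α ⊕ β)) :
    inputProj (.inl a :: w) = a :: inputProj w := rfl
@[simp] theorem inputProj_inr {α β : Type} (b : β) (w : List (α ⊕ β)) :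
    inputProj (.inr b :: w) = inputProj w := rfl
@[simp] theorem outputProj_inl {α β : Type} (a : α) (w : List (α ⊕ β)) :
    outputProj (.inl a :: w) = outputProj w := rfl
@[simp] theorem outputProj_inr {α β : Type} (b : β) (w : List (α ⊕ β)) :
    outputProj (.inr b :: w) = b :: outputProj w := rfl
@[simp] theorem inputProj_append {α β : Type} (w w' : List (α ⊕ β)) :
    inputProj (w ++ w') = inputProj w ++ inputProj w' := List.filterMap_append
@[simp] theorem outputProj_append {α β : Type} (w w' : List (α ⊕ β)) :
    outputProj (w ++ w') = outputProj w ++ outputProj w' := List.filterMap_append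
@[simp] theorem inputProj_map_inr {α β : Type} (v : List β) :
    inputProj (v.map (Sum.inr : β → α ⊕ β)) = [] := by
  induction v <;> simp_all
@[simp] theorem outputProj_map_inr {α β : Type} (v : List β) :
    outputProj (v.map (Sum.inr : β → α ⊕ β)) = v := by
  induction v <;> simp_all

@[simp] theorem syncWord_nil {α β : Type} (v : List β) :
    syncWord ([] : List (α × List β)) v = v.map Sum.inr := rfl
theorem syncWord_cons {α β : Type} (a : α) (x v : List β) (ρ : List (α × List β)) :
    syncWord ((a, x) :: ρ) v = .inl a :: (x.map Sum.inr ++ syncWord ρ v) := by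
  simp [syncWord]
theorem syncWord_append {α β : Type} (ρ₁ ρ₂ : List (α × List β)) (v : List β) :
    syncWord (ρ₁ ++ ρ₂) v = syncWord ρ₁ [] ++ syncWord ρ₂ v := by
  simp [syncWord]
@[simp] theorem inputProj_syncWord {α β : Type} (ρ : List (α × List β)) (v : List β) :
    inputProj (syncWord ρ v) = ρ.map Prod.fst := by
  induction ρ with
  | nil => simp
  | cons x ρ ih => obtain ⟨a, x⟩ := x; simp [syncWord_cons, ih]
theorem length_outputProj_syncWord {α : Type} (ρ : List (α × List Unit)) (v : List Unit) :
    (outputProj (syncWord ρ v)).length = traceLength ρ + v.length := by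
  induction ρ with
  | nil => simp [traceLength]
  | cons x ρ ih =>
    obtain ⟨a, x⟩ := x
    simp only [syncWord_cons, outputProj_inl, outputProj_append, outputProj_map_inr,
      List.length_append, ih, traceLength, List.map_cons, List.sum_cons]
    ring

theorem map_inr_eq_replicate {α : Type} (v : List Unit) :
    v.map (Sum.inr : Unit → α ⊕ Unit) = List.replicate v.length (.inr ()) := by
  induction v <;> simp_all [List.replicate_succ]

/-- The state counts output letters read minus output letters written, and every transition respects
this, while input letters are copied immediately. -/
theorem lagResynchronizer_run {α : Type} {K : ℕ} {p q : Set.Icc (-K : ℤ) K}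
    {ρ : List ((α ⊕ Unit) × List (α ⊕ Unit))} (h : (lagResynchronizer α K).Run p ρ q) :
    inputProj (ρ.map Prod.fst) = inputProj (ρ.map Prod.snd).flatten ∧
      p.1 + (outputProj (ρ.map Prod.fst)).length =
        q.1 + (outputProj (ρ.map Prod.snd).flatten).length := by
  induction h with
  | nil => simp
  | @cons p q r a v ρ _ hv _ ih =>
    obtain ⟨ih₁, ih₂⟩ := ih
    rcases a with a | a
    · obtain ⟨j, hj, rfl⟩ := hv
      have := map_inr_eq_replicate (α := α) (List.replicate j ())
      simp only [List.length_replicate] at this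
      simp only [List.map_cons, inputProj_inl, List.flatten_cons, List.cons_append,
        inputProj_append, outputProj_inl, outputProj_append, ← this, inputProj_map_inr,
        outputProj_map_inr, List.length_append, List.length_replicate, ih₁, List.nil_append,
        true_and]
      push_cast
      omega
    · obtain ⟨hq, rfl⟩ := hv
      simp only [List.map_cons, inputProj_inr, List.flatten_cons, List.nil_append,
        outputProj_inr, List.length_cons, ih₁, true_and]
      push_cast
      omega

/-- The final output writes the surplus that is left, so the numbers of output letters agree; with
one output letter this already gives equal projections. -/
theorem isRationalResynchronizer_lagResynchronizer (α : Type) (K : ℕ) :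
    IsRationalResynchronizer (lagResynchronizer α K) := by
  rintro w w' ⟨ρ, v, ⟨p, hp, q, hq, hr, hv⟩, h⟩
  obtain ⟨rfl, rfl⟩ := Prod.mk.inj h
  obtain ⟨h₁, h₂⟩ := lagResynchronizer_run hr
  have hp : p.1 = 0 := hp
  have hq : 0 ≤ q.1 := hq
  obtain rfl : v = _ := hv
  have := map_inr_eq_replicate (α := α) (List.replicate q.1.toNat ())
  simp only [List.length_replicate] at this
  rw [← this]
  refine ⟨by simp only [inputProj_append, inputProj_map_inr, h₁, List.append_nil], ?_⟩
  have : ∀ x y : List Unit, x.length = y.length → x = y := fun x y h => List.ext_getElem h (by simp)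
  apply this
  simp only [outputProj_append, outputProj_map_inr, List.length_append, List.length_replicate]
  omega

theorem lagResynchronizer_run_outputs {α : Type} {K : ℕ} (p q : Set.Icc (-K : ℤ) K) (v : List Unit)
    (h : q.1 = p.1 + v.length) :
    (lagResynchronizer α K).Run p (v.map fun _ => (.inr (), [])) q := by
  induction v generalizing p with
  | nil =>
    obtain rfl : q = p := Subtype.ext (by simpa using h)
    exact .nil q
  | cons x v ih =>
    simp only [List.length_cons] at h
    push_cast at h
    have hp := p.2
    have hq := q.2
    simp only [Set.mem_Icc] at hp hq
    exact .cons (q := ⟨p.1 + 1, by simp only [Set.mem_Icc]; omega⟩) trivial ⟨rfl, rfl⟩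
      (ih _ (by simp only; omega))

/-- The second trace is read and the first one written, so the state is `-d` at letter boundaries.
The margin `B` is needed because the output `x` of a letter is written before `y` is read, and
because the surplus at the end is the length of `v`. -/
theorem Lag.lagResynchronizer_run {α : Type} {k B : ℕ} {d : ℤ} {ρ ρ' : List (α × List Unit)}
    {v v' : List Unit} (h : Lag k d ρ v ρ' v') (hρ : ∀ x ∈ ρ, x.2.length ≤ B) (hv : v.length ≤ B)
    (p : Set.Icc (-(k + B : ℕ) : ℤ) (k + B : ℕ)) (hp : p.1 = -d) :
    ∃ σ q, (lagResynchronizer α (k + B)).Run p σ q ∧ q.1 = v.length ∧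
      σ.map Prod.fst = syncWord ρ' v' ∧
      (σ.map Prod.snd).flatten ++ v.map Sum.inr = syncWord ρ v := by
  induction h generalizing p with
  | @nil d v v' hd hvv =>
    refine ⟨v'.map fun _ => (.inr (), []), ⟨v.length, ?_⟩,
      lagResynchronizer_run_outputs _ _ v' (by simp only; omega), rfl, ?_, ?_⟩
    · simp only [Set.mem_Icc]; omega
    · simp [map_inr_eq_replicate]
    · simp
  | @cons d a x y v v' ρ ρ' hd hl ih =>
    simp only [List.mem_cons, forall_eq_or_imp] at hρ
    have hd' : |d + x.length - y.length| ≤ k := by cases hl <;> assumption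
    rw [abs_le] at hd hd'
    have hx := hρ.1
    obtain ⟨σ, q, hr, hq, h₁, h₂⟩ := ih hρ.2 hv
      ⟨-(d + x.length - y.length), by simp only [Set.mem_Icc]; push_cast; omega⟩ rfl
    -- All of `x` is emitted together with the letter `a`; the letters of `y` are then absorbed one
    -- at a time.
    refine ⟨(.inl a, .inl a :: x.map Sum.inr) :: (y.map (fun _ => (.inr (), [])) ++ σ), q,
      .cons (q := ⟨-d - x.length, by simp only [Set.mem_Icc]; push_cast; omega⟩) trivial
        ⟨x.length, by simp [hp], by rw [map_inr_eq_replicate]⟩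
        ((lagResynchronizer_run_outputs _ _ y (by simp only; omega)).append hr), hq, ?_, ?_⟩
    · simp [syncWord_cons, h₁, map_inr_eq_replicate]
    · simp [syncWord_cons, ← h₂]

theorem OneWayTransducer.Run.length_le {α β Q : Type} {T : OneWayTransducer α β Q} {B : ℕ}
    (hB : ∀ p a q, (p, a, q) ∈ T.edges → ∀ v ∈ T.out p a q, v.length ≤ B) {p q : Q}
    {ρ : List (α × List β)} (h : T.Run p ρ q) : ∀ x ∈ ρ, x.2.length ≤ B := by
  induction h with
  | nil => simp
  | cons he hx _ ih =>
    simp only [List.mem_cons, forall_eq_or_imp]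
    exact ⟨hB _ _ _ he _ hx, ih⟩

theorem hasRationalResynchronizer_of_lag {α Q₁ Q₂ : Type} {T₁ : OneWayTransducer α Unit Q₁}
    {T₂ : OneWayTransducer α Unit Q₂} (h₁ : T₁.RealTime) {k : ℕ}
    (h : ∀ ρ v, T₁.Accepts ρ v → ∃ ρ' v', T₂.Accepts ρ' v' ∧ Lag k 0 ρ v ρ' v') :
    HasRationalResynchronizer T₁ T₂ := by
  obtain ⟨B, hB, hB'⟩ := h₁
  refine ⟨_, (Set.finite_Icc _ _).to_subtype, lagResynchronizer α (k + B),
    isRationalResynchronizer_lagResynchronizer _ _, ?_⟩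
  rintro _ ⟨ρ, v, hacc, rfl⟩
  obtain ⟨ρ', v', hacc', hl⟩ := h ρ v hacc
  obtain ⟨p, hp, q, hq, hr, hv⟩ := hacc
  obtain ⟨σ, r, hσ, hr, e₁, e₂⟩ := hl.lagResynchronizer_run (hr.length_le hB) (hB' _ hq _ hv)
    ⟨0, by simp; omega⟩ (by simp)
  refine ⟨_, ⟨ρ', v', hacc', rfl⟩, σ, v.map Sum.inr, ⟨_, rfl, r, ?_, hσ, ?_⟩, ?_⟩
  · show 0 ≤ r.1
    omega
  · show _ = _
    rw [map_inr_eq_replicate, hr]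
    simp
  · rw [e₁, e₂]

/-! #### Bounded lag from resynchronizers -/

/-- Along successful runs of a rational resynchronizer, the projections of the words read and
written so far differ in length by a bounded number only. -/
theorem IsRationalResynchronizer.exists_bound {α β Q : Type} [Finite Q]
    {R : OneWayTransducer (α ⊕ β) (α ⊕ β) Q} (hR : IsRationalResynchronizer R) :
    ∃ D : ℕ, ∀ p ∈ R.init, ∀ σ₁ q, R.Run p σ₁ q → ∀ σ₂ r, R.Run q σ₂ r → r ∈ R.final →
      ∀ v ∈ R.finalOut r,
      |((inputProj (σ₁.map Prod.fst)).length : ℤ)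
        - (inputProj (σ₁.map Prod.snd).flatten).length| ≤ D ∧
      |((outputProj (σ₁.map Prod.fst)).length : ℤ)
        - (outputProj (σ₁.map Prod.snd).flatten).length| ≤ D := by
  -- The whole run preserves both projections, so a gap after `σ₁` is exactly cancelled by what
  -- follows.
  have key : ∀ p ∈ R.init, ∀ σ₁ q, R.Run p σ₁ q → ∀ σ₂ r, R.Run q σ₂ r → r ∈ R.final →
      ∀ v ∈ R.finalOut r,
      ((inputProj (σ₁.map Prod.fst)).length : ℤ) - (inputProj (σ₁.map Prod.snd).flatten).length
        = (inputProj ((σ₂.map Prod.snd).flatten ++ v)).length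
          - (inputProj (σ₂.map Prod.fst)).length ∧
      ((outputProj (σ₁.map Prod.fst)).length : ℤ) - (outputProj (σ₁.map Prod.snd).flatten).length
        = (outputProj ((σ₂.map Prod.snd).flatten ++ v)).length
          - (outputProj (σ₂.map Prod.fst)).length := by
    intro p hp σ₁ q h₁ σ₂ r h₂ hr v hv
    obtain ⟨e₁, e₂⟩ := hR _ _ ⟨σ₁ ++ σ₂, v, ⟨p, hp, r, hr, h₁.append h₂, hv⟩, rfl⟩
    have e₁ := congrArg List.length e₁
    have e₂ := congrArg List.length e₂
    simp only [List.map_append, inputProj_append, outputProj_append, List.length_append,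
      List.flatten_append] at e₁ e₂ ⊢
    push_cast
    omega
  have hq : ∀ q : Q, ∃ D : ℕ, ∀ p ∈ R.init, ∀ σ₁, R.Run p σ₁ q → ∀ σ₂ r, R.Run q σ₂ r →
      r ∈ R.final → ∀ v ∈ R.finalOut r,
      |((inputProj (σ₁.map Prod.fst)).length : ℤ)
        - (inputProj (σ₁.map Prod.snd).flatten).length| ≤ D ∧
      |((outputProj (σ₁.map Prod.fst)).length : ℤ)
        - (outputProj (σ₁.map Prod.snd).flatten).length| ≤ D := by
    intro q
    -- One fixed completion from `q` determines the gap for every `σ₁` that reaches `q`. Without a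
    -- successful completion nothing is claimed about `q`.
    by_cases h : ∃ σ₂ r, R.Run q σ₂ r ∧ r ∈ R.final ∧ ∃ v, v ∈ R.finalOut r
    · obtain ⟨σ₂, r, h₂, hr, v, hv⟩ := h
      refine ⟨(|((inputProj ((σ₂.map Prod.snd).flatten ++ v)).length : ℤ)
          - (inputProj (σ₂.map Prod.fst)).length| +
        |((outputProj ((σ₂.map Prod.snd).flatten ++ v)).length : ℤ)
          - (outputProj (σ₂.map Prod.fst)).length|).toNat, ?_⟩
      intro p hp σ₁ h₁ _ _ _ _ _ _
      obtain ⟨e₁, e₂⟩ := key p hp σ₁ q h₁ σ₂ r h₂ hr v hv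
      rw [e₁, e₂, Int.toNat_of_nonneg (by positivity)]
      exact ⟨le_add_of_nonneg_right (abs_nonneg _), le_add_of_nonneg_left (abs_nonneg _)⟩
    · refine ⟨0, fun p _ σ₁ _ σ₂ r h₂ hr v hv => (h ⟨σ₂, r, h₂, hr, v, hv⟩).elim⟩
  choose D hD using hq
  obtain ⟨M, hM⟩ := Finite.exists_le D
  refine ⟨M, fun p hp σ₁ q h₁ σ₂ r h₂ hr v hv => ?_⟩
  have := hD q p hp σ₁ h₁ σ₂ r h₂ hr v hv
  have hM : (D q : ℤ) ≤ M := by exact_mod_cast hM q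
  exact ⟨this.1.trans hM, this.2.trans hM⟩

/-- At most `j` output letters precede the first input letter, and at most `b` follow any input
letter directly. -/
inductive SparseOutputs {α : Type} (b : ℕ) : ℕ → List (α ⊕ Unit) → Prop
  | nil (j : ℕ) : SparseOutputs b j []
  | inl (j : ℕ) (a : α) {w} : SparseOutputs b b w → SparseOutputs b j (.inl a :: w)
  | inr (j : ℕ) {w} : SparseOutputs b j w → SparseOutputs b (j + 1) (.inr () :: w)

theorem SparseOutputs.mono {α : Type} {b j j' : ℕ} {w : List (α ⊕ Unit)}
    (h : SparseOutputs b j w) (hj : j ≤ j') : SparseOutputs b j' w := by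
  induction h generalizing j' with
  | nil => exact .nil _
  | inl j a h _ => exact .inl _ a h
  | inr j _ ih =>
    obtain ⟨i, rfl⟩ : ∃ i, j' = i + 1 := ⟨j' - 1, by omega⟩
    exact .inr _ (ih (by omega))

theorem SparseOutputs.of_append_left {α : Type} {b j : ℕ} {w w' : List (α ⊕ Unit)}
    (h : SparseOutputs b j (w ++ w')) : SparseOutputs b j w := by
  induction w generalizing j with
  | nil => exact .nil _
  | cons x w ih =>
    cases h with
    | inl _ a h => exact .inl _ a (ih h)
    | inr _ h => exact .inr _ (ih h)

theorem SparseOutputs.of_append_right {α : Type} {b j : ℕ} {w w' : List (α ⊕ Unit)} (hj : j ≤ b)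
    (h : SparseOutputs b j (w ++ w')) : SparseOutputs b b w' := by
  induction w generalizing j with
  | nil => exact h.mono hj
  | cons x w ih =>
    cases h with
    | inl _ a h => exact ih le_rfl h
    | inr _ h => exact ih (by omega) h

theorem SparseOutputs.length_le {α : Type} {b j : ℕ} {w : List (α ⊕ Unit)}
    (h : SparseOutputs b j w) : (outputProj w).length ≤ j + b * (inputProj w).length := by
  induction h with
  | nil => simp
  | inl j a _ ih => simp only [outputProj_inl, inputProj_inl, List.length_cons]; linarith
  | inr j _ ih => simp only [outputProj_inr, inputProj_inr, List.length_cons]; linarith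

theorem SparseOutputs.map_inr_append {α : Type} {b j : ℕ} {w : List (α ⊕ Unit)} (v : List Unit)
    (h : SparseOutputs b j w) : SparseOutputs b (v.length + j) (v.map Sum.inr ++ w) := by
  induction v with
  | nil => simpa using h
  | cons x v ih =>
    have := ih.inr
    simpa [Nat.add_right_comm] using this

/-- The factor 2 is due to the last input letter, which is followed by its own output and by the
final output. -/
theorem sparseOutputs_syncWord {α : Type} {B : ℕ} {v : List Unit} (hv : v.length ≤ B)
    (ρ : List (α × List Unit)) (hρ : ∀ x ∈ ρ, x.2.length ≤ B) :
    SparseOutputs (2 * B) B (syncWord ρ v) := by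
  induction ρ with
  | nil =>
    have := SparseOutputs.map_inr_append v (SparseOutputs.nil (α := α) (b := 2 * B) 0)
    rw [List.append_nil] at this
    exact this.mono (by omega)
  | cons x ρ ih =>
    obtain ⟨a, x⟩ := x
    simp only [List.mem_cons, forall_eq_or_imp] at hρ
    rw [syncWord_cons]
    exact .inl _ a ((SparseOutputs.map_inr_append x (ih hρ.2)).mono (by have := hρ.1; omega))

/-- When the resynchronizer has read a prefix of the right-hand word, it has written a prefix of the
left-hand word with nearly as many input letters. Sparsity of outputs bounds how far this is, in
output letters, from the left-hand prefix with the same number of input letters. -/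
theorem exists_lag_of_hasRationalResynchronizer {α Q₁ Q₂ : Type} {T₁ : OneWayTransducer α Unit Q₁}
    {T₂ : OneWayTransducer α Unit Q₂} (h₁ : T₁.RealTime) (h : HasRationalResynchronizer T₁ T₂) :
    ∃ k, ∀ ρ v, T₁.Accepts ρ v → ∃ ρ' v', T₂.Accepts ρ' v' ∧ Lag k 0 ρ v ρ' v' := by
  obtain ⟨B, hB, hB'⟩ := h₁
  obtain ⟨Q, _, R, hR, hsub⟩ := h
  obtain ⟨D, hD⟩ := hR.exists_bound
  -- At most `D` input letters lie between the two prefixes of the left-hand word, hence at most `2B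
  -- + 2BD` output letters; the last `D` is the gap in outputs between reading and writing.
  refine ⟨2 * B + 2 * B * D + D, fun ρ v hacc => ?_⟩
  obtain ⟨_, ⟨ρ', v', hacc', rfl⟩, σ, u, ⟨p, hp, r, hr, hσ, hu⟩, hw⟩ := hsub ⟨ρ, v, hacc, rfl⟩
  obtain ⟨hin, hout⟩ := hR _ _ ⟨σ, u, ⟨p, hp, r, hr, hσ, hu⟩, hw⟩
  replace hw := Prod.mk.inj hw
  obtain ⟨hw', hw⟩ := hw
  refine ⟨ρ', v', hacc', Lag.of_prefixes _ _ _ _ _ (by simpa using hin.symm) ?_ ?_⟩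
  · have := congrArg List.length hout
    rw [length_outputProj_syncWord, length_outputProj_syncWord] at this
    omega
  have hsp : SparseOutputs (2 * B) B (syncWord ρ v) := by
    obtain ⟨p, hp, q, hq, hr, hv⟩ := hacc
    exact sparseOutputs_syncWord (hB' _ hq _ hv) _ (hr.length_le hB)
  rintro ρ₁ ρ₂ ρ₁' ρ₂' rfl rfl hl
  rw [syncWord_append] at hw'
  -- The run of the resynchronizer is cut where it has read precisely the word of `ρ₁'`.
  obtain ⟨σ₁, σ₂, rfl, e₁, e₂⟩ := List.map_eq_append_iff.1 hw'.symm
  obtain ⟨q, hr₁, hr₂⟩ := hσ.split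
  obtain ⟨b₁, b₂⟩ := hD p hp σ₁ q hr₁ σ₂ r hr₂ hr u hu
  rw [e₁, inputProj_syncWord, List.length_map, ← hl] at b₁
  rw [e₁, length_outputProj_syncWord] at b₂
  rw [syncWord_append, List.map_append, List.flatten_append, List.append_assoc] at hw
  rw [syncWord_append] at hsp
  have hi : (inputProj (syncWord ρ₁ ([] : List Unit))).length = ρ₁.length := by simp
  have ho := length_outputProj_syncWord ρ₁ []
  simp only [List.length_nil, Nat.add_zero] at ho b₂
  rw [abs_le] at b₁ b₂ ⊢
  rcases List.append_eq_append_iff.1 hw with ⟨z, hz, hz'⟩ | ⟨z, hz, hz'⟩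
  · -- the resynchronizer is ahead of the first transducer
    have hz1 := (hsp.of_append_right (by omega))
    rw [hz'] at hz1
    have hz2 := hz1.of_append_left.length_le
    rw [hz] at b₁ b₂
    simp only [inputProj_append, outputProj_append, List.length_append, hi, ho] at b₁ b₂
    have : 2 * B * (inputProj z).length ≤ 2 * B * D := Nat.mul_le_mul_left _ (by omega)
    push_cast at b₁ b₂ ⊢
    zify at this hz2
    constructor <;> linarith
  -- The resynchronizer is behind: `z` is the part of the word of `ρ₁` that is still to be written.
  · have hz1 := hsp.of_append_left
    rw [hz] at hz1
    have hz2 := (hz1.of_append_right (by omega)).length_le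
    rw [hz] at hi ho
    simp only [inputProj_append, outputProj_append, List.length_append] at hi ho
    have : 2 * B * (inputProj z).length ≤ 2 * B * D := Nat.mul_le_mul_left _ (by omega)
    push_cast at b₁ b₂ ⊢
    zify at this hz2 hi ho
    constructor <;> linarith

theorem hasRationalResynchronizer_iff_lag {α Q₁ Q₂ : Type} {T₁ : OneWayTransducer α Unit Q₁}
    {T₂ : OneWayTransducer α Unit Q₂} (h₁ : T₁.RealTime) :
    HasRationalResynchronizer T₁ T₂ ↔
      ∃ k, ∀ ρ v, T₁.Accepts ρ v → ∃ ρ' v', T₂.Accepts ρ' v' ∧ Lag k 0 ρ v ρ' v' :=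
  ⟨exists_lag_of_hasRationalResynchronizer h₁, fun ⟨_, h⟩ => hasRationalResynchronizer_of_lag h₁ h⟩

/-! ### Automata given by lists -/

/-- A transducer with a one-letter output alphabet: a transition `(s, a, w, s')` outputs a
word of length `w`, and so does a pair `(s, w)` of a final state at the end of the input. -/
structure WeightedAutomaton (S A : Type) where
  init : List S
  final : List (S × ℕ)
  trans : List (S × A × ℕ × S)

namespace WeightedAutomaton

variable {S A S' A' : Type}

/-- There is a path from the given state to a final state which has the given letters and output
lengths. -/
inductive Path (M : WeightedAutomaton S A) : S → List (A × ℕ) → ℕ → Prop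
  | nil {s : S} {x : ℕ} : (s, x) ∈ M.final → Path M s [] x
  | cons {s s' : S} {a : A} {x y : ℕ} {ρ : List (A × ℕ)} :
      (s, a, x, s') ∈ M.trans → Path M s' ρ y → Path M s ((a, x) :: ρ) y

/-- There is a path from the given state to a final state whose total output, after an initial
difference, is the one given, and which never differs from it by more than `k`. -/
inductive Matches (M : WeightedAutomaton S A) (k : ℕ) : S → ℤ → List (A × ℕ) → ℕ → Prop
  | nil {s : S} {d : ℤ} {x y : ℕ} : (s, y) ∈ M.final → |d| ≤ k → d + x = y → Matches M k s d [] x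
  | cons {s s' : S} {d : ℤ} {a : A} {x y z : ℕ} {ρ : List (A × ℕ)} :
      (s, a, y, s') ∈ M.trans → |d| ≤ k → Matches M k s' (d + x - y) ρ z →
      Matches M k s d ((a, x) :: ρ) z

/-- For some `k`, every path of `M` is matched by one of `N` with a difference of at most `k`. -/
def LagBounded (M : WeightedAutomaton S A) (N : WeightedAutomaton S' A) : Prop :=
  ∃ k, ∀ s ∈ M.init, ∀ ρ x, M.Path s ρ x → ∃ s' ∈ N.init, N.Matches k s' 0 ρ x

/-- The description `c` over the input alphabet `Fin m` presents `M`, up to an encoding of states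
and letters. -/
structure IsCode (M : WeightedAutomaton S A) (c : TransducerCode) (m : ℕ) (f : S → ℕ) (g : A → ℕ) :
    Prop where
  init : ∀ i, (i ∈ c.init ∧ i < c.numStates) ↔ ∃ s ∈ M.init, f s = i
  final : ∀ i v, ((i, v) ∈ c.final ∧ i < c.numStates) ↔
    ∃ s, (s, v.length) ∈ M.final ∧ f s = i
  trans : ∀ i a v j, ((i, a, v, j) ∈ c.trans ∧ i < c.numStates ∧ a < m ∧ j < c.numStates) ↔
    ∃ s b s', (s, b, v.length, s') ∈ M.trans ∧ f s = i ∧ g b = a ∧ f s' = j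

variable {M : WeightedAutomaton S A} {N : WeightedAutomaton S' A} {c c' : TransducerCode} {m : ℕ}
  {f : S → ℕ} {f' : S' → ℕ} {g : A → ℕ}

/-- Each rule used by the run decodes separately; injectivity of `f` makes its decoded source agree
with the decoded target of the preceding rule. -/
theorem IsCode.path_of_run (h : M.IsCode c m f g) (hf : f.Injective) {p q : Fin c.numStates}
    {ρ : List (Fin m × List Unit)} {v : List Unit} (hr : (c.toTransducer m).Run p ρ q)
    (hv : v ∈ (c.toTransducer m).finalOut q) {s : S} (hs : f s = p) :
    ∃ ρ₀, M.Path s ρ₀ v.length ∧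
      ρ.map (fun x => (x.1.val, x.2.length)) = ρ₀.map fun x => (g x.1, x.2) := by
  induction hr generalizing s with
  | nil q =>
    obtain ⟨t, ht, e⟩ := (h.final _ _).1 ⟨hv, q.2⟩
    obtain rfl := hf (e.trans hs.symm)
    exact ⟨[], .nil ht, rfl⟩
  | @cons p q r a x ρ he hx hr ih =>
    obtain ⟨t, b, t', ht, e, eb, e'⟩ := (h.trans _ _ _ _).1 ⟨hx, p.2, a.2, q.2⟩
    obtain rfl := hf (e.trans hs.symm)
    obtain ⟨ρ₀, hρ, e⟩ := ih hv e'
    exact ⟨_, .cons ht hρ, by simp [e, eb]⟩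

theorem IsCode.run_of_path (h : M.IsCode c m f g) {s : S} {ρ₀ : List (A × ℕ)} {x : ℕ}
    (hs : M.Path s ρ₀ x) (p : Fin c.numStates) (hp : f s = p) :
    ∃ ρ q, (c.toTransducer m).Run p ρ q ∧ q ∈ (c.toTransducer m).final ∧
      List.replicate x () ∈ (c.toTransducer m).finalOut q ∧
      ρ.map (fun x => (x.1.val, x.2.length)) = ρ₀.map fun x => (g x.1, x.2) := by
  induction hs generalizing p with
  | @nil s x hs =>
    have := (h.final p (List.replicate x ())).2 ⟨s, by simpa using hs, hp⟩
    exact ⟨[], p, .nil p, ⟨_, this.1⟩, this.1, rfl⟩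
  | @cons s s' a x y ρ₀ hs _ ih =>
    obtain ⟨ht, -, ha, hs'⟩ := (h.trans p (g a) (List.replicate x ()) (f s')).2
      ⟨s, a, s', by simpa using hs, hp, rfl, rfl⟩
    obtain ⟨ρ, q, hr, hq, hv, e⟩ := ih ⟨f s', hs'⟩ rfl
    have ht' : List.replicate x () ∈ (c.toTransducer m).out p ⟨g a, ha⟩ ⟨f s', hs'⟩ := ht
    exact ⟨(⟨g a, ha⟩, List.replicate x ()) :: ρ, q, .cons ⟨_, ht⟩ ht' hr, hq, hv, by simp [e]⟩

/-- Injectivity of `g` is what lets the decoded letters of the two traces be identified. -/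
theorem IsCode.matches_of_lag (h : M.IsCode c m f g) (hf : f.Injective) (hg : g.Injective) {k : ℕ}
    {d : ℤ} {ρ ρ' : List (Fin m × List Unit)} {v v' : List Unit} (hl : Lag k d ρ v ρ' v')
    {p q : Fin c.numStates} (hr : (c.toTransducer m).Run p ρ' q)
    (hv : v' ∈ (c.toTransducer m).finalOut q) {s : S} (hs : f s = p) {ρ₀ : List (A × ℕ)}
    (e : ρ.map (fun x => (x.1.val, x.2.length)) = ρ₀.map fun x => (g x.1, x.2)) :
    M.Matches k s d ρ₀ v.length := by
  induction hl generalizing p s ρ₀ with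
  | nil hd hvv =>
    cases hr
    obtain ⟨t, ht, e'⟩ := (h.final _ _).1 ⟨hv, q.2⟩
    obtain rfl := hf (e'.trans hs.symm)
    obtain rfl : ρ₀ = [] := by simpa using e.symm
    exact .nil ht hd hvv
  | @cons d a x y v v' ρ ρ' hd hl ih =>
    cases hr with
    | @cons _ p' _ _ _ _ he hy hr =>
      obtain ⟨t, b, t', ht, e', eb, e''⟩ := (h.trans _ _ _ _).1 ⟨hy, p.2, a.2, p'.2⟩
      obtain rfl := hf (e'.trans hs.symm)
      obtain ⟨⟨b', x'⟩, ρ₀, rfl, eb', e₀⟩ := List.map_eq_cons_iff.1 e.symm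
      simp only [Prod.mk.injEq] at eb'
      obtain ⟨eb', rfl⟩ := eb'
      obtain rfl := hg (eb.trans eb'.symm)
      exact .cons ht hd (ih hr hv e'' e₀.symm)

theorem IsCode.lag_of_matches (h : M.IsCode c m f g) {s : S} {k : ℕ} {d : ℤ} {ρ₀ : List (A × ℕ)}
    {x : ℕ} (hs : M.Matches k s d ρ₀ x) (p : Fin c.numStates) (hp : f s = p)
    {ρ : List (Fin m × List Unit)} {v : List Unit} (hx : v.length = x)
    (e : ρ.map (fun x => (x.1.val, x.2.length)) = ρ₀.map fun x => (g x.1, x.2)) :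
    ∃ ρ' v' q, (c.toTransducer m).Run p ρ' q ∧ q ∈ (c.toTransducer m).final ∧
      v' ∈ (c.toTransducer m).finalOut q ∧ Lag k d ρ v ρ' v' := by
  induction hs generalizing p ρ with
  | @nil s d x y hs hd he =>
    have := (h.final p (List.replicate y ())).2 ⟨s, by simpa using hs, hp⟩
    obtain rfl : ρ = [] := by simpa using e
    exact ⟨[], _, p, .nil p, ⟨_, this.1⟩, this.1, .nil hd (by simp [hx, he])⟩
  | @cons s s' d a x y z ρ₀ hs hd _ ih =>
    obtain ⟨⟨b, u⟩, ρ, rfl, eb, e₀⟩ := List.map_eq_cons_iff.1 e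
    simp only [Prod.mk.injEq] at eb
    obtain ⟨eb, rfl⟩ := eb
    obtain ⟨ht, -, -, hs'⟩ := (h.trans p b (List.replicate y ()) (f s')).2
      ⟨s, a, s', by simpa using hs, hp, eb.symm, rfl⟩
    obtain ⟨ρ', v', q, hr, hq, hv, hl⟩ := ih ⟨f s', hs'⟩ rfl hx e₀
    have ht' : List.replicate y () ∈ (c.toTransducer m).out p b ⟨f s', hs'⟩ := ht
    exact ⟨(b, List.replicate y ()) :: ρ', v', q, .cons ⟨_, ht⟩ ht' hr, hq, hv,
      .cons hd (by simpa using hl)⟩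

/-- From here on both reductions only deal with list automata and bounded lag; resynchronizers no
longer occur. The same letter encoding `g` must serve both sides. -/
theorem IsCode.hasRationalResynchronizer_iff (h : M.IsCode c m f g) (h' : N.IsCode c' m f' g)
    (hf : f.Injective) (hf' : f'.Injective) (hg : g.Injective) :
    HasRationalResynchronizer (c.toTransducer m) (c'.toTransducer m) ↔ M.LagBounded N := by
  rw [hasRationalResynchronizer_iff_lag (c.realTime m)]
  refine exists_congr fun k => ⟨?_, ?_⟩
  · intro H s hs ρ₀ x hp
    obtain ⟨hi, hlt⟩ := (h.init (f s)).2 ⟨s, hs, rfl⟩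
    obtain ⟨ρ, q, hr, hq, hv, e⟩ := h.run_of_path hp ⟨f s, hlt⟩ rfl
    obtain ⟨ρ', v', ⟨p', hp', q', hq', hr', hv'⟩, hl⟩ := H ρ _ ⟨_, hi, q, hq, hr, hv⟩
    obtain ⟨s', hs', e'⟩ := (h'.init _).1 ⟨hp', p'.2⟩
    refine ⟨s', hs', ?_⟩
    simpa using h'.matches_of_lag hf' hg hl hr' hv' e' e
  · rintro H ρ v ⟨p, hp, q, hq, hr, hv⟩
    obtain ⟨s, hs, e⟩ := (h.init _).1 ⟨hp, p.2⟩
    obtain ⟨ρ₀, hρ, e'⟩ := h.path_of_run hf hr hv e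
    obtain ⟨s', hs', hm⟩ := H s hs ρ₀ _ hρ
    obtain ⟨hi, hlt⟩ := (h'.init (f' s')).2 ⟨s', hs', rfl⟩
    obtain ⟨ρ', v', q', hr', hq', hv', hl⟩ := h'.lag_of_matches hm ⟨f' s', hlt⟩ rfl rfl e'
    exact ⟨ρ', v', ⟨_, hi, q', hq', hr', hv'⟩, hl⟩

end WeightedAutomaton

/-- The automaton presented by a description over the input alphabet `Fin m`. -/
def TransducerCode.toWeighted (c : TransducerCode) (m : ℕ) : WeightedAutomaton ℕ ℕ where
  init := c.init.filter (· < c.numStates)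
  final := (c.final.filter fun t => t.1 < c.numStates).map fun t => (t.1, t.2.length)
  trans := (c.trans.filter fun t => t.1 < c.numStates ∧ t.2.1 < m ∧ t.2.2.2 < c.numStates).map
    fun t => (t.1, t.2.1, t.2.2.1.length, t.2.2.2)

theorem List.eq_of_length_eq_unit {v v' : List Unit} (h : v.length = v'.length) : v = v' :=
  List.ext_getElem h (by simp)

theorem TransducerCode.isCode_toWeighted (c : TransducerCode) (m : ℕ) :
    (c.toWeighted m).IsCode c m id id where
  init i := by simp [toWeighted]
  final i v := by
    simp only [toWeighted, List.mem_map, List.mem_filter, Prod.mk.injEq, Prod.exists, id]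
    constructor
    · rintro ⟨h, h'⟩
      exact ⟨i, ⟨i, v, ⟨h, by simpa using h'⟩, rfl, rfl⟩, rfl⟩
    · rintro ⟨_, ⟨j, u, ⟨h, h'⟩, rfl, hu⟩, rfl⟩
      obtain rfl := List.eq_of_length_eq_unit hu
      exact ⟨h, by simpa using h'⟩
  trans i a v j := by
    simp only [toWeighted, List.mem_map, List.mem_filter, Prod.mk.injEq, Prod.exists, id]
    constructor
    · rintro ⟨h, h'⟩
      exact ⟨i, a, j, ⟨i, a, v, j, ⟨h, by simpa using h'⟩, rfl, rfl, rfl, rfl⟩, rfl, rfl, rfl⟩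
    · rintro ⟨_, _, _, ⟨i', a', u, j', ⟨h, h'⟩, rfl, rfl, hu, rfl⟩, rfl, rfl, rfl⟩
      obtain rfl := List.eq_of_length_eq_unit hu
      exact ⟨h, by simpa using h'⟩

/-- A description of an automaton whose states and letters are encoded by numbers. -/
def WeightedAutomaton.toCode {S A : Type} [Encodable S] [Encodable A] (M : WeightedAutomaton S A) :
    TransducerCode where
  numStates := (M.init.map Encodable.encode).sum + (M.final.map fun t => Encodable.encode t.1).sum +
    (M.trans.map fun t => Encodable.encode t.1 + Encodable.encode t.2.2.2).sum + 1
  init := M.init.map Encodable.encode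
  final := M.final.map fun t => (Encodable.encode t.1, List.replicate t.2 ())
  trans := M.trans.map fun t =>
    (Encodable.encode t.1, Encodable.encode t.2.1, List.replicate t.2.2.1 (), Encodable.encode t.2.2.2)

theorem List.le_sum_map {α : Type} {l : List α} {a : α} (f : α → ℕ) (h : a ∈ l) :
    f a ≤ (l.map f).sum :=
  List.single_le_sum (fun _ _ => Nat.zero_le _) _ (List.mem_map_of_mem h)

/-- The number of states is one more than a sum over all codes in use, so no state code is out of
range; `hm` ensures the same for letters. -/
theorem WeightedAutomaton.isCode_toCode {S A : Type} [Encodable S] [Encodable A]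
    (M : WeightedAutomaton S A) {m : ℕ} (hm : ∀ t ∈ M.trans, Encodable.encode t.2.1 < m) :
    M.IsCode M.toCode m Encodable.encode Encodable.encode where
  init i := by
    simp only [toCode, List.mem_map, and_iff_left_iff_imp]
    rintro ⟨s, hs, rfl⟩
    have := List.le_sum_map Encodable.encode hs
    omega
  final i v := by
    simp only [toCode, List.mem_map, Prod.mk.injEq, Prod.exists]
    constructor
    · rintro ⟨⟨s, x, h, rfl, rfl⟩, -⟩
      exact ⟨s, by simpa using h, rfl⟩
    · rintro ⟨s, h, rfl⟩
      refine ⟨⟨s, _, h, rfl, List.eq_of_length_eq_unit (by simp)⟩, ?_⟩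
      have := List.le_sum_map (fun t => Encodable.encode t.1) h
      dsimp only at this
      omega
  trans i a v j := by
    simp only [toCode, List.mem_map, Prod.mk.injEq, Prod.exists]
    constructor
    · rintro ⟨⟨s, b, x, s', h, rfl, rfl, rfl, rfl⟩, -⟩
      exact ⟨s, b, s', by simpa using h, rfl, rfl, rfl⟩
    · rintro ⟨s, b, s', h, rfl, rfl, rfl⟩
      refine ⟨⟨s, b, _, s', h, rfl, rfl, List.eq_of_length_eq_unit (by simp), rfl⟩, ?_⟩
      have := List.le_sum_map (fun t => Encodable.encode t.1 + Encodable.encode t.2.2.2) h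
      have := hm _ h
      dsimp only at *
      omega

/-! ### One-counter automata given by lists -/

namespace OneCounterAutomaton

variable {S : Type}

/-- The description `c` over the alphabet `Fin m` presents `M`, up to an encoding of states. -/
structure IsCode (M : OneCounterAutomaton ℕ S) (c : OCACode) (m : ℕ) (f : S → ℕ) : Prop where
  init : ∀ i, (i ∈ c.init ∧ i < c.numStates) ↔ ∃ s ∈ M.init, f s = i
  final : ∀ i, (i ∈ c.final ∧ i < c.numStates) ↔ ∃ s ∈ M.final, f s = i
  trans : ∀ i a z x j, ((i, a, z, x, j) ∈ c.trans ∧ i < c.numStates ∧ (∀ b ∈ a, b < m) ∧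
    j < c.numStates) ↔ ∃ s s', (s, a, z, x, s') ∈ M.trans ∧ f s = i ∧ f s' = j

variable {M : OneCounterAutomaton ℕ S} {c : OCACode} {m : ℕ} {f : S → ℕ}

theorem IsCode.run_of_run (h : M.IsCode c m f) (hf : f.Injective) {C : Set ℕ} {w : List (Fin m)}
    {x y : Fin c.numStates × ℕ} (hr : (c.toOCA m).Run C x w y) {s : S} (hs : f s = x.1) :
    ∃ s', f s' = y.1 ∧ M.Run C (s, x.2) (w.map Fin.val) (s', y.2) := by
  induction hr generalizing s with
  | nil hx => exact ⟨s, hs, .nil hx⟩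
  | @cons x y z a w hx hst _ ih =>
    have : ∃ s', f s' = y.1 ∧ M.Step (s, x.2) (a.map Fin.val) (s', y.2) := by
      cases hst with
      | @zero p q a j ht =>
        obtain ⟨t, t', ht', e, e'⟩ := (h.trans _ _ _ _ _).1
          ⟨ht, p.2, by
            simp only [Option.mem_def, Option.map_eq_some_iff]
            rintro _ ⟨b, _, rfl⟩
            exact b.2, q.2⟩
        obtain rfl := hf (e.trans hs.symm)
        exact ⟨t', e', .zero ht'⟩
      | @pos p q a j n ht =>
        obtain ⟨t, t', ht', e, e'⟩ := (h.trans _ _ _ _ _).1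
          ⟨ht, p.2, by
            simp only [Option.mem_def, Option.map_eq_some_iff]
            rintro _ ⟨b, _, rfl⟩
            exact b.2, q.2⟩
        obtain rfl := hf (e.trans hs.symm)
        exact ⟨t', e', .pos ht'⟩
    obtain ⟨s', hs', hst'⟩ := this
    obtain ⟨s'', hs'', hr⟩ := ih hs'
    refine ⟨s'', hs'', ?_⟩
    have := Run.cons (x := (s, x.2)) (w := w.map Fin.val) hx hst' hr
    cases a <;> simpa using this

theorem IsCode.run_of_run_map (h : M.IsCode c m f) {C : Set ℕ} {w : List ℕ} {x y : S × ℕ}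
    (hr : M.Run C x w y) (p : Fin c.numStates) (hp : f x.1 = p) {w' : List (Fin m)}
    (hw : w = w'.map Fin.val) :
    ∃ q : Fin c.numStates, f y.1 = q ∧ (c.toOCA m).Run C (p, x.2) w' (q, y.2) := by
  induction hr generalizing p w' with
  | nil hx =>
    obtain rfl : w' = [] := by simpa using hw.symm
    exact ⟨p, hp, .nil hx⟩
  | @cons x y z a w hx hst _ ih =>
    have : ∃ (q : Fin c.numStates) (a' : Option (Fin m)), f y.1 = q ∧ a'.map Fin.val = a ∧
        (c.toOCA m).Step (p, x.2) a' (q, y.2) := by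
      cases hst with
      | @zero s t a j ht =>
        obtain ⟨ht', hp', ha, hq⟩ := (h.trans _ _ _ _ _).2 ⟨s, t, ht, hp, rfl⟩
        refine ⟨⟨f t, hq⟩, a.attach.map fun b => ⟨b.1, ha _ b.2⟩, rfl, ?_, .zero ?_⟩
        · cases a <;> rfl
        · cases a <;> exact ht'
      | @pos s t a j n ht =>
        obtain ⟨ht', hp', ha, hq⟩ := (h.trans _ _ _ _ _).2 ⟨s, t, ht, hp, rfl⟩
        refine ⟨⟨f t, hq⟩, a.attach.map fun b => ⟨b.1, ha _ b.2⟩, rfl, ?_, .pos ?_⟩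
        · cases a <;> rfl
        · cases a <;> exact ht'
    obtain ⟨q, a', hq, rfl, hst'⟩ := this
    cases a' with
    | none =>
      obtain ⟨r, hr, hrun⟩ := ih q hq (w' := w') (by simpa using hw)
      exact ⟨r, hr, .cons (a := none) hx hst' hrun⟩
    | some b =>
      simp only [Option.map_some, Option.toList_some, List.singleton_append] at hw
      obtain ⟨b', w', rfl, e, rfl⟩ := List.map_eq_cons_iff.1 hw.symm
      obtain rfl := Fin.ext e
      obtain ⟨r, hr, hrun⟩ := ih q hq rfl
      exact ⟨r, hr, .cons (a := some b') hx hst' hrun⟩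

/-- Encoding changes states only and leaves all counter values alone, so the same set `C` works on
both sides. -/
theorem IsCode.acceptsWithin_iff (h : M.IsCode c m f) (hf : f.Injective) {C : Set ℕ}
    {w : List (Fin m)} : (c.toOCA m).AcceptsWithin C w ↔ M.AcceptsWithin C (w.map Fin.val) := by
  constructor
  · rintro ⟨p, hp, q, hq, n, hr⟩
    obtain ⟨s, hs, e⟩ := (h.init _).1 ⟨hp, p.2⟩
    obtain ⟨s', e', hr'⟩ := h.run_of_run hf hr e
    obtain ⟨t, ht, e''⟩ := (h.final _).1 ⟨hq, q.2⟩
    obtain rfl := hf (e''.trans e'.symm)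
    exact ⟨s, hs, t, ht, n, hr'⟩
  · rintro ⟨s, hs, t, ht, n, hr⟩
    obtain ⟨hi, hlt⟩ := (h.init (f s)).2 ⟨s, hs, rfl⟩
    obtain ⟨q, hq, hr'⟩ := h.run_of_run_map hr ⟨f s, hlt⟩ rfl rfl
    exact ⟨_, hi, q, ((h.final _).2 ⟨t, ht, hq⟩).1, n, hr'⟩

/-- The automaton given by lists of its initial states, final states and transitions. -/
def ofLists (I F : List S) (E : List (S × Option ℕ × Bool × ℕ × S)) : OneCounterAutomaton ℕ S where
  init := {s | s ∈ I}
  final := {s | s ∈ F}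
  trans := {t | t ∈ E}
  trans_finite := E.finite_toSet

end OneCounterAutomaton

/-- The transitions of a description over the alphabet `Fin m` that are not ignored. -/
def OCACode.rules (c : OCACode) (m : ℕ) : List (ℕ × Option ℕ × Bool × ℕ × ℕ) :=
  c.trans.filter fun t => t.1 < c.numStates ∧ (∀ b ∈ t.2.1.toList, b < m) ∧ t.2.2.2.2 < c.numStates

/-- The automaton presented by a description over the alphabet `Fin m`. -/
def OCACode.toLists (c : OCACode) (m : ℕ) : OneCounterAutomaton ℕ ℕ :=
  .ofLists (c.init.filter (· < c.numStates)) (c.final.filter (· < c.numStates)) (c.rules m)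

theorem OCACode.isCode_toLists (c : OCACode) (m : ℕ) : (c.toLists m).IsCode c m id where
  init i := by simp [toLists, OneCounterAutomaton.ofLists]
  final i := by simp [toLists, OneCounterAutomaton.ofLists]
  trans i a z x j := by simp [toLists, OneCounterAutomaton.ofLists, rules]

/-- A description of an automaton whose states are encoded by numbers. -/
def OCACode.ofLists {S : Type} [Encodable S] (I F : List S)
    (E : List (S × Option ℕ × Bool × ℕ × S)) : OCACode where
  numStates := (I.map Encodable.encode).sum + (F.map Encodable.encode).sum +
    (E.map fun t => Encodable.encode t.1 + Encodable.encode t.2.2.2.2).sum + 1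
  init := I.map Encodable.encode
  final := F.map Encodable.encode
  trans := E.map fun t => (Encodable.encode t.1, t.2.1, t.2.2.1, t.2.2.2.1, Encodable.encode t.2.2.2.2)

theorem OCACode.isCode_ofLists {S : Type} [Encodable S] {I F : List S}
    {E : List (S × Option ℕ × Bool × ℕ × S)} {m : ℕ} (hm : ∀ t ∈ E, ∀ b ∈ t.2.1, b < m) :
    (OneCounterAutomaton.ofLists I F E).IsCode (OCACode.ofLists I F E) m Encodable.encode where
  init i := by
    simp only [ofLists, OneCounterAutomaton.ofLists, Set.mem_ofPred_eq, List.mem_map,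
      and_iff_left_iff_imp]
    rintro ⟨s, hs, rfl⟩
    have := List.le_sum_map Encodable.encode hs
    omega
  final i := by
    simp only [ofLists, OneCounterAutomaton.ofLists, Set.mem_ofPred_eq, List.mem_map,
      and_iff_left_iff_imp]
    rintro ⟨s, hs, rfl⟩
    have := List.le_sum_map Encodable.encode hs
    omega
  trans i a z x j := by
    simp only [ofLists, OneCounterAutomaton.ofLists, Set.mem_ofPred_eq, List.mem_map, Prod.mk.injEq,
      Prod.exists]
    constructor
    · rintro ⟨⟨s, a, z, x, s', h, rfl, rfl, rfl, rfl, rfl⟩, -⟩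
      exact ⟨s, s', h, rfl, rfl⟩
    · rintro ⟨s, s', h, rfl, rfl⟩
      refine ⟨⟨s, a, z, x, s', h, rfl, rfl, rfl, rfl, rfl⟩, ?_⟩
      have := List.le_sum_map (fun t => Encodable.encode t.1 + Encodable.encode t.2.2.2.2) h
      have hb := hm _ h
      dsimp only at this hb
      refine ⟨by omega, hb, by omega⟩

/-! ### From synthesis to boundedness -/

/-- The elements of a list, numbered from `k` on. -/
def List.number {α : Type} (k : ℕ) (l : List α) : List (ℕ × α) :=
  (List.range l.length).flatMap fun i => l[i]?.toList.map fun a => (k + i, a)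

theorem List.mem_number {α : Type} {k : ℕ} {l : List α} {x : ℕ × α} :
    x ∈ l.number k ↔ ∃ i, x.1 = k + i ∧ l[i]? = some x.2 := by
  obtain ⟨n, a⟩ := x
  simp only [number, List.mem_flatMap, List.mem_range, List.mem_map, Option.mem_toList,
    Prod.mk.injEq]
  constructor
  · rintro ⟨i, _, _, h, rfl, rfl⟩
    exact ⟨i, rfl, h⟩
  · rintro ⟨i, rfl, h⟩
    exact ⟨i, (List.getElem?_eq_some_iff.1 h).1, a, h, rfl, rfl⟩

namespace LagAutomaton

/-- States of the automaton that simulates `N` on paths of `M`: plain states, states `chk l` that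
check the word read (`l` lists the possible current states of `M`), and states `sim q b u d` (`q` is
a state of `N`, or `none` after the end of the path), where the counter `c` stands for the
difference `± c + u - d`, with the sign given by `b`. -/
abbrev State : Type := Bool ⊕ List ℕ ⊕ (Option ℕ × Bool × ℕ × ℕ)

/-- The state reached when the word is accepted. -/
abbrev sink : State := .inl true
/-- The state in which letters are counted. -/
abbrev count : State := .inl false
/-- A state that checks the word. -/
abbrev chk (l : List ℕ) : State := .inr (.inl l)
/-- A state that simulates `N`. -/
abbrev sim (q : Option ℕ) (b : Bool) (u d : ℕ) : State := .inr (.inr (q, b, u, d))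

/-- The number of stack symbols that replaces a topmost symbol so that the counter is kept. -/
abbrev keep (z : Bool) : ℕ := bif z then 0 else 1

variable (M N : WeightedAutomaton ℕ ℕ)

/-- The letters that stand for transitions of `M`. -/
def transLetters : List (ℕ × ℕ × ℕ × ℕ × ℕ) := M.trans.number 0

/-- The letters that stand for final states of `M`. -/
def finalLetters : List (ℕ × ℕ × ℕ) := M.final.number M.trans.length

/-- The number of letters. -/
def numLetters : ℕ := M.trans.length + M.final.length

/-- A bound on the outputs. -/
def bound : ℕ :=
  (M.trans.map fun t => t.2.2.1).sum + (M.final.map fun t => t.2).sum +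
    (N.trans.map fun t => t.2.2.1).sum + (N.final.map fun t => t.2).sum

/-- The possible lists of current states of `M`. -/
def currents : List (List ℕ) := M.init :: M.trans.map fun t => [t.2.2.2]

/-- The transitions outside of the simulation. -/
def plainTrans : List (State × Option ℕ × Bool × ℕ × State) :=
  ((List.range (numLetters M)).flatMap fun i =>
    [(sink, some i, true, 0, sink), (count, some i, true, 1, count),
      (count, some i, false, 2, count)]) ++
  (((currents M).flatMap fun l => (transLetters M).map fun t =>
    (chk l, some t.1, true, 0, if t.2.1 ∈ l then chk [t.2.2.2.2] else sink)) ++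
  ((currents M).flatMap fun l => (finalLetters M).flatMap fun t =>
    if t.2.1 ∈ l then [] else [(chk l, some t.1, true, 0, sink)]))

/-- The transitions of the simulation that read a letter. -/
def simTrans : List (State × Option ℕ × Bool × ℕ × State) :=
  ((transLetters M).flatMap fun t => N.trans.flatMap fun e =>
    if e.2.1 = t.2.2.1 then [(true, true), (true, false), (false, true), (false, false)].map fun b =>
      (sim (some e.1) b.1 0 0, some t.1, b.2, keep b.2, sim (some e.2.2.2) b.1 t.2.2.2.1 e.2.2.1)
    else []) ++
  ((finalLetters M).flatMap fun t => N.final.flatMap fun e =>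
    [(true, true), (true, false), (false, true), (false, false)].map fun b =>
      (sim (some e.1) b.1 0 0, some t.1, b.2, keep b.2, sim none b.1 t.2.2 e.2))

/-- The moves that change the difference in direction `b`. -/
def moves (q : Option ℕ) (b : Bool) (x y : ℕ × ℕ) :
    List (State × Option ℕ × Bool × ℕ × State) :=
  [(sim q b x.1 x.2, none, true, 1, sim q b y.1 y.2),
    (sim q b x.1 x.2, none, false, 2, sim q b y.1 y.2),
    (sim q (!b) x.1 x.2, none, false, 0, sim q (!b) y.1 y.2),
    (sim q (!b) x.1 x.2, none, true, 1, sim q b y.1 y.2)]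

/-- The transitions of the simulation that read no letter. -/
def silentTrans : List (State × Option ℕ × Bool × ℕ × State) :=
  (((none :: N.trans.map fun e => some e.2.2.2).flatMap fun q =>
    (List.range (bound M N + 1)).flatMap fun u => (List.range (bound M N + 1)).flatMap fun d =>
      moves q true (u + 1, d) (u, d) ++ moves q false (u, d + 1) (u, d)) ++
  [(sim none true 0 0, none, true, 0, sink), (sim none false 0 0, none, true, 0, sink)])

/-- All transitions. -/
def trans : List (State × Option ℕ × Bool × ℕ × State) :=
  plainTrans M ++ (simTrans M N ++ silentTrans M N)

/-- The initial states. -/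
def init : List State := count :: chk M.init :: N.init.map fun q => sim (some q) true 0 0

/-- The final states. -/
def final : List State := count :: sink :: (currents M).map chk

/-- The transitions, characterized. -/
inductive Trans : State → Option ℕ → Bool → ℕ → State → Prop
  | sink {i : ℕ} : i < numLetters M → Trans sink (some i) true 0 sink
  | count_zero {i : ℕ} : i < numLetters M → Trans count (some i) true 1 count
  | count_pos {i : ℕ} : i < numLetters M → Trans count (some i) false 2 count
  | chk_trans {l : List ℕ} {i p a x q : ℕ} : l ∈ currents M → (i, p, a, x, q) ∈ transLetters M →
      p ∈ l → Trans (chk l) (some i) true 0 (chk [q])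
  | chk_trans_sink {l : List ℕ} {i p a x q : ℕ} : l ∈ currents M →
      (i, p, a, x, q) ∈ transLetters M → p ∉ l → Trans (chk l) (some i) true 0 LagAutomaton.sink
  | chk_final_sink {l : List ℕ} {i p x : ℕ} : l ∈ currents M → (i, p, x) ∈ finalLetters M →
      p ∉ l → Trans (chk l) (some i) true 0 LagAutomaton.sink
  | sim_trans {i p a x p' q y q' : ℕ} {b z : Bool} : (i, p, a, x, p') ∈ transLetters M →
      (q, a, y, q') ∈ N.trans →
      Trans (sim (some q) b 0 0) (some i) z (keep z) (sim (some q') b x y)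
  | sim_final {i p x q y : ℕ} {b z : Bool} : (i, p, x) ∈ finalLetters M → (q, y) ∈ N.final →
      Trans (sim (some q) b 0 0) (some i) z (keep z) (sim none b x y)
  | silent {q : Option ℕ} {b : Bool} {x y : ℕ × ℕ} {s s' : State} {z : Bool} {j : ℕ} :
      (q = none ∨ ∃ e ∈ N.trans, q = some e.2.2.2) →
      (∃ u d, u ≤ bound M N ∧ d ≤ bound M N ∧ y = (u, d) ∧ x = bif b then (u + 1, d) else (u, d + 1)) →
      (s, none, z, j, s') ∈ moves q b x y → Trans s none z j s'
  | accept {b : Bool} : Trans (sim none b 0 0) none true 0 LagAutomaton.sink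

variable {M N}

theorem mem_trans_iff {s : State} {a : Option ℕ} {z : Bool} {j : ℕ} {s' : State} :
    (s, a, z, j, s') ∈ trans M N ↔ Trans M N s a z j s' := by
  constructor
  · intro h
    rw [trans, List.mem_append, List.mem_append] at h
    rcases h with h | h | h
    · simp only [plainTrans, List.mem_append, List.mem_flatMap, List.mem_map, List.mem_range] at h
      rcases h with ⟨i, hi, h⟩ | ⟨l, hl, ⟨i, p, a, x, q⟩, ht, h⟩ | ⟨l, hl, ⟨i, p, x⟩, ht, h⟩
      · simp only [List.mem_cons, Prod.mk.injEq, List.not_mem_nil, or_false] at h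
        rcases h with ⟨rfl, rfl, rfl, rfl, rfl⟩ | ⟨rfl, rfl, rfl, rfl, rfl⟩ | ⟨rfl, rfl, rfl, rfl, rfl⟩
        exacts [.sink hi, .count_zero hi, .count_pos hi]
      · simp only [Prod.mk.injEq] at h
        obtain ⟨rfl, rfl, rfl, rfl, rfl⟩ := h
        split_ifs with hp
        exacts [.chk_trans hl ht hp, .chk_trans_sink hl ht hp]
      · split_ifs at h with hp
        · simp at h
        · simp only [List.mem_singleton, Prod.mk.injEq] at h
          obtain ⟨rfl, rfl, rfl, rfl, rfl⟩ := h
          exact .chk_final_sink hl ht hp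
    · simp only [simTrans, List.mem_append, List.mem_flatMap] at h
      rcases h with ⟨⟨i, p, a, x, p'⟩, ht, ⟨q, a', y, q'⟩, he, h⟩ | ⟨⟨i, p, x⟩, ht, ⟨q, y⟩, he, h⟩
      · split_ifs at h with ha
        · dsimp only at ha
          subst ha
          obtain ⟨⟨b, z'⟩, -, h⟩ := List.mem_map.1 h
          simp only [Prod.mk.injEq] at h
          obtain ⟨rfl, rfl, rfl, rfl, rfl⟩ := h
          exact .sim_trans ht he
        · simp at h
      · obtain ⟨⟨b, z'⟩, -, h⟩ := List.mem_map.1 h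
        simp only [Prod.mk.injEq] at h
        obtain ⟨rfl, rfl, rfl, rfl, rfl⟩ := h
        exact .sim_final ht he
    · have hm : ∀ q b x y, (s, a, z, j, s') ∈ moves q b x y → a = none := by
        intro q b x y h
        simp only [moves, List.mem_cons, Prod.mk.injEq, List.not_mem_nil, or_false] at h
        tauto
      simp only [silentTrans, List.mem_append, List.mem_flatMap, List.mem_range] at h
      rcases h with ⟨q, hq, u, hu, d, hd, h⟩ | h
      · have hq : q = none ∨ ∃ e ∈ N.trans, q = some e.2.2.2 := by
          simpa [eq_comm] using hq
        rcases h with h | h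
        · obtain rfl := hm _ _ _ _ h
          exact .silent hq ⟨u, d, by omega, by omega, rfl, rfl⟩ h
        · obtain rfl := hm _ _ _ _ h
          exact .silent hq ⟨u, d, by omega, by omega, rfl, rfl⟩ h
      · simp only [List.mem_cons, Prod.mk.injEq, List.not_mem_nil, or_false] at h
        rcases h with ⟨rfl, rfl, rfl, rfl, rfl⟩ | ⟨rfl, rfl, rfl, rfl, rfl⟩ <;> exact .accept
  · intro h
    rw [trans, List.mem_append, List.mem_append]
    cases h with
    | sink h => left; simp [plainTrans, h]
    | count_zero h => left; simp [plainTrans, h]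
    | count_pos h => left; simp [plainTrans, h]
    | chk_trans hl ht hp =>
      left
      simp only [plainTrans, List.mem_append, List.mem_flatMap, List.mem_map]
      exact .inr (.inl ⟨_, hl, _, ht, by simp [hp]⟩)
    | chk_trans_sink hl ht hp =>
      left
      simp only [plainTrans, List.mem_append, List.mem_flatMap, List.mem_map]
      exact .inr (.inl ⟨_, hl, _, ht, by simp [hp]⟩)
    | chk_final_sink hl ht hp =>
      left
      simp only [plainTrans, List.mem_append, List.mem_flatMap, List.mem_map]
      exact .inr (.inr ⟨_, hl, _, ht, by simp [hp]⟩)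
    | @sim_trans i p a x p' q y q' b _ ht he =>
      right; left
      simp only [simTrans, List.mem_append, List.mem_flatMap]
      refine .inl ⟨_, ht, _, he, ?_⟩
      rw [if_pos rfl]
      exact List.mem_map.2 ⟨(b, z), by cases b <;> cases z <;> simp, rfl⟩
    | @sim_final i p x q y b _ ht he =>
      right; left
      simp only [simTrans, List.mem_append, List.mem_flatMap]
      refine .inr ⟨_, ht, _, he, ?_⟩
      exact List.mem_map.2 ⟨(b, z), by cases b <;> cases z <;> simp, rfl⟩
    | @silent q b x y _ _ _ _ hq h hm =>
      right; right
      obtain ⟨u, d, hu, hd, rfl, rfl⟩ := h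
      simp only [silentTrans, List.mem_append, List.mem_flatMap, List.mem_range]
      refine .inl ⟨q, by simpa [eq_comm] using hq, u, by omega, d, by omega, ?_⟩
      cases b
      exacts [.inr hm, .inl hm]
    | @accept b => right; right; cases b <;> simp [silentTrans]

variable (M N) in
/-- The automaton that accepts a word by counting its letters, by checking that it does
not present a path of `M`, or by simulating `N` on the path. -/
def automaton : OneCounterAutomaton ℕ State := .ofLists (init M N) (final M) (trans M N)

/-- A letter is a position in a list, hence names a single transition even if the list has
repetitions. A word therefore determines the run that it spells. -/
theorem eq_of_mem_transLetters {i : ℕ} {t t' : ℕ × ℕ × ℕ × ℕ} (h : (i, t) ∈ transLetters M)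
    (h' : (i, t') ∈ transLetters M) : t = t' := by
  obtain ⟨j, hj, h⟩ := List.mem_number.1 h
  obtain ⟨j', hj', h'⟩ := List.mem_number.1 h'
  obtain rfl : j = j' := by dsimp only at hj hj'; omega
  simpa [h] using h'

theorem eq_of_mem_finalLetters {i : ℕ} {t t' : ℕ × ℕ} (h : (i, t) ∈ finalLetters M)
    (h' : (i, t') ∈ finalLetters M) : t = t' := by
  obtain ⟨j, hj, h⟩ := List.mem_number.1 h
  obtain ⟨j', hj', h'⟩ := List.mem_number.1 h'
  obtain rfl : j = j' := by dsimp only at hj hj'; omega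
  simpa [h] using h'

/-- The final letters are numbered from `M.trans.length` on, beyond all transition letters. -/
theorem not_mem_finalLetters {i : ℕ} {t : ℕ × ℕ × ℕ × ℕ} {t' : ℕ × ℕ}
    (h : (i, t) ∈ transLetters M) (h' : (i, t') ∈ finalLetters M) : False := by
  obtain ⟨j, hj, h⟩ := List.mem_number.1 h
  obtain ⟨j', hj', h'⟩ := List.mem_number.1 h'
  have := (List.getElem?_eq_some_iff.1 h).1
  dsimp only at hj hj'
  omega

theorem lt_numLetters_of_mem_transLetters {i : ℕ} {t : ℕ × ℕ × ℕ × ℕ}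
    (h : (i, t) ∈ transLetters M) : i < numLetters M := by
  obtain ⟨j, hj, h⟩ := List.mem_number.1 h
  have := (List.getElem?_eq_some_iff.1 h).1
  dsimp only [numLetters] at *
  omega

theorem lt_numLetters_of_mem_finalLetters {i : ℕ} {t : ℕ × ℕ}
    (h : (i, t) ∈ finalLetters M) : i < numLetters M := by
  obtain ⟨j, hj, h⟩ := List.mem_number.1 h
  have := (List.getElem?_eq_some_iff.1 h).1
  dsimp only [numLetters] at *
  omega

theorem exists_mem_letters {i : ℕ} (h : i < numLetters M) :
    (∃ t, (i, t) ∈ transLetters M) ∨ ∃ t, (i, t) ∈ finalLetters M := by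
  by_cases hi : i < M.trans.length
  · exact .inl ⟨M.trans[i], List.mem_number.2 ⟨i, by simp, by simp [hi]⟩⟩
  · have hj : i - M.trans.length < M.final.length := by
      dsimp only [numLetters] at h
      omega
    exact .inr ⟨M.final[i - M.trans.length], List.mem_number.2 ⟨i - M.trans.length, by dsimp only; omega, by simp [hj]⟩⟩

theorem mem_transLetters_of_mem {t : ℕ × ℕ × ℕ × ℕ} (h : t ∈ M.trans) :
    ∃ i, (i, t) ∈ transLetters M := by
  obtain ⟨i, hi⟩ := List.mem_iff_getElem?.1 h
  exact ⟨0 + i, List.mem_number.2 ⟨i, rfl, hi⟩⟩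

theorem mem_finalLetters_of_mem {t : ℕ × ℕ} (h : t ∈ M.final) :
    ∃ i, (i, t) ∈ finalLetters M := by
  obtain ⟨i, hi⟩ := List.mem_iff_getElem?.1 h
  exact ⟨_, List.mem_number.2 ⟨i, rfl, hi⟩⟩

theorem mem_of_mem_transLetters {i : ℕ} {t : ℕ × ℕ × ℕ × ℕ} (h : (i, t) ∈ transLetters M) :
    t ∈ M.trans := by
  obtain ⟨j, -, h⟩ := List.mem_number.1 h
  exact List.mem_of_getElem? h

theorem mem_of_mem_finalLetters {i : ℕ} {t : ℕ × ℕ} (h : (i, t) ∈ finalLetters M) :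
    t ∈ M.final := by
  obtain ⟨j, -, h⟩ := List.mem_number.1 h
  exact List.mem_of_getElem? h

/-! ### Words that spell runs -/

variable (M) in
/-- A prefix of the word lists the transitions and the final state of the path from `p` with the
given letters and outputs. -/
inductive Presents : ℕ → List ℕ → List (ℕ × ℕ) → ℕ → Prop
  | final {i p x : ℕ} {w : List ℕ} : (i, p, x) ∈ finalLetters M → Presents p (i :: w) [] x
  | trans {i p a x q y : ℕ} {w : List ℕ} {ρ : List (ℕ × ℕ)} : (i, p, a, x, q) ∈ transLetters M →
      Presents q w ρ y → Presents p (i :: w) ((a, x) :: ρ) y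

theorem Presents.path {p : ℕ} {w : List ℕ} {ρ : List (ℕ × ℕ)} {x : ℕ} (h : Presents M p w ρ x) :
    M.Path p ρ x := by
  induction h with
  | final h => exact .nil (mem_of_mem_finalLetters h)
  | trans h _ ih => exact .cons (mem_of_mem_transLetters h) ih

/-- Only a prefix has to spell the run, so the final letter can be repeated until the word is too
long for the counting mode. -/
theorem Presents.exists_of_path {p : ℕ} {ρ : List (ℕ × ℕ)} {x : ℕ} (h : M.Path p ρ x) (k : ℕ) :
    ∃ w, Presents M p w ρ x ∧ k ≤ w.length ∧ ∀ i ∈ w, i < numLetters M := by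
  induction h with
  | nil h =>
    obtain ⟨i, hi⟩ := mem_finalLetters_of_mem h
    refine ⟨i :: List.replicate k i, .final hi, by simp, ?_⟩
    intro j hj
    obtain rfl : j = i := by
      rw [← List.replicate_succ] at hj
      exact List.eq_of_mem_replicate hj
    exact lt_numLetters_of_mem_finalLetters hi
  | cons h _ ih =>
    obtain ⟨i, hi⟩ := mem_transLetters_of_mem h
    obtain ⟨w, hw, hk, hl⟩ := ih
    refine ⟨i :: w, .trans hi hw, by simp; omega, ?_⟩
    simp only [List.mem_cons, forall_eq_or_imp]
    exact ⟨lt_numLetters_of_mem_transLetters hi, hl⟩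

/-! ### A bounded counter gives bounded lag -/

/-- The absolute value and the sign as an integer. -/
def signed (b : Bool) (c : ℕ) : ℤ := bif b then c else -c

theorem abs_signed (b : Bool) (c : ℕ) : |signed b c| = c := by
  cases b <;> simp [signed]

variable (M N) in
/-- What a run in which the counter is at most `k` says about the word that it reads. -/
def Sound (k : ℕ) : State × ℕ → List ℕ → Prop
  | (.inl true, _), _ => True
  | (.inl false, c), w => c + w.length ≤ k
  | (.inr (.inl l), _), w => ∀ p ∈ l, ∀ ρ x, ¬ Presents M p w ρ x
  | (.inr (.inr (some q, b, u, d)), c), w => ∀ p ρ x, Presents M p w ρ x →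
      N.Matches k q (signed b c + u - d) ρ x
  | (.inr (.inr (none, b, u, d)), c), _ => signed b c + u - d = 0

theorem step_iff {x y : State × ℕ} {a : Option ℕ} :
    (automaton M N).Step x a y ↔ ∃ z j, Trans M N x.1 a z j y.1 ∧
      (bif z then x.2 = 0 ∧ y.2 = j else ∃ c, x.2 = c + 1 ∧ y.2 = c + j) := by
  obtain ⟨s, c⟩ := x
  obtain ⟨s', c'⟩ := y
  constructor
  · rintro (h | h)
    · exact ⟨true, _, mem_trans_iff.1 h, rfl, rfl⟩
    · exact ⟨false, _, mem_trans_iff.1 h, _, rfl, rfl⟩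
  · rintro ⟨z, j, h, h'⟩
    cases z
    · obtain ⟨n, h₁, h₂⟩ := h'
      dsimp only at h₁ h₂
      subst h₁ h₂
      exact .pos (mem_trans_iff.2 h)
    · obtain ⟨h₁, h₂⟩ := h'
      dsimp only at h₁ h₂
      subst h₁ h₂
      exact .zero (mem_trans_iff.2 h)

/-- Stepping in direction `b` enlarges a counter of sign `b` and shrinks one of the opposite sign;
at zero the opposite sign is first exchanged for `b`. The signed value changes by one in every case.
-/
theorem signed_moves {q : Option ℕ} {b : Bool} {x y : ℕ × ℕ} {s s' : State} {a : Option ℕ}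
    {z : Bool} {j c c' : ℕ} (h : (s, a, z, j, s') ∈ moves q b x y)
    (hc : bif z then c = 0 ∧ c' = j else ∃ n, c = n + 1 ∧ c' = n + j) :
    ∃ b₁ b₂, s = sim q b₁ x.1 x.2 ∧ s' = sim q b₂ y.1 y.2 ∧
      signed b₂ c' = signed b₁ c + bif b then 1 else -1 := by
  simp only [moves, List.mem_cons, Prod.mk.injEq, List.not_mem_nil, or_false] at h
  rcases h with ⟨rfl, rfl, rfl, rfl, rfl⟩ | ⟨rfl, rfl, rfl, rfl, rfl⟩ | ⟨rfl, rfl, rfl, rfl, rfl⟩ |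
    ⟨rfl, rfl, rfl, rfl, rfl⟩
  · obtain ⟨rfl, rfl⟩ := hc
    exact ⟨_, _, rfl, rfl, by cases b <;> simp [signed]⟩
  · obtain ⟨n, rfl, rfl⟩ := hc
    exact ⟨_, _, rfl, rfl, by cases b <;> simp [signed] <;> ring⟩
  · obtain ⟨n, rfl, rfl⟩ := hc
    exact ⟨_, _, rfl, rfl, by cases b <;> simp [signed]⟩
  · obtain ⟨rfl, rfl⟩ := hc
    exact ⟨_, _, rfl, rfl, by cases b <;> simp [signed]⟩

/-- `Sound` is propagated backwards along the run. In simulation states it quantifies over all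
source states of `M`: the simulation does not check that the transitions read are consecutive, since
`Presents` supplies this. -/
theorem sound_of_run {k : ℕ} {x y : State × ℕ} {w : List ℕ}
    (h : (automaton M N).Run (Set.Iic k) x w y) (hy : y.1 ∈ final M) : Sound M N k x w := by
  induction h with
  | @nil x hx =>
    simp only [final, List.mem_cons, List.mem_map] at hy
    obtain ⟨s, c⟩ := x
    rcases hy with rfl | rfl | ⟨l, hl, rfl⟩
    · simpa [Sound] using hx
    · trivial
    · intro p _ ρ x h
      cases h
  | @cons x y z a w hx hs hr ih =>
    specialize ih hy
    obtain ⟨s, c⟩ := x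
    obtain ⟨s', c'⟩ := y
    obtain ⟨zr, j, ht, hc⟩ := step_iff.1 hs
    clear hr hs
    dsimp only at ht hc hx
    cases ht with
    | sink h => trivial
    | count_zero h =>
      obtain ⟨rfl, rfl⟩ := hc
      simp only [Sound, Option.toList_some, List.singleton_append, List.length_cons] at ih ⊢
      omega
    | count_pos h =>
      obtain ⟨n, rfl, rfl⟩ := hc
      simp only [Sound, Option.toList_some, List.singleton_append, List.length_cons] at ih ⊢
      omega
    | chk_trans hl ht hp =>
      intro p hp' ρ x h
      cases h with
      | final h => exact not_mem_finalLetters ht h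
      | trans h h' =>
        obtain ⟨rfl, rfl, rfl, rfl⟩ := by simpa using eq_of_mem_transLetters ht h
        exact ih _ (List.mem_singleton_self _) _ _ h'
    | chk_trans_sink hl ht hp =>
      intro p hp' ρ x h
      cases h with
      | final h => exact not_mem_finalLetters ht h
      | trans h h' =>
        obtain ⟨rfl, rfl, rfl, rfl⟩ := by simpa using eq_of_mem_transLetters ht h
        exact hp hp'
    | chk_final_sink hl ht hp =>
      intro p hp' ρ x h
      cases h with
      | final h =>
        obtain ⟨rfl, rfl⟩ := by simpa using eq_of_mem_finalLetters ht h
        exact hp hp'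
      | trans h h' => exact not_mem_finalLetters h ht
    | @sim_trans i p a x p' q y q' b z ht he =>
      have hc : c' = c := by
        cases zr
        · obtain ⟨n, rfl, rfl⟩ := hc; rfl
        · obtain ⟨rfl, rfl⟩ := hc; rfl
      subst hc
      intro p ρ x h
      cases h with
      | final h => exact (not_mem_finalLetters ht h).elim
      | trans h h' =>
        obtain ⟨rfl, rfl, rfl, rfl⟩ := by simpa using eq_of_mem_transLetters ht h
        -- Letters are read only when no change is pending, so the counter is then the absolute
        -- difference and its bound is the bound on the lag.
        refine .cons he ?_ ?_
        · simpa [abs_signed] using hx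
        · simpa using ih _ _ _ h'
    | @sim_final i p x q y b z ht he =>
      have hc : c' = c := by
        cases zr
        · obtain ⟨n, rfl, rfl⟩ := hc; rfl
        · obtain ⟨rfl, rfl⟩ := hc; rfl
      subst hc
      intro p ρ x h
      cases h with
      | final h =>
        obtain ⟨rfl, rfl⟩ := by simpa using eq_of_mem_finalLetters ht h
        refine .nil he ?_ ?_
        · simpa [abs_signed] using hx
        · simp only [Sound] at ih
          push_cast
          linarith
      | trans h h' => exact (not_mem_finalLetters h ht).elim
    | @silent q b x y _ _ _ _ hq h hm =>
      obtain ⟨u, d, hu, hd, rfl, rfl⟩ := h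
      obtain ⟨b₁, b₂, rfl, rfl, e⟩ := signed_moves hm hc
      have e : signed b₁ c + ((bif b then (u + 1, d) else (u, d + 1) : ℕ × ℕ).1 : ℤ)
          - (bif b then (u + 1, d) else (u, d + 1) : ℕ × ℕ).2 = signed b₂ c' + u - d := by
        cases b <;> simp only [cond_true, cond_false] at e ⊢ <;> push_cast <;> linarith
      cases q with
      | none => simpa only [Sound, e] using ih
      | some q => simpa only [Sound, e, Option.toList_none, List.nil_append] using ih
    | @accept b =>
      obtain ⟨rfl, rfl⟩ := hc
      cases b <;> simp [Sound, signed]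

/-- On a long word that spells a run, the counting mode exceeds `k` and the checking mode fails, so
only the simulation remains. -/
theorem lagBounded_of_acceptsWithin {k : ℕ} (h : ∀ w : List ℕ, (∀ i ∈ w, i < numLetters M) →
    (automaton M N).AcceptsWithin (Set.Iic k) w) : M.LagBounded N := by
  refine ⟨k, fun s hs ρ x hp => ?_⟩
  -- Length `k + 1` is just enough to push the letter count beyond `k`.
  obtain ⟨w, hw, hk, hl⟩ := Presents.exists_of_path hp (k + 1)
  obtain ⟨s₀, hs₀, s₁, hs₁, c, hr⟩ := h w hl
  have := sound_of_run hr hs₁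
  have hs₀ : s₀ ∈ init M N := hs₀
  simp only [init, List.mem_cons, List.mem_map] at hs₀
  rcases hs₀ with rfl | rfl | ⟨q, hq, rfl⟩
  · simp only [Sound] at this
    omega
  · exact (this s hs _ _ hw).elim
  · exact ⟨q, hq, by simpa [signed] using this s ρ x hw⟩

/-! ### Bounded lag gives a bounded counter -/

theorem run_append {S Ω : Type} {A : OneCounterAutomaton Ω S} {C : Set ℕ} {x y z : S × ℕ}
    {w w' : List Ω} (h : A.Run C x w y) (h' : A.Run C y w' z) : A.Run C x (w ++ w') z := by
  induction h with
  | nil => exact h'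
  | cons hx hs _ ih =>
    rw [List.append_assoc]
    exact .cons hx hs (ih h')

theorem run_sink {k : ℕ} {w : List ℕ} (hw : ∀ i ∈ w, i < numLetters M) :
    (automaton M N).Run (Set.Iic k) (sink, 0) w (sink, 0) := by
  induction w with
  | nil => exact .nil (Nat.zero_le _)
  | cons i w ih =>
    simp only [List.mem_cons, forall_eq_or_imp] at hw
    exact .cons (a := some i) (Nat.zero_le _) (step_iff.2 ⟨true, 0, .sink hw.1, rfl, rfl⟩) (ih hw.2)

theorem run_count {w : List ℕ} (hw : ∀ i ∈ w, i < numLetters M) (c : ℕ) :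
    (automaton M N).Run Set.univ (count, c) w (count, c + w.length) := by
  induction w generalizing c with
  | nil => exact .nil trivial
  | cons i w ih =>
    simp only [List.mem_cons, forall_eq_or_imp] at hw
    have := ih hw.2 (c + 1)
    rw [Nat.add_assoc, Nat.add_comm 1] at this
    refine .cons (a := some i) trivial (step_iff.2 ?_) this
    cases c with
    | zero => exact ⟨true, 1, .count_zero hw.1, rfl, rfl⟩
    | succ c => exact ⟨false, 2, .count_pos hw.1, c, rfl, rfl⟩

/-- The check is deterministic: after a transition letter with an allowed source there is one
current state. It stays in `chk` as long as the letters chain up, goes to the sink at the first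
mismatch, and could only get stuck at a matching final letter, which `h` excludes. -/
theorem exists_run_chk {k : ℕ} {w : List ℕ} (hw : ∀ i ∈ w, i < numLetters M) {l : List ℕ}
    (hl : l ∈ currents M) (h : ∀ p ∈ l, ∀ ρ x, ¬ Presents M p w ρ x) :
    ∃ s ∈ final M, (automaton M N).Run (Set.Iic k) (chk l, 0) w (s, 0) := by
  induction w generalizing l with
  | nil => exact ⟨chk l, by simp [final, hl], .nil (Nat.zero_le _)⟩
  | cons i w ih =>
    simp only [List.mem_cons, forall_eq_or_imp] at hw
    have hsink : sink ∈ final M := by simp [final]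
    rcases exists_mem_letters hw.1 with ⟨⟨p, a, x, q⟩, ht⟩ | ⟨⟨p, x⟩, ht⟩
    · by_cases hp : p ∈ l
      · have hq : [q] ∈ currents M :=
          List.mem_cons_of_mem _ (List.mem_map.2 ⟨_, mem_of_mem_transLetters ht, rfl⟩)
        obtain ⟨s, hs, hr⟩ := ih hw.2 hq (by
          simp only [List.mem_singleton, forall_eq]
          exact fun ρ y h' => h p hp _ _ (.trans ht h'))
        exact ⟨s, hs, .cons (a := some i) (Nat.zero_le _)
          (step_iff.2 ⟨true, 0, .chk_trans hl ht hp, rfl, rfl⟩) hr⟩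
      · exact ⟨sink, hsink, .cons (a := some i) (Nat.zero_le _)
          (step_iff.2 ⟨true, 0, .chk_trans_sink hl ht hp, rfl, rfl⟩) (run_sink hw.2)⟩
    · have hp : p ∉ l := fun hp => h p hp _ _ (.final ht)
      exact ⟨sink, hsink, .cons (a := some i) (Nat.zero_le _)
          (step_iff.2 ⟨true, 0, .chk_final_sink hl ht hp, rfl, rfl⟩) (run_sink hw.2)⟩

theorem exists_step_move {q : Option ℕ} (hq : q = none ∨ ∃ e ∈ N.trans, q = some e.2.2.2) (b : Bool)
    {u d : ℕ} (hu : u ≤ bound M N) (hd : d ≤ bound M N) (s : Bool) (c : ℕ) :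
    ∃ s' c', (automaton M N).Step
        (sim q s (bif b then u + 1 else u) (bif b then d else d + 1), c) none (sim q s' u d, c') ∧
      c' ≤ c + 1 ∧ signed s' c' = signed s c + bif b then 1 else -1 := by
  have hx : ∀ z j s s', (sim q s (bif b then u + 1 else u) (bif b then d else d + 1), none, z, j,
      sim q s' u d) ∈ moves q b (bif b then (u + 1, d) else (u, d + 1)) (u, d) →
      Trans M N (sim q s (bif b then u + 1 else u) (bif b then d else d + 1)) none z j
        (sim q s' u d) :=
    fun z j s s' h => .silent hq ⟨u, d, hu, hd, rfl, rfl⟩ h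
  by_cases hs : s = b
  · subst hs
    refine ⟨s, c + 1, step_iff.2 ?_, le_rfl, by cases s <;> simp [signed]; ring⟩
    cases c with
    | zero => exact ⟨true, 1, hx _ _ _ _ (by cases s <;> simp [moves]), rfl, rfl⟩
    | succ c => exact ⟨false, 2, hx _ _ _ _ (by cases s <;> simp [moves]), c, rfl, rfl⟩
  · obtain rfl : s = !b := by cases s <;> cases b <;> simp_all
    cases c with
    | zero =>
      refine ⟨b, 1, step_iff.2 ⟨true, 1, hx _ _ _ _ (by cases b <;> simp [moves]), rfl, rfl⟩,
        le_rfl, by cases b <;> simp [signed]⟩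
    | succ c =>
      refine ⟨!b, c, step_iff.2 ⟨false, 0, hx _ _ _ _ (by cases b <;> simp [moves]), c, rfl, rfl⟩,
        by omega, by cases b <;> simp [signed]⟩

/-- Pending changes are carried out one unit at a time, so intermediate counters are at most the
initial one plus all pending units. -/
theorem exists_run_silent {q : Option ℕ} (hq : q = none ∨ ∃ e ∈ N.trans, q = some e.2.2.2) {K : ℕ}
    {u d : ℕ} (hu : u ≤ bound M N) (hd : d ≤ bound M N) (s : Bool) (c : ℕ) (hK : c + u + d ≤ K) :
    ∃ s' c', (automaton M N).Run (Set.Iic K) (sim q s u d, c) [] (sim q s' 0 0, c') ∧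
      signed s' c' = signed s c + u - d := by
  have hc : c ∈ Set.Iic K := by simp only [Set.mem_Iic]; omega
  induction u generalizing s c with
  | zero =>
    induction d generalizing s c with
    | zero => exact ⟨s, c, .nil hc, by simp⟩
    | succ d ih =>
      obtain ⟨s', c', hst, hc', e⟩ := exists_step_move (M := M) hq false hu (d := d) (by omega) s c
      obtain ⟨s'', c'', hr, e'⟩ := ih (by omega) s' c' (by omega) (by simp only [Set.mem_Iic]; omega)
      refine ⟨s'', c'', .cons (a := none) hc hst hr, ?_⟩
      simp only [cond_false] at e
      push_cast at e' ⊢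
      linarith
  | succ u ih =>
    obtain ⟨s', c', hst, hc', e⟩ := exists_step_move (M := M) hq true (u := u) (by omega) hd s c
    obtain ⟨s'', c'', hr, e'⟩ := ih (by omega) s' c' (by omega) (by simp only [Set.mem_Iic]; omega)
    refine ⟨s'', c'', .cons (a := none) hc hst hr, ?_⟩
    simp only [cond_true] at e
    push_cast at e' ⊢
    linarith

theorem exists_step_keep {s s' : State} {i : ℕ} (h : ∀ z, Trans M N s (some i) z (keep z) s')
    (c : ℕ) : (automaton M N).Step (s, c) (some i) (s', c) := by
  refine step_iff.2 ?_
  cases c with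
  | zero => exact ⟨true, 0, h true, rfl, rfl⟩
  | succ c => exact ⟨false, 1, h false, c, rfl, rfl⟩

/-- The counter is at most `k` when a letter is read, and each of the two pending outputs is at most
`bound M N`; hence the limit `k + 2 * bound M N`. -/
theorem run_sim {k q : ℕ} {e : ℤ} {ρ : List (ℕ × ℕ)} {x : ℕ} (h : N.Matches k q e ρ x) {p : ℕ}
    {w : List ℕ} (hw : ∀ i ∈ w, i < numLetters M) (hp : Presents M p w ρ x) {b : Bool} {c : ℕ}
    (hc : signed b c = e) :
    (automaton M N).Run (Set.Iic (k + 2 * bound M N)) (sim (some q) b 0 0, c) w (sink, 0) := by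
  induction h generalizing p w b c with
  | @nil q e x y hq he hxy =>
    cases hp with
    | @final i _ _ w ht =>
      simp only [List.mem_cons, forall_eq_or_imp] at hw
      rw [← hc, abs_signed] at he
      have he : c ≤ k := by exact_mod_cast he
      have h₁ := List.le_sum_map (fun t : ℕ × ℕ => t.2) (mem_of_mem_finalLetters ht)
      have h₂ := List.le_sum_map (fun t : ℕ × ℕ => t.2) hq
      have hx : x ≤ bound M N := by simp only [bound] at h₁ ⊢; omega
      have hy : y ≤ bound M N := by simp only [bound] at h₂ ⊢; omega
      obtain ⟨s', c', hr, e'⟩ := exists_run_silent (M := M) (N := N) (q := none)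
        (K := k + 2 * bound M N) (.inl rfl) hx hy b c (by omega)
      have hc' : signed s' c' = 0 := by rw [e']; linarith
      obtain rfl : c' = 0 := by simpa [hc'] using (abs_signed s' c').symm
      exact .cons (a := some i) (by simp only [Set.mem_Iic]; omega)
        (exists_step_keep (fun z => .sim_final ht hq) c)
        (run_append hr (.cons (a := none) (Nat.zero_le _)
          (step_iff.2 ⟨true, 0, .accept, rfl, rfl⟩) (run_sink hw.2)))
  | @cons q q' e a x y z ρ hq he hm ih =>
    cases hp with
    | @trans i _ _ _ p' _ w _ ht hp =>
      simp only [List.mem_cons, forall_eq_or_imp] at hw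
      rw [← hc, abs_signed] at he
      have he : c ≤ k := by exact_mod_cast he
      have h₁ := List.le_sum_map (fun t : ℕ × ℕ × ℕ × ℕ => t.2.2.1) (mem_of_mem_transLetters ht)
      have h₂ := List.le_sum_map (fun t : ℕ × ℕ × ℕ × ℕ => t.2.2.1) hq
      have hx : x ≤ bound M N := by simp only [bound] at h₁ ⊢; omega
      have hy : y ≤ bound M N := by simp only [bound] at h₂ ⊢; omega
      obtain ⟨s', c', hr, e'⟩ := exists_run_silent (M := M) (N := N) (q := some q')
        (K := k + 2 * bound M N) (.inr ⟨_, hq, rfl⟩) hx hy b c (by omega)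
      exact .cons (a := some i) (by simp only [Set.mem_Iic]; omega)
        (exists_step_keep (fun z => .sim_trans ht hq) c)
        (run_append hr (ih hw.2 hp (by rw [e', hc])))

/-- The counting mode alone fulfils the promise of universality, with no bound on the counter. -/
theorem acceptsWithin_univ {w : List ℕ} (hw : ∀ i ∈ w, i < numLetters M) :
    (automaton M N).AcceptsWithin Set.univ w :=
  ⟨count, List.mem_cons_self, count, List.mem_cons_self, _, run_count hw 0⟩

theorem lagBounded_iff_acceptsWithin : M.LagBounded N ↔ ∃ k, ∀ w : List ℕ,
    (∀ i ∈ w, i < numLetters M) → (automaton M N).AcceptsWithin (Set.Iic k) w := by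
  refine ⟨?_, fun ⟨k, h⟩ => lagBounded_of_acceptsWithin h⟩
  rintro ⟨k, h⟩
  refine ⟨k + 2 * bound M N, fun w hw => ?_⟩
  by_cases hv : ∃ p ∈ M.init, ∃ ρ x, Presents M p w ρ x
  · obtain ⟨p, hp, ρ, x, hpr⟩ := hv
    obtain ⟨q, hq, hm⟩ := h p hp ρ x hpr.path
    refine ⟨sim (some q) true 0 0, ?_, sink, ?_, 0, run_sim hm hw hpr (by simp [signed])⟩
    · exact List.mem_cons_of_mem _ (List.mem_cons_of_mem _ (List.mem_map_of_mem hq))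
    · exact List.mem_cons_of_mem _ List.mem_cons_self
  · push Not at hv
    obtain ⟨s, hs, hr⟩ := exists_run_chk (N := N) (k := k + 2 * bound M N) hw List.mem_cons_self hv
    exact ⟨chk M.init, List.mem_cons_of_mem _ List.mem_cons_self, s, hs, 0, hr⟩

theorem lt_numLetters_of_mem_trans : ∀ t ∈ trans M N, ∀ i ∈ t.2.1, i < numLetters M := by
  rintro ⟨s, a, z, j, s'⟩ hmem i rfl
  cases mem_trans_iff.1 hmem with
  | sink h => exact h
  | count_zero h => exact h
  | count_pos h => exact h
  | chk_trans _ h _ => exact lt_numLetters_of_mem_transLetters h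
  | chk_trans_sink _ h _ => exact lt_numLetters_of_mem_transLetters h
  | chk_final_sink _ h _ => exact lt_numLetters_of_mem_finalLetters h
  | sim_trans h _ => exact lt_numLetters_of_mem_transLetters h
  | sim_final h _ => exact lt_numLetters_of_mem_finalLetters h

end LagAutomaton

/-! ### From boundedness to synthesis -/

/-- A transition `(p, a, z, j, q)` of a one-counter automaton. -/
abbrev CounterRule : Type := ℕ × Option ℕ × Bool × ℕ × ℕ

/-! ### Rules evaluated along a list of cells -/

namespace CounterRule

/-- The rule leads from the value `c` of the counter to the value `c'`. -/
def Fires (r : CounterRule) (c c' : ℕ) : Prop :=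
  bif r.2.2.1 then c = 0 ∧ c' = r.2.2.2.1 else ∃ n, c = n + 1 ∧ c' = n + r.2.2.2.1

/-- Moves that compute, on a list of cells, the value of the counter after an application of the
rule in some cell that contains its source: the phase is `0` at the beginning, `1` after the first
cell, and `2` after the cell where the rule is applied. -/
def sourceSteps (r : CounterRule) (x : ℕ) : List (ℕ × ℕ × ℕ) :=
  [(1, 1, 1), (2, 0, 2)] ++ ((if x.testBit r.1 = true then
    (if r.2.2.1 = true then [(0, r.2.2.2.1, 2)] else [(1, r.2.2.2.1, 2)]) else []) ++
    if r.2.2.1 = true then [] else [(0, 0, 1)])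

/-- Moves that compute, on a list of cells, the position of a cell that does not contain
the target of the rule. -/
def targetSteps (r : CounterRule) (x : ℕ) : List (Bool × ℕ × Bool) :=
  [(false, 1, false), (true, 0, true)] ++
    if x.testBit r.2.2.2.2 = true then [] else [(false, 0, true)]

/-- A sequence of moves of `sourceSteps` with its total. -/
inductive Source (r : CounterRule) : ℕ → List ℕ → ℕ → Prop
  | nil : Source r 2 [] 0
  | cons {s s' x y z : ℕ} {l : List ℕ} : (s, y, s') ∈ r.sourceSteps x → Source r s' l z →
      Source r s (x :: l) (y + z)

/-- A sequence of moves of `targetSteps` with its total. -/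
inductive Target (r : CounterRule) : Bool → List ℕ → ℕ → Prop
  | nil : Target r true [] 0
  | cons {s s' : Bool} {x y z : ℕ} {l : List ℕ} : (s, y, s') ∈ r.targetSteps x → Target r s' l z →
      Target r s (x :: l) (y + z)

variable {r : CounterRule}

theorem source_two_iff {l : List ℕ} {y : ℕ} : r.Source 2 l y ↔ y = 0 := by
  induction l generalizing y with
  | nil => exact ⟨fun h => by cases h; rfl, fun h => h ▸ .nil⟩
  | cons x l ih =>
    constructor
    · intro h
      cases h with
      | cons h h' =>
        simp only [sourceSteps] at h
        split_ifs at h <;> simp at h <;> obtain ⟨rfl, rfl⟩ := h <;> simp [ih.1 h']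
    · rintro rfl
      exact .cons (y := 0) (s' := 2) (by simp [sourceSteps]) (ih.2 rfl)

/-- One unit is added for each cell before the source. As phase 1 starts after the first cell, `c`
counts the symbols left below the topmost one that the rule replaces. -/
theorem source_one_iff (hz : r.2.2.1 = false) {l : List ℕ} {y : ℕ} : r.Source 1 l y ↔
    ∃ c x, l[c]? = some x ∧ x.testBit r.1 = true ∧ y = c + r.2.2.2.1 := by
  induction l generalizing y with
  | nil =>
    constructor
    · intro h
      cases h
    · simp
  | cons x l ih =>
    constructor
    · intro h
      cases h with
      | @cons _ s' _ y z _ h h' =>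
        have h : (y = 1 ∧ s' = 1) ∨ (x.testBit r.1 = true ∧ y = r.2.2.2.1 ∧ s' = 2) := by
          simp only [sourceSteps] at h
          split_ifs at h <;> simp_all
        rcases h with ⟨rfl, rfl⟩ | ⟨hx, rfl, rfl⟩
        · obtain ⟨c, x', hc, hx, rfl⟩ := ih.1 h'
          exact ⟨c + 1, x', hc, hx, by ring⟩
        · obtain rfl := source_two_iff.1 h'
          exact ⟨0, x, rfl, hx, by ring⟩
    · rintro ⟨c, x', hc, hx, rfl⟩
      cases c with
      | zero =>
        obtain rfl : x = x' := by simpa using hc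
        have := Source.cons (r := r) (s := 1) (s' := 2) (x := x) (y := r.2.2.2.1) (l := l)
          (by simp [sourceSteps, hx, hz]) (source_two_iff.2 rfl)
        simpa using this
      | succ c =>
        have := Source.cons (r := r) (s := 1) (s' := 1) (x := x) (y := 1) (l := l)
          (by simp [sourceSteps]) (ih.2 ⟨c, x', by simpa using hc, hx, rfl⟩)
        convert this using 1
        ring

/-- A rule for the empty counter must be applied in the first cell. Any other rule skips it at no
cost, which accounts for the removed stack symbol; the total is thus the new counter value. -/
theorem source_zero_iff {l : List ℕ} {y : ℕ} : r.Source 0 l y ↔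
    ∃ c x, l[c]? = some x ∧ x.testBit r.1 = true ∧ r.Fires c y := by
  cases l with
  | nil =>
    constructor
    · intro h
      cases h
    · simp
  | cons x l =>
    cases hz : r.2.2.1 with
    | true =>
      simp only [Fires, hz, cond_true]
      constructor
      · intro h
        cases h with
        | @cons _ s' _ y z _ h h' =>
          have h : x.testBit r.1 = true ∧ y = r.2.2.2.1 ∧ s' = 2 := by
            simp only [sourceSteps] at h
            split_ifs at h <;> simp_all
          obtain ⟨hx, rfl, rfl⟩ := h
          obtain rfl := source_two_iff.1 h'
          exact ⟨0, x, rfl, hx, rfl, rfl⟩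
      · rintro ⟨_, x', hc, hx, rfl, rfl⟩
        obtain rfl : x = x' := by simpa using hc
        exact .cons (s' := 2) (z := 0) (by simp [sourceSteps, hx, hz]) (source_two_iff.2 rfl)
    | false =>
      simp only [Fires, hz, cond_false]
      constructor
      · intro h
        cases h with
        | @cons _ s' _ y z _ h h' =>
          have h : y = 0 ∧ s' = 1 := by
            simp only [sourceSteps] at h
            split_ifs at h <;> simp_all
          obtain ⟨rfl, rfl⟩ := h
          obtain ⟨c, x', hc, hx, rfl⟩ := (source_one_iff hz).1 h'
          exact ⟨c + 1, x', by simpa using hc, hx, c, rfl, by ring⟩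
      · rintro ⟨_, x', hc, hx, c, rfl, rfl⟩
        have := Source.cons (r := r) (s := 0) (s' := 1) (x := x) (y := 0) (l := l)
          (by simp [sourceSteps, hz]) ((source_one_iff hz).2 ⟨c, x', by simpa using hc, hx, rfl⟩)
        simpa using this

theorem target_true_iff {l : List ℕ} {y : ℕ} : r.Target true l y ↔ y = 0 := by
  induction l generalizing y with
  | nil => exact ⟨fun h => by cases h; rfl, fun h => h ▸ .nil⟩
  | cons x l ih =>
    constructor
    · intro h
      cases h with
      | cons h h' =>
        simp only [targetSteps] at h
        split_ifs at h <;> simp at h <;> obtain ⟨rfl, rfl⟩ := h <;> simp [ih.1 h']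
    · rintro rfl
      exact .cons (y := 0) (s' := true) (by simp [targetSteps]) (ih.2 rfl)

/-- Units are counted until the unmarked cell is guessed, so the total is its position. -/
theorem target_false_iff {l : List ℕ} {y : ℕ} : r.Target false l y ↔
    ∃ x, l[y]? = some x ∧ ¬ x.testBit r.2.2.2.2 = true := by
  induction l generalizing y with
  | nil =>
    constructor
    · intro h
      cases h
    · simp
  | cons x l ih =>
    constructor
    · intro h
      cases h with
      | @cons _ s' _ y z _ h h' =>
        have h : (y = 1 ∧ s' = false) ∨ (¬ x.testBit r.2.2.2.2 = true ∧ y = 0 ∧ s' = true) := by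
          simp only [targetSteps] at h
          split_ifs at h <;> simp_all
        rcases h with ⟨rfl, rfl⟩ | ⟨hx, rfl, rfl⟩
        · obtain ⟨x', hc, hx⟩ := ih.1 h'
          exact ⟨x', by rw [add_comm]; exact hc, hx⟩
        · obtain rfl := target_true_iff.1 h'
          exact ⟨x, rfl, hx⟩
    · rintro ⟨x', hc, hx⟩
      cases y with
      | zero =>
        obtain rfl : x = x' := by simpa using hc
        exact .cons (s' := true) (y := 0) (z := 0) (by simp [targetSteps, hx]) (target_true_iff.2 rfl)
      | succ y =>
        rw [add_comm]
        exact .cons (s' := false) (by simp [targetSteps]) (ih.2 ⟨x', by simpa using hc, hx⟩)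

/-- This keeps the weights `1 + y - z` in the transitions free of truncated subtraction. -/
theorem le_one_of_mem_targetSteps {x y : ℕ} {s s' : Bool} (h : (s, y, s') ∈ r.targetSteps x) :
    y ≤ 1 := by
  simp only [targetSteps] at h
  split_ifs at h <;> simp at h <;> omega

end CounterRule

/-! ### The automaton that guesses an error -/

namespace ErrorAutomaton

/-- Letters are cells, which present sets of states by numbers, and letters of the one-counter
automaton, which separate blocks of cells. -/
abbrev Letter : Type := ℕ ⊕ ℕ

/-- States of the automaton that guesses an error. -/
abbrev State : Type := ℕ ⊕ (CounterRule × ℕ × Option Bool)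

/-- The state before the error. -/
abbrev idle : State := .inl 0
/-- The state after the error. -/
abbrev done : State := .inl 1
/-- The state that checks the first cell. -/
abbrev first : State := .inl 2
/-- The state that checks that the last block has been reached. -/
abbrev last : State := .inl 3
/-- The state in the first half of a block that is checked to be short. -/
abbrev up : State := .inl 4
/-- The state in the second half of a block that is checked to be short. -/
abbrev down : State := .inl 5
/-- A state that checks a rule. -/
abbrev check (r : CounterRule) (s : ℕ) (t : Option Bool) : State := .inr (r, s, t)

variable (c : OCACode) (m : ℕ)

/-- The cells. -/
def cells : List ℕ := List.range (2 ^ c.numStates)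

/-- The letters. -/
def letters : List Letter := (cells c).map .inl ++ (List.range m).map .inr

/-- The initial states of the one-counter automaton. -/
def inits : List ℕ := c.init.filter (· < c.numStates)

/-- The final states of the one-counter automaton. -/
def finals : List ℕ := c.final.filter (· < c.numStates)

/-- The states in which the automaton may be at the beginning of a block. -/
def starts : List State :=
  idle :: up :: (c.rules m).flatMap fun r =>
    check r 0 none :: if r.2.1 = none then [check r 0 (some false)] else []

/-- The transitions outside of the check of a rule that read a cell. -/
def cellTrans : List (State × Letter × ℕ × State) :=
  (cells c).flatMap fun x =>
    [(idle, .inl x, 1, idle), (last, .inl x, 1, last), (done, .inl x, 1, done),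
      (up, .inl x, 2, up), (up, .inl x, 1, down), (up, .inl x, 0, down), (down, .inl x, 0, down)] ++
    (((finals c).flatMap fun q => if x.testBit q = true then [(idle, .inl x, 1, last)] else []) ++
    ((inits c).flatMap fun q => if x.testBit q = true then [] else [(first, .inl x, 1, done)]))

/-- The transitions that separate blocks. -/
def sepTrans : List (State × Letter × ℕ × State) :=
  (List.range m).flatMap fun a =>
    [(done, .inr a, 1, done), (up, .inr a, 1, done), (down, .inr a, 1, done)] ++
    (((starts c m).map fun s => (idle, .inr a, 1, s)) ++
    ((c.rules m).flatMap fun r => (check r 2 (some true), .inr a, 1, done) ::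
      if r.2.1 = some a then [(check r 2 none, .inr a, 1, check r 2 (some false))] else []))

/-- The transitions that read a cell during the check of a rule. -/
def checkTrans : List (State × Letter × ℕ × State) :=
  (cells c).flatMap fun x => (c.rules m).flatMap fun r => (CounterRule.sourceSteps r x).flatMap fun t =>
    (check r t.1 none, .inl x, 1 + t.2.1, check r t.2.2 none) ::
      (CounterRule.targetSteps r x).map fun t' =>
        (check r t.1 (some t'.1), .inl x, 1 + t.2.1 - t'.2.1, check r t.2.2 (some t'.2.2))

/-- The automaton that accepts, with output as long as the input, the words with an error
and, as long as the lag is not less than half of its length, those with a short block. -/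
def automaton : WeightedAutomaton State Letter where
  init := first :: starts c m
  final := [(done, 0), (last, 0), (up, 0), (down, 0)] ++
    (c.rules m).map fun r => (check r 2 (some true), 0)
  trans := cellTrans c ++ (sepTrans c m ++ checkTrans c m)

/-- The automaton that outputs one letter for every letter that it reads. -/
def copy : WeightedAutomaton ℕ Letter where
  init := [0]
  final := [(0, 0)]
  trans := (letters c m).map fun a => (0, a, 1, 0)

/-- The transitions, characterized. -/
inductive Trans : State → Letter → ℕ → State → Prop
  | idle {x : ℕ} : x < 2 ^ c.numStates → Trans idle (.inl x) 1 idle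
  | last {x : ℕ} : x < 2 ^ c.numStates → Trans last (.inl x) 1 last
  | done {x : ℕ} : x < 2 ^ c.numStates → Trans done (.inl x) 1 done
  | up {x : ℕ} : x < 2 ^ c.numStates → Trans up (.inl x) 2 up
  | up_down {x y : ℕ} : x < 2 ^ c.numStates → y ≤ 1 → Trans up (.inl x) y down
  | down {x : ℕ} : x < 2 ^ c.numStates → Trans down (.inl x) 0 down
  | idle_last {x q : ℕ} : x < 2 ^ c.numStates → q ∈ finals c → x.testBit q = true →
      Trans ErrorAutomaton.idle (.inl x) 1 ErrorAutomaton.last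
  | first {x q : ℕ} : x < 2 ^ c.numStates → q ∈ inits c → ¬ x.testBit q = true →
      Trans first (.inl x) 1 ErrorAutomaton.done
  | done_sep {a : ℕ} : a < m → Trans ErrorAutomaton.done (.inr a) 1 ErrorAutomaton.done
  | up_sep {a : ℕ} : a < m → Trans ErrorAutomaton.up (.inr a) 1 ErrorAutomaton.done
  | down_sep {a : ℕ} : a < m → Trans ErrorAutomaton.down (.inr a) 1 ErrorAutomaton.done
  | idle_sep {a : ℕ} {s : State} : a < m → s ∈ starts c m →
      Trans ErrorAutomaton.idle (.inr a) 1 s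
  | check_done {a : ℕ} {r : CounterRule} : a < m → r ∈ c.rules m →
      Trans (check r 2 (some true)) (.inr a) 1 ErrorAutomaton.done
  | check_sep {a : ℕ} {r : CounterRule} : a < m → r ∈ c.rules m → r.2.1 = some a →
      Trans (check r 2 none) (.inr a) 1 (check r 2 (some false))
  | source {x s y s' : ℕ} {r : CounterRule} : x < 2 ^ c.numStates → r ∈ c.rules m →
      (s, y, s') ∈ r.sourceSteps x → Trans (check r s none) (.inl x) (1 + y) (check r s' none)
  | both {x s y s' z : ℕ} {t t' : Bool} {r : CounterRule} : x < 2 ^ c.numStates →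
      r ∈ c.rules m → (s, y, s') ∈ r.sourceSteps x → (t, z, t') ∈ r.targetSteps x →
      Trans (check r s (some t)) (.inl x) (1 + y - z) (check r s' (some t'))

variable {c m}

theorem mem_trans_iff {s s' : State} {a : Letter} {y : ℕ} :
    (s, a, y, s') ∈ (automaton c m).trans ↔ Trans c m s a y s' := by
  constructor
  · intro h
    simp only [automaton, List.mem_append] at h
    rcases h with h | h | h
    · simp only [cellTrans, cells, List.mem_flatMap, List.mem_range, List.mem_append] at h
      obtain ⟨x, hx, h | ⟨q, hq, h⟩ | ⟨q, hq, h⟩⟩ := h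
      · simp only [List.mem_cons, Prod.mk.injEq, List.not_mem_nil, or_false] at h
        rcases h with ⟨rfl, rfl, rfl, rfl⟩ | ⟨rfl, rfl, rfl, rfl⟩ | ⟨rfl, rfl, rfl, rfl⟩ |
          ⟨rfl, rfl, rfl, rfl⟩ | ⟨rfl, rfl, rfl, rfl⟩ | ⟨rfl, rfl, rfl, rfl⟩ | ⟨rfl, rfl, rfl, rfl⟩
        exacts [.idle hx, .last hx, .done hx, .up hx, .up_down hx le_rfl, .up_down hx zero_le_one,
          .down hx]
      · split_ifs at h with hb
        · simp only [List.mem_singleton, Prod.mk.injEq] at h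
          obtain ⟨rfl, rfl, rfl, rfl⟩ := h
          exact .idle_last hx hq hb
        · simp at h
      · split_ifs at h with hb
        · simp at h
        · simp only [List.mem_singleton, Prod.mk.injEq] at h
          obtain ⟨rfl, rfl, rfl, rfl⟩ := h
          exact .first hx hq hb
    · simp only [sepTrans, List.mem_flatMap, List.mem_range, List.mem_append, List.mem_map] at h
      obtain ⟨a, ha, h | ⟨s, hs, h⟩ | ⟨r, hr, h⟩⟩ := h
      · simp only [List.mem_cons, Prod.mk.injEq, List.not_mem_nil, or_false] at h
        rcases h with ⟨rfl, rfl, rfl, rfl⟩ | ⟨rfl, rfl, rfl, rfl⟩ | ⟨rfl, rfl, rfl, rfl⟩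
        exacts [.done_sep ha, .up_sep ha, .down_sep ha]
      · simp only [Prod.mk.injEq] at h
        obtain ⟨rfl, rfl, rfl, rfl⟩ := h
        exact .idle_sep ha hs
      · rcases List.mem_cons.1 h with h | h
        · simp only [Prod.mk.injEq] at h
          obtain ⟨rfl, rfl, rfl, rfl⟩ := h
          exact .check_done ha hr
        · split_ifs at h with hra
          · simp only [List.mem_singleton, Prod.mk.injEq] at h
            obtain ⟨rfl, rfl, rfl, rfl⟩ := h
            exact .check_sep ha hr hra
          · simp at h
    · simp only [checkTrans, cells, List.mem_flatMap, List.mem_range] at h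
      obtain ⟨x, hx, r, hr, ⟨s, y, s'⟩, ht, h⟩ := h
      rcases List.mem_cons.1 h with h | h
      · simp only [Prod.mk.injEq] at h
        obtain ⟨rfl, rfl, rfl, rfl⟩ := h
        exact .source hx hr ht
      · obtain ⟨⟨t, z, t'⟩, ht', h⟩ := List.mem_map.1 h
        simp only [Prod.mk.injEq] at h
        obtain ⟨rfl, rfl, rfl, rfl⟩ := h
        exact .both hx hr ht ht'
  · intro h
    simp only [automaton, List.mem_append]
    cases h with
    | idle hx => left; exact List.mem_flatMap.2 ⟨_, List.mem_range.2 hx, by simp⟩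
    | last hx => left; exact List.mem_flatMap.2 ⟨_, List.mem_range.2 hx, by simp⟩
    | done hx => left; exact List.mem_flatMap.2 ⟨_, List.mem_range.2 hx, by simp⟩
    | up hx => left; exact List.mem_flatMap.2 ⟨_, List.mem_range.2 hx, by simp⟩
    | up_down hx hy =>
      left
      refine List.mem_flatMap.2 ⟨_, List.mem_range.2 hx, ?_⟩
      interval_cases y <;> simp
    | down hx => left; exact List.mem_flatMap.2 ⟨_, List.mem_range.2 hx, by simp⟩
    | idle_last hx hq hb =>
      left
      refine List.mem_flatMap.2 ⟨_, List.mem_range.2 hx, List.mem_append_right _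
        (List.mem_append_left _ (List.mem_flatMap.2 ⟨_, hq, ?_⟩))⟩
      rw [if_pos hb]
      exact List.mem_singleton_self _
    | first hx hq hb =>
      left
      refine List.mem_flatMap.2 ⟨_, List.mem_range.2 hx, List.mem_append_right _
        (List.mem_append_right _ (List.mem_flatMap.2 ⟨_, hq, ?_⟩))⟩
      rw [if_neg hb]
      exact List.mem_singleton_self _
    | done_sep ha => right; left; exact List.mem_flatMap.2 ⟨_, List.mem_range.2 ha, by simp⟩
    | up_sep ha => right; left; exact List.mem_flatMap.2 ⟨_, List.mem_range.2 ha, by simp⟩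
    | down_sep ha => right; left; exact List.mem_flatMap.2 ⟨_, List.mem_range.2 ha, by simp⟩
    | idle_sep ha hs =>
      right; left
      exact List.mem_flatMap.2 ⟨_, List.mem_range.2 ha, List.mem_append_right _
        (List.mem_append_left _ (List.mem_map.2 ⟨_, hs, rfl⟩))⟩
    | check_done ha hr =>
      right; left
      exact List.mem_flatMap.2 ⟨_, List.mem_range.2 ha, List.mem_append_right _
        (List.mem_append_right _ (List.mem_flatMap.2 ⟨_, hr, List.mem_cons_self⟩))⟩
    | check_sep ha hr hra =>
      right; left
      refine List.mem_flatMap.2 ⟨_, List.mem_range.2 ha, List.mem_append_right _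
        (List.mem_append_right _ (List.mem_flatMap.2 ⟨_, hr, List.mem_cons_of_mem _ ?_⟩))⟩
      rw [if_pos hra]
      exact List.mem_singleton_self _
    | source hx hr ht =>
      right; right
      exact List.mem_flatMap.2 ⟨_, List.mem_range.2 hx, List.mem_flatMap.2 ⟨_, hr,
        List.mem_flatMap.2 ⟨_, ht, List.mem_cons_self⟩⟩⟩
    | both hx hr ht ht' =>
      right; right
      exact List.mem_flatMap.2 ⟨_, List.mem_range.2 hx, List.mem_flatMap.2 ⟨_, hr,
        List.mem_flatMap.2 ⟨_, ht, List.mem_cons_of_mem _ (List.mem_map.2 ⟨_, ht', rfl⟩)⟩⟩⟩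

theorem mem_starts_iff {s : State} : s ∈ starts c m ↔ s = idle ∨ s = up ∨
    ∃ r ∈ c.rules m, s = check r 0 none ∨ r.2.1 = none ∧ s = check r 0 (some false) := by
  simp only [starts, List.mem_cons, List.mem_flatMap]
  refine or_congr_right (or_congr_right (exists_congr fun r => and_congr_right fun _ =>
    or_congr_right ?_))
  split_ifs with h <;> simp [h]

/-- The letters and output lengths of a word that is copied. -/
def copied (u : List Letter) : List (Letter × ℕ) := u.map fun a => (a, 1)

variable (c m) in
/-- The automaton accepts `u` from the state `s` with a lag of at most `k`, if its initial
deficit is `d`. -/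
def Acc (k : ℕ) (s : State) (d : ℤ) (u : List Letter) : Prop :=
  (automaton c m).Matches k s d (copied u) 0

theorem acc_nil {k : ℕ} {s : State} {d : ℤ} :
    Acc c m k s d [] ↔ (s, 0) ∈ (automaton c m).final ∧ d = 0 := by
  constructor
  · intro h
    cases h with
    | @nil _ _ _ y hs hd e =>
      obtain rfl : y = 0 := by
        simp only [automaton, List.mem_append, List.mem_cons, List.mem_map, Prod.mk.injEq,
          List.not_mem_nil, or_false] at hs
        rcases hs with (h | h | h | h) | ⟨r, _, h⟩ <;> first | exact h.2 | exact h.2.symm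
      exact ⟨hs, by simpa using e⟩
  · rintro ⟨h, rfl⟩
    exact .nil h (by simp) (by simp)

/-- The copying side writes one letter per step, so a transition of weight `y` changes the
difference by `1 - y`. -/
theorem acc_cons {k : ℕ} {s : State} {d : ℤ} {a : Letter} {u : List Letter} :
    Acc c m k s d (a :: u) ↔
      |d| ≤ k ∧ ∃ y s', Trans c m s a y s' ∧ Acc c m k s' (d + 1 - y) u := by
  constructor
  · intro h
    cases h with
    | cons ht hd h => exact ⟨hd, _, _, mem_trans_iff.1 ht, by simpa [Acc, copied] using h⟩
  · rintro ⟨hd, y, s', ht, h⟩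
    exact .cons (mem_trans_iff.2 ht) hd (by simpa [Acc, copied] using h)

theorem Acc.step {k : ℕ} {s s' : State} {d d' : ℤ} {a : Letter} {u : List Letter} {y : ℕ}
    (ht : Trans c m s a y s') (hd : |d| ≤ k) (h : Acc c m k s' d' u) (e : d' = d + 1 - y) :
    Acc c m k s d (a :: u) :=
  acc_cons.2 ⟨hd, y, s', ht, e ▸ h⟩

/-- The word with the first block `l` and the given further separators and blocks. -/
def word (l : List ℕ) (b : List (ℕ × List ℕ)) : List Letter :=
  l.map .inl ++ b.flatMap fun t => .inr t.1 :: t.2.map .inl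

@[simp] theorem word_cons (x : ℕ) (l : List ℕ) (b : List (ℕ × List ℕ)) :
    word (x :: l) b = .inl x :: word l b := rfl
@[simp] theorem word_nil_cons (a : ℕ) (l : List ℕ) (b : List (ℕ × List ℕ)) :
    word [] ((a, l) :: b) = .inr a :: word l b := rfl

theorem exists_eq_word (u : List Letter) : ∃ l b, u = word l b := by
  induction u with
  | nil => exact ⟨[], [], rfl⟩
  | cons a u ih =>
    obtain ⟨l, b, rfl⟩ := ih
    rcases a with x | a
    · exact ⟨x :: l, b, rfl⟩
    · exact ⟨[], (a, l) :: b, rfl⟩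

variable (c m) in
/-- All letters of the word with the given blocks are admissible. -/
def Admissible (l : List ℕ) (b : List (ℕ × List ℕ)) : Prop :=
  (∀ x ∈ l, x < 2 ^ c.numStates) ∧ ∀ t ∈ b, t.1 < m ∧ ∀ x ∈ t.2, x < 2 ^ c.numStates

theorem Admissible.of_cons {x : ℕ} {l : List ℕ} {b : List (ℕ × List ℕ)}
    (h : Admissible c m (x :: l) b) : x < 2 ^ c.numStates ∧ Admissible c m l b := by
  obtain ⟨h₁, h₂⟩ := h
  simp only [List.mem_cons, forall_eq_or_imp] at h₁
  exact ⟨h₁.1, h₁.2, h₂⟩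

theorem Admissible.of_sep {a : ℕ} {l l' : List ℕ} {b : List (ℕ × List ℕ)}
    (h : Admissible c m l ((a, l') :: b)) : a < m ∧ Admissible c m l' b := by
  obtain ⟨h₁, h₂⟩ := h
  simp only [List.mem_cons, forall_eq_or_imp] at h₂
  exact ⟨h₂.1.1, h₂.1.2, h₂.2⟩

theorem admissible_iff {l : List ℕ} {b : List (ℕ × List ℕ)} :
    Admissible c m l b ↔ ∀ a ∈ word l b, a ∈ letters c m := by
  simp only [word, letters, cells, List.mem_append, List.mem_map, List.mem_flatMap, List.mem_cons,
    List.mem_range, Admissible]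
  constructor
  · rintro ⟨h₁, h₂⟩ a (⟨x, hx, rfl⟩ | ⟨t, ht, rfl | ⟨x, hx, rfl⟩⟩)
    exacts [.inl ⟨x, h₁ x hx, rfl⟩, .inr ⟨_, (h₂ t ht).1, rfl⟩, .inl ⟨x, (h₂ t ht).2 x hx, rfl⟩]
  · intro h
    refine ⟨fun x hx => ?_, fun t ht => ⟨?_, fun x hx => ?_⟩⟩
    · simpa using h (.inl x) (.inl ⟨x, hx, rfl⟩)
    · simpa using h (.inr t.1) (.inr ⟨t, ht, .inl rfl⟩)
    · simpa using h (.inl x) (.inr ⟨t, ht, .inr ⟨x, hx, rfl⟩⟩)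

/-! #### Words with an error are accepted -/

section Complete

variable {k : ℕ}

theorem acc_done {l : List ℕ} {b : List (ℕ × List ℕ)} (h : Admissible c m l b) :
    Acc c m k done 0 (word l b) := by
  rw [admissible_iff] at h
  generalize word l b = u at h
  induction u with
  | nil => exact acc_nil.2 ⟨by simp [automaton], rfl⟩
  | cons a u ih =>
    simp only [List.mem_cons, forall_eq_or_imp] at h
    have ha : Trans c m done a 1 done := by
      have := h.1
      simp only [letters, cells, List.mem_append, List.mem_map, List.mem_range] at this
      rcases this with ⟨x, hx, rfl⟩ | ⟨a, ha, rfl⟩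
      exacts [.done hx, .done_sep ha]
    exact .step ha (by simp) (ih h.2) (by simp)

/-- The error may be located in any later block: `idle` writes one letter per input letter and keeps
the lag at zero. -/
theorem acc_idle {a : ℕ} {l l' : List ℕ} {b : List (ℕ × List ℕ)}
    (h : Admissible c m l ((a, l') :: b)) (hs : ∃ s ∈ starts c m, Acc c m k s 0 (word l' b)) :
    Acc c m k idle 0 (word l ((a, l') :: b)) := by
  induction l with
  | nil =>
    obtain ⟨s, hs, hs'⟩ := hs
    exact .step (.idle_sep h.of_sep.1 hs) (by simp) hs' (by simp)
  | cons x l ih => exact .step (.idle h.of_cons.1) (by simp) (ih h.of_cons.2) (by simp)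

theorem acc_down {l : List ℕ} {b : List (ℕ × List ℕ)} (h : Admissible c m l b)
    (hl : l.length ≤ k) : Acc c m k down (-l.length) (word l b) := by
  induction l with
  | nil =>
    rcases b with _ | ⟨⟨a, l'⟩, b⟩
    · exact acc_nil.2 ⟨by simp [automaton], by simp⟩
    · exact .step (.down_sep h.of_sep.1) (by simp) (acc_done h.of_sep.2) (by simp)
  | cons x l ih =>
    rw [List.length_cons] at hl
    refine .step (.down h.of_cons.1) ?_ (ih h.of_cons.2 (by omega)) (by push_cast [List.length_cons]; ring)
    rw [abs_neg, Nat.abs_cast]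
    exact_mod_cast hl

/-- Weights 2 in the first half of the block are balanced by weights 0 in the second half, so that
the lag returns to zero at its end. -/
theorem acc_up {l : List ℕ} {b : List (ℕ × List ℕ)} (h : Admissible c m l b) {n : ℕ}
    (hn : n ≤ l.length) (hl : l.length + n ≤ k) : Acc c m k up (-n) (word l b) := by
  induction l generalizing n with
  | nil =>
    obtain rfl : n = 0 := by simpa using hn
    rcases b with _ | ⟨⟨a, l'⟩, b⟩
    · exact acc_nil.2 ⟨by simp [automaton], by simp⟩
    · exact .step (.up_sep h.of_sep.1) (by simp) (acc_done h.of_sep.2) (by simp)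
  | cons x l ih =>
    rw [List.length_cons] at hl hn
    have hd : |(-n : ℤ)| ≤ k := by
      rw [abs_neg, Nat.abs_cast]
      exact_mod_cast (by omega : n ≤ k)
    have hx := h.of_cons.1
    -- The turn happens in the middle: the middle cell gets weight 1 if the block has odd length,
    -- and the first cell of the second half gets weight 0 if it has even length.
    rcases lt_trichotomy n l.length with hlt | rfl | hlt
    · exact .step (.up hx) hd (ih h.of_cons.2 (n := n + 1) hlt (by omega)) (by push_cast; ring)
    · exact .step (.up_down hx le_rfl) hd (acc_down h.of_cons.2 (by omega)) (by simp)
    · obtain rfl : n = l.length + 1 := by omega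
      exact .step (.up_down hx zero_le_one) hd (acc_down h.of_cons.2 (by omega))
        (by push_cast; ring)

/-- The lag is the source total still to come minus the target total still to come. Both lie in `[0,
k]`, and the lag ends at zero precisely because the full totals balance. -/
theorem acc_both {r : CounterRule} (hr : r ∈ c.rules m) {l : List ℕ} {b : List (ℕ × List ℕ)}
    (h : Admissible c m l b) {s x y : ℕ} {t : Bool} (hx : r.Source s l x) (hy : r.Target t l y)
    (hxk : x ≤ k) (hyk : y ≤ k) : Acc c m k (check r s (some t)) (x - y) (word l b) := by
  induction hx generalizing t y with
  | nil =>
    cases hy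
    rcases b with _ | ⟨⟨a, l'⟩, b⟩
    · exact acc_nil.2 ⟨by simp [automaton, hr], by simp⟩
    · exact .step (.check_done h.of_sep.1 hr) (by simp) (acc_done h.of_sep.2) (by simp)
  | @cons s s' i x x' l hs _ ih =>
    cases hy with
    | @cons _ t' _ y y' _ ht hy =>
      have := CounterRule.le_one_of_mem_targetSteps ht
      refine .step (.both h.of_cons.1 hr hs ht) ?_ (ih h.of_cons.2 hy (by omega) (by omega)) ?_
      · rw [abs_le]
        constructor <;> omega
      · push_cast [Nat.cast_sub (show y ≤ 1 + x by omega)]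
        ring

/-- For a rule that reads a letter, the source total is stored in the lag during the first block;
the target total has to pay it back in the next one. -/
theorem acc_source {r : CounterRule} (hr : r ∈ c.rules m) {l l' : List ℕ} {a : ℕ}
    {b : List (ℕ × List ℕ)} (h : Admissible c m l ((a, l') :: b)) (ha : r.2.1 = some a) {s x : ℕ}
    (hx : r.Source s l x) {d : ℕ} (hd : d + x ≤ k)
    (hs : Acc c m k (check r 2 (some false)) (-(d + x : ℕ)) (word l' b)) :
    Acc c m k (check r s none) (-d) (word l ((a, l') :: b)) := by
  have hdk : |(-d : ℤ)| ≤ k := by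
    rw [abs_neg, Nat.abs_cast]
    exact_mod_cast (by omega : d ≤ k)
  induction hx generalizing d with
  | nil => exact .step (.check_sep h.of_sep.1 hr ha) hdk hs (by simp)
  | @cons s s' i x x' l hst _ ih =>
    rw [← Nat.add_assoc] at hs
    refine .step (.source h.of_cons.1 hr hst) hdk (ih h.of_cons.2 (d := d + x) (by omega) hs ?_)
      (by push_cast; ring)
    rw [abs_neg, Nat.abs_cast]
    exact_mod_cast (by omega : d + x ≤ k)

theorem acc_last {l : List ℕ} (h : Admissible c m l []) : Acc c m k last 0 (word l []) := by
  induction l with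
  | nil => exact acc_nil.2 ⟨by simp [automaton], rfl⟩
  | cons x l ih => exact .step (.last h.of_cons.1) (by simp) (ih h.of_cons.2) (by simp)

theorem acc_idle_last {l : List ℕ} (h : Admissible c m l []) {x q : ℕ} (hx : x ∈ l)
    (hq : q ∈ finals c) (hb : x.testBit q = true) : Acc c m k idle 0 (word l []) := by
  induction l with
  | nil => simp at hx
  | cons y l ih =>
    rcases List.mem_cons.1 hx with rfl | hx
    · exact .step (.idle_last h.of_cons.1 hq hb) (by simp) (acc_last h.of_cons.2) (by simp)
    · exact .step (.idle h.of_cons.1) (by simp) (ih h.of_cons.2 hx) (by simp)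

theorem step_iff {x y : ℕ × ℕ} {a : Option ℕ} : (c.toLists m).Step x a y ↔
    ∃ r ∈ c.rules m, r.1 = x.1 ∧ r.2.1 = a ∧ r.2.2.2.2 = y.1 ∧
      CounterRule.Fires r x.2 y.2 := by
  obtain ⟨p, n⟩ := x
  obtain ⟨q, n'⟩ := y
  constructor
  · rintro (h | h)
    · exact ⟨_, h, rfl, rfl, rfl, rfl, rfl⟩
    · exact ⟨_, h, rfl, rfl, rfl, _, rfl, rfl⟩
  · rintro ⟨⟨_, _, z, j, _⟩, h, rfl, rfl, rfl, hf⟩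
    cases z
    · obtain ⟨i, h₁, h₂⟩ := hf
      dsimp only at h₁ h₂
      subst h₁ h₂
      exact .pos h
    · obtain ⟨h₁, h₂⟩ := hf
      dsimp only at h₁ h₂
      subst h₁ h₂
      exact .zero h

theorem run_start_mem {S Ω : Type} {A : OneCounterAutomaton Ω S} {C : Set ℕ} {x y : S × ℕ}
    {w : List Ω} (h : A.Run C x w y) : x.2 ∈ C := by
  cases h <;> assumption

theorem run_end_mem {S Ω : Type} {A : OneCounterAutomaton Ω S} {C : Set ℕ} {x y : S × ℕ}
    {w : List Ω} (h : A.Run C x w y) : y.2 ∈ C := by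
  induction h <;> assumption

/-- The accepting run is followed through the cells as long as its configurations are marked. The
first unmarked one exposes a violated rule; if there is none, a final state is marked in the last
block. Blocks longer than `k` contain a cell for every counter value of the run. -/
theorem exists_acc_of_run {x y : ℕ × ℕ} {w : List ℕ}
    (hr : (c.toLists m).Run (Set.Iic k) x w y) (hy : y.1 ∈ finals c) {l : List ℕ}
    {b : List (ℕ × List ℕ)} (h : Admissible c m l b) (hw : w = b.map Prod.fst)
    (hl : k < l.length) (hb : ∀ t ∈ b, k < t.2.length) {i : ℕ} (hi : l[x.2]? = some i)
    (hx : i.testBit x.1 = true) : ∃ s ∈ starts c m, Acc c m k s 0 (word l b) := by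
  induction hr generalizing l b i with
  | nil hc =>
    obtain rfl : b = [] := by simpa using hw.symm
    exact ⟨idle, by simp [starts], acc_idle_last h (List.mem_of_getElem? hi) hy hx⟩
  | @cons x x' y a w hc hs hr ih =>
    obtain ⟨r, hr', e₁, rfl, e₂, hf⟩ := step_iff.1 hs
    have hk : x'.2 ≤ k := run_start_mem hr
    cases ha : r.2.1 with
    | none =>
      rw [ha] at hw
      -- A silent rule stays in the same block, so source and target are checked simultaneously
      -- there.
      by_cases hx' : (l[x'.2]'(by omega)).testBit x'.1 = true
      · exact ih hy h hw hl hb (List.getElem?_eq_getElem _) hx'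
      · refine ⟨check r 0 (some false), mem_starts_iff.2 (.inr (.inr ⟨r, hr', .inr ⟨ha, rfl⟩⟩)), ?_⟩
        have := acc_both (k := k) hr' h
          (CounterRule.source_zero_iff.2 ⟨x.2, i, hi, by rw [e₁]; exact hx, hf⟩)
          (CounterRule.target_false_iff.2 ⟨l[x'.2]'(by omega), List.getElem?_eq_getElem _,
            by rw [e₂]; exact hx'⟩) hk hk
        simpa using this
    | some a =>
      rw [ha] at hw
      obtain ⟨⟨a', l'⟩, b, rfl, e, rfl⟩ := List.map_eq_cons_iff.1 hw.symm
      dsimp only at e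
      subst e
      simp only [List.mem_cons, forall_eq_or_imp] at hb
      have hl' := hb.1
      by_cases hx' : (l'[x'.2]'(by omega)).testBit x'.1 = true
      · exact ⟨idle, by simp [starts], acc_idle h
          (ih hy h.of_sep.2 rfl hb.1 hb.2 (List.getElem?_eq_getElem _) hx')⟩
      · refine ⟨check r 0 none, mem_starts_iff.2 (.inr (.inr ⟨r, hr', .inl rfl⟩)), ?_⟩
        have := acc_both (k := k) hr' h.of_sep.2 (CounterRule.source_two_iff.2 rfl)
          (CounterRule.target_false_iff.2 ⟨l'[x'.2]'(by omega), List.getElem?_eq_getElem _,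
            by rw [e₂]; exact hx'⟩) (Nat.zero_le _) hk
        have := acc_source (k := k) (d := 0) hr' h ha
          (CounterRule.source_zero_iff.2 ⟨x.2, i, hi, by rw [e₁]; exact hx, hf⟩) (by omega)
          (by simpa using this)
        simpa using this

theorem exists_acc_of_short {l : List ℕ} {b : List (ℕ × List ℕ)} (h : Admissible c m l b)
    (hs : l.length ≤ k ∨ ∃ t ∈ b, t.2.length ≤ k) :
    ∃ s ∈ starts c m, Acc c m k s 0 (word l b) := by
  by_cases hl : l.length ≤ k
  · exact ⟨up, by simp [starts], by simpa using acc_up (n := 0) h (Nat.zero_le _) hl⟩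
  · replace hs := hs.resolve_left hl
    clear hl
    induction b generalizing l with
    | nil => simp at hs
    | cons t b ih =>
      obtain ⟨a, l'⟩ := t
      refine ⟨idle, by simp [starts], acc_idle h ?_⟩
      by_cases hl : l'.length ≤ k
      · exact ⟨up, by simp [starts], by simpa using acc_up (n := 0) h.of_sep.2 (Nat.zero_le _) hl⟩
      · refine ih h.of_sep.2 ?_
        simpa [hl] using hs

theorem exists_acc {l : List ℕ} {b : List (ℕ × List ℕ)} (h : Admissible c m l b)
    (hw : (c.toLists m).AcceptsWithin (Set.Iic k) (b.map Prod.fst)) :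
    ∃ s ∈ (automaton c m).init, Acc c m k s 0 (word l b) := by
  by_cases hs : l.length ≤ k ∨ ∃ t ∈ b, t.2.length ≤ k
  · obtain ⟨s, hs, hs'⟩ := exists_acc_of_short h hs
    exact ⟨s, List.mem_cons_of_mem _ hs, hs'⟩
  · push Not at hs
    obtain ⟨p, hp, q, hq, n, hr⟩ := hw
    -- The first block is longer than `k`, hence has a cell for counter value 0, where the initial
    -- state must be marked.
    obtain ⟨x, l, rfl⟩ := List.exists_cons_of_length_pos (Nat.zero_lt_of_lt hs.1)
    by_cases hx : x.testBit p = true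
    · obtain ⟨s, hs, hs'⟩ := exists_acc_of_run hr hq h rfl hs.1 hs.2 (i := x) rfl hx
      exact ⟨s, List.mem_cons_of_mem _ hs, hs'⟩
    · exact ⟨first, List.mem_cons_self, .step (.first h.of_cons.1 hp hx) (by simp)
        (acc_done h.of_cons.2) (by simp)⟩

end Complete

/-! #### Accepted words have an error or a short block -/

section Sound

variable {k : ℕ} {d : ℤ} {l : List ℕ} {b : List (ℕ × List ℕ)}

theorem eq_zero_of_acc_done {u : List Letter} (h : Acc c m k done d u) : d = 0 := by
  induction u generalizing d with
  | nil => exact (acc_nil.1 h).2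
  | cons a u ih =>
    obtain ⟨-, y, s', ht, h⟩ := acc_cons.1 h
    cases ht <;> simpa using ih h

theorem eq_nil_of_acc_last (h : Acc c m k last d (word l b)) : b = [] := by
  induction l generalizing d with
  | nil =>
    rcases b with _ | ⟨⟨a, l'⟩, b⟩
    · rfl
    · obtain ⟨-, y, s', ht, h⟩ := acc_cons.1 h
      cases ht
  | cons x l ih =>
    obtain ⟨-, y, s', ht, h⟩ := acc_cons.1 h
    cases ht
    exact ih h

/-- The state `idle` is not final, so it must be left: through a marked final state, after which no
separator can be read, or at a separator. -/
theorem acc_idle_cases (h : Acc c m k idle 0 (word l b)) :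
    (b = [] ∧ ∃ x ∈ l, ∃ q ∈ finals c, x.testBit q = true) ∨
      ∃ a l' b', b = (a, l') :: b' ∧ ∃ s ∈ starts c m, Acc c m k s 0 (word l' b') := by
  induction l with
  | nil =>
    rcases b with _ | ⟨⟨a, l'⟩, b⟩
    · have := (acc_nil.1 h).1
      simp [automaton] at this
    · obtain ⟨-, y, s', ht, h⟩ := acc_cons.1 h
      cases ht with
      | idle_sep ha hs =>
        have h : Acc c m k s' (0 + 1 - (1 : ℕ)) (word l' b) := h
        exact .inr ⟨a, l', b, rfl, s', hs, by simpa using h⟩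
  | cons x l ih =>
    obtain ⟨-, y, s', ht, h⟩ := acc_cons.1 h
    cases ht with
    | idle hx =>
      have h : Acc c m k idle (0 + 1 - (1 : ℕ)) (word l b) := h
      rcases ih (by simpa using h) with ⟨hb, x', hx', hq⟩ | h
      · exact .inl ⟨hb, x', List.mem_cons_of_mem _ hx', hq⟩
      · exact .inr h
    | idle_last hx hq hb => exact .inl ⟨eq_nil_of_acc_last h, x, List.mem_cons_self, _, hq, hb⟩

theorem acc_down_length (h : Acc c m k down d (word l b)) : d = -l.length := by
  induction l generalizing d with
  | nil =>
    rcases b with _ | ⟨⟨a, l'⟩, b⟩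
    · simpa using (acc_nil.1 h).2
    · obtain ⟨-, y, s', ht, h⟩ := acc_cons.1 h
      cases ht
      simpa using eq_zero_of_acc_done h
  | cons x l ih =>
    obtain ⟨-, y, s', ht, h⟩ := acc_cons.1 h
    cases ht
    have := ih h
    push_cast [List.length_cons] at this ⊢
    linarith

/-- Every cell read in `up` lowers the difference by one, which is possible only down to `-k`, and
`down` raises it by one per cell back to zero; one more cell may be spent on the turn. -/
theorem acc_up_length (h : Acc c m k up d (word l b)) : (l.length : ℤ) ≤ d + 2 * k + 1 := by
  induction l generalizing d with
  | nil =>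
    rcases b with _ | ⟨⟨a, l'⟩, b⟩
    · have := (acc_nil.1 h).2
      simp only [List.length_nil]
      omega
    · obtain ⟨-, y, s', ht, h⟩ := acc_cons.1 h
      cases ht
      have := eq_zero_of_acc_done h
      simp only [List.length_nil]
      push_cast at this
      omega
  | cons x l ih =>
    obtain ⟨hd, y, s', ht, h⟩ := acc_cons.1 h
    rw [abs_le] at hd
    cases ht with
    | up hx =>
      have := ih h
      push_cast [List.length_cons] at this ⊢
      linarith
    | up_down hx hy =>
      have := acc_down_length h
      push_cast [List.length_cons]
      omega

/-- After the check only `done` can follow, and it preserves the difference, so the difference at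
the beginning is exactly what the two totals cancel. -/
theorem exists_of_acc_both {r : CounterRule} {s : ℕ} {t : Bool}
    (h : Acc c m k (check r s (some t)) d (word l b)) :
    ∃ x y : ℕ, r.Source s l x ∧ r.Target t l y ∧ d = x - y := by
  induction l generalizing d s t with
  | nil =>
    have : s = 2 ∧ t = true ∧ d = 0 := by
      rcases b with _ | ⟨⟨a, l'⟩, b⟩
      · obtain ⟨hs, hd⟩ := acc_nil.1 h
        simp [automaton] at hs
        grind
      · obtain ⟨-, y, s', ht, h⟩ := acc_cons.1 h
        cases ht
        exact ⟨rfl, rfl, by simpa using eq_zero_of_acc_done h⟩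
    obtain ⟨rfl, rfl, rfl⟩ := this
    exact ⟨0, 0, .nil, .nil, rfl⟩
  | cons i l ih =>
    obtain ⟨-, y, s', ht, h⟩ := acc_cons.1 h
    cases ht with
    | @both _ _ y _ z _ _ _ hx hr hs ht =>
      obtain ⟨x', y', hx', hy', e⟩ := ih h
      have := CounterRule.le_one_of_mem_targetSteps ht
      exact ⟨_, _, .cons hs hx', .cons ht hy', by push_cast at e ⊢; omega⟩

theorem exists_of_acc_source {r : CounterRule} {s : ℕ}
    (h : Acc c m k (check r s none) d (word l b)) :
    ∃ (a : ℕ) (l' : List ℕ) (b' : List (ℕ × List ℕ)) (x : ℕ), b = (a, l') :: b' ∧ r.2.1 = some a ∧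
      r.Source s l x ∧ Acc c m k (check r 2 (some false)) (d - x) (word l' b') := by
  induction l generalizing d s with
  | nil =>
    rcases b with _ | ⟨⟨a, l'⟩, b⟩
    · have := (acc_nil.1 h).1
      simp [automaton] at this
    · obtain ⟨-, y, s', ht, h⟩ := acc_cons.1 h
      cases ht with
      | check_sep ha hr hra =>
        have h : Acc c m k _ (d + 1 - (1 : ℕ)) (word l' b) := h
        exact ⟨a, l', b, 0, rfl, hra, .nil, by simpa using h⟩
  | cons i l ih =>
    obtain ⟨-, y, s', ht, h⟩ := acc_cons.1 h
    cases ht with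
    | @source _ _ y _ _ hx hr hs =>
      obtain ⟨a, l', b', x, rfl, ha, hx', h⟩ := ih h
      refine ⟨a, l', b', y + x, rfl, ha, .cons hs hx', ?_⟩
      convert h using 1
      push_cast
      ring

/-! ### The word of reachable configurations -/

variable (c m) in
/-- The configurations with a counter of at most `k` that are reached when reading `v`. -/
def Reach (k : ℕ) (v : List ℕ) (q n : ℕ) : Prop :=
  ∃ p ∈ inits c, (c.toLists m).Run (Set.Iic k) (p, 0) v (q, n)

open Classical in
variable (c m) in
/-- The block that presents the configurations that are reached when reading `v`. -/
noncomputable def reachBlock (k : ℕ) (v : List ℕ) : List ℕ :=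
  (List.range (k + 1)).map fun n => Nat.ofBits fun q : Fin c.numStates => decide (Reach c m k v q n)

theorem length_reachBlock {v : List ℕ} : (reachBlock c m k v).length = k + 1 := by
  simp [reachBlock]

theorem lt_of_mem_reachBlock {v : List ℕ} {x : ℕ} (h : x ∈ reachBlock c m k v) :
    x < 2 ^ c.numStates := by
  simp only [reachBlock, List.mem_map] at h
  obtain ⟨n, -, rfl⟩ := h
  exact Nat.ofBits_lt_two_pow _

theorem testBit_reachBlock {v : List ℕ} {n x q : ℕ} (h : (reachBlock c m k v)[n]? = some x)
    (hq : q < c.numStates) : x.testBit q = true ↔ Reach c m k v q n := by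
  simp only [reachBlock, List.getElem?_map, Option.map_eq_some_iff] at h
  obtain ⟨n', h, rfl⟩ := h
  obtain ⟨-, rfl⟩ := List.getElem?_eq_some_iff.1 h
  rw [Nat.testBit_ofBits_lt _ _ hq]
  simp

variable (c m) in
/-- The blocks after those for `v` that present the configurations reached when reading `w`. -/
noncomputable def reachBlocks (k : ℕ) : List ℕ → List ℕ → List (ℕ × List ℕ)
  | _, [] => []
  | v, a :: w => (a, reachBlock c m k (v ++ [a])) :: reachBlocks k (v ++ [a]) w

theorem admissible_reachBlocks {v w : List ℕ} (hw : ∀ a ∈ w, a < m) :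
    Admissible c m (reachBlock c m k v) (reachBlocks c m k v w) := by
  refine ⟨fun x => lt_of_mem_reachBlock, ?_⟩
  induction w generalizing v with
  | nil => simp [reachBlocks]
  | cons a w ih =>
    simp only [List.mem_cons, forall_eq_or_imp, reachBlocks] at hw ⊢
    exact ⟨⟨hw.1, fun x => lt_of_mem_reachBlock⟩, ih hw.2⟩

theorem Reach.step {v : List ℕ} {r : CounterRule} (hr : r ∈ c.rules m) {n n' : ℕ}
    (h : Reach c m k v r.1 n) (hf : r.Fires n n') (hn : n' ≤ k) :
    Reach c m k (v ++ r.2.1.toList) r.2.2.2.2 n' := by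
  obtain ⟨p, hp, h⟩ := h
  have := LagAutomaton.run_append h (.cons (run_end_mem h)
    (step_iff.2 ⟨r, hr, rfl, rfl, rfl, hf⟩ : (c.toLists m).Step (r.1, n) r.2.1 (r.2.2.2.2, n'))
    (.nil hn))
  exact ⟨p, hp, by simpa using this⟩

/-- A block has cells only for counters up to `k`, so an unmarked target would be a configuration
within the bound, and the marked ones are closed under rules within the bound. -/
theorem not_acc_of_rule {v : List ℕ} {r : CounterRule} (hr : r ∈ c.rules m) {x : ℕ}
    (hs : r.Source 0 (reachBlock c m k v) x)
    (ht : r.Target false (reachBlock c m k (v ++ r.2.1.toList)) x) : False := by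
  obtain ⟨n, i, hn, hi, hf⟩ := CounterRule.source_zero_iff.1 hs
  obtain ⟨j, hj, hj'⟩ := CounterRule.target_false_iff.1 ht
  have hlt : r.1 < c.numStates ∧ r.2.2.2.2 < c.numStates := by
    have := (List.mem_filter.1 hr).2
    simp only [decide_eq_true_eq] at this
    exact ⟨this.1, this.2.2⟩
  have hx := (List.getElem?_eq_some_iff.1 hj).1
  rw [length_reachBlock] at hx
  rw [testBit_reachBlock hn hlt.1] at hi
  rw [testBit_reachBlock hj hlt.2] at hj'
  exact hj' (hi.step hr hf (by omega))

/-- The blocks have length `K + 1`, at least `2k + 2`, one more than the short-block check can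
certify with lag `k`. All rules are respected by `not_acc_of_rule`, and no final state is marked at
the end by `hw`. -/
theorem not_acc_reachBlocks {K : ℕ} {v w : List ℕ} (hk : 2 * k + 1 ≤ K)
    (hw : ∀ q ∈ finals c, ∀ n, ¬ Reach c m K (v ++ w) q n) :
    ∀ s ∈ starts c m,
      ¬ Acc c m k s 0 (word (reachBlock c m K v) (reachBlocks c m K v w)) := by
  intro s hs h
  induction w generalizing v s with
  | nil =>
    rcases mem_starts_iff.1 hs with rfl | rfl | ⟨r, hr, rfl | ⟨ha, rfl⟩⟩
    · rcases acc_idle_cases h with ⟨-, x, hx, q, hq, hb⟩ | ⟨a, l', b', e, -⟩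
      · obtain ⟨n, hn⟩ := List.mem_iff_getElem?.1 hx
        rw [testBit_reachBlock hn (by simpa using (List.mem_filter.1 hq).2)] at hb
        exact hw q hq n (by simpa using hb)
      · simp [reachBlocks] at e
    · have := acc_up_length h
      rw [length_reachBlock] at this
      omega
    · obtain ⟨a, l', b', x, e, -⟩ := exists_of_acc_source h
      simp [reachBlocks] at e
    · obtain ⟨x, y, hx, hy, e⟩ := exists_of_acc_both h
      obtain rfl : x = y := by omega
      exact not_acc_of_rule hr hx (by simpa [ha] using hy)
  | cons a w ih =>
    rcases mem_starts_iff.1 hs with rfl | rfl | ⟨r, hr, rfl | ⟨ha, rfl⟩⟩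
    · rcases acc_idle_cases h with ⟨e, -⟩ | ⟨a', l', b', e, s', hs', h'⟩
      · simp [reachBlocks] at e
      · simp only [reachBlocks, List.cons.injEq, Prod.mk.injEq] at e
        obtain ⟨⟨rfl, rfl⟩, rfl⟩ := e
        exact ih (by simpa using hw) s' hs' h'
    · have := acc_up_length h
      rw [length_reachBlock] at this
      omega
    · obtain ⟨a', l', b', x, e, ha, hx, h'⟩ := exists_of_acc_source h
      simp only [reachBlocks, List.cons.injEq, Prod.mk.injEq] at e
      obtain ⟨⟨rfl, rfl⟩, rfl⟩ := e
      obtain ⟨z, y, hz, hy, e⟩ := exists_of_acc_both h'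
      obtain rfl := CounterRule.source_two_iff.1 hz
      obtain rfl : x = y := by omega
      exact not_acc_of_rule hr hx (by simpa [ha] using hy)
    · obtain ⟨x, y, hx, hy, e⟩ := exists_of_acc_both h
      obtain rfl : x = y := by omega
      exact not_acc_of_rule hr hx (by simpa [ha] using hy)

/-- If `w` were not accepted within the bound, its blocks of reachable configurations would form a
word with no error to guess. -/
theorem acceptsWithin_of_acc {w : List ℕ} (h : ∀ l b, Admissible c m l b →
    ∃ s ∈ (automaton c m).init, Acc c m k s 0 (word l b)) (hw : ∀ a ∈ w, a < m) :
    (c.toLists m).AcceptsWithin (Set.Iic (2 * k + 1)) w := by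
  by_contra hn
  have hw' : ∀ q ∈ finals c, ∀ n, ¬ Reach c m (2 * k + 1) ([] ++ w) q n := by
    rintro q hq n ⟨p, hp, hr⟩
    exact hn ⟨p, hp, q, hq, n, by simpa using hr⟩
  obtain ⟨s, hs, hacc⟩ := h _ _ (admissible_reachBlocks (v := []) (k := (2 * k + 1)) hw)
  rcases List.mem_cons.1 hs with rfl | hs
  -- The `first` check fails too: every initial state is reached with an empty counter by the empty
  -- run.
  · have hl := length_reachBlock (c := c) (m := m) (k := (2 * k + 1)) (v := [])
    obtain ⟨x, l, e⟩ := List.exists_cons_of_length_pos (hl.symm ▸ Nat.succ_pos _ :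
      0 < (reachBlock c m (2 * k + 1) []).length)
    rw [e] at hacc
    obtain ⟨-, y, s', ht, -⟩ := acc_cons.1 hacc
    cases ht with
    | @first _ q hx hq hb =>
      rw [testBit_reachBlock (n := 0) (by rw [e]; rfl)
        (by simpa using (List.mem_filter.1 hq).2)] at hb
      exact hb ⟨q, hq, .nil (Nat.zero_le _)⟩
  · exact not_acc_reachBlocks le_rfl hw' s hs hacc

end Sound

theorem path_copy_iff {s : ℕ} {ρ : List (Letter × ℕ)} {x : ℕ} : (copy c m).Path s ρ x ↔
    s = 0 ∧ x = 0 ∧ ∃ u, ρ = copied u ∧ ∀ a ∈ u, a ∈ letters c m := by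
  constructor
  · intro h
    induction h with
    | nil h =>
      obtain ⟨rfl, rfl⟩ := by simpa [copy] using h
      exact ⟨rfl, rfl, [], rfl, by simp⟩
    | cons h _ ih =>
      simp only [copy, List.mem_map, Prod.mk.injEq] at h
      obtain ⟨a, ha, rfl, rfl, rfl, rfl⟩ := h
      obtain ⟨-, rfl, u, rfl, hu⟩ := ih
      exact ⟨rfl, rfl, a :: u, rfl, by simpa [ha] using hu⟩
  · rintro ⟨rfl, rfl, u, rfl, hu⟩
    induction u with
    | nil => exact .nil (by simp [copy])
    | cons a u ih =>
      simp only [List.mem_cons, forall_eq_or_imp] at hu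
      exact .cons (s' := 0) (by simpa [copy] using hu.1) (ih hu.2)

/-- Every word over the letters splits into blocks, so bounded lag is a statement about all
admissible block words. The bound is kept in one direction and becomes `2 * k + 1` in the other. -/
theorem lagBounded_iff : (copy c m).LagBounded (automaton c m) ↔
    ∃ k, ∀ w : List ℕ, (∀ a ∈ w, a < m) → (c.toLists m).AcceptsWithin (Set.Iic k) w := by
  have key : (copy c m).LagBounded (automaton c m) ↔ ∃ k, ∀ l b, Admissible c m l b →
      ∃ s ∈ (automaton c m).init, Acc c m k s 0 (word l b) := by
    refine exists_congr fun k => ⟨fun h l b hlb => ?_, fun h s hs ρ x hp => ?_⟩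
    · exact h 0 (by simp [copy]) _ _ (path_copy_iff.2 ⟨rfl, rfl, _, rfl, admissible_iff.1 hlb⟩)
    · obtain ⟨-, rfl, u, rfl, hu⟩ := path_copy_iff.1 hp
      obtain ⟨l, b, rfl⟩ := exists_eq_word u
      exact h l b (admissible_iff.2 hu)
  rw [key]
  constructor
  · rintro ⟨k, h⟩
    exact ⟨2 * k + 1, fun w hw => acceptsWithin_of_acc h hw⟩
  · rintro ⟨k, h⟩
    refine ⟨k, fun l b hlb => exists_acc hlb (h _ ?_)⟩
    simp only [List.mem_map]
    rintro _ ⟨t, ht, rfl⟩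
    exact (hlb.2 t ht).1

end ErrorAutomaton

/-! ### The reductions are computable -/

namespace Primrec

section

variable {α β γ : Type} [Primcodable α] [Primcodable β] [Primcodable γ]

attribute [fun_prop] Primrec

-- The closure properties are restated for explicit functions of a parameter, so that `fun_prop` can
-- follow the shape of each construction.
@[fun_prop] theorem fun_id : Primrec fun a : α => a := .id

@[fun_prop] theorem fun_const (b : β) : Primrec fun _ : α => b := .const b

@[fun_prop] theorem fun_comp {f : β → γ} {g : α → β} (hf : Primrec f) (hg : Primrec g) :
    Primrec fun a => f (g a) := hf.comp hg

@[fun_prop] theorem fun_fst {f : α → β × γ} (hf : Primrec f) : Primrec fun a => (f a).1 :=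
  fst.comp hf

@[fun_prop] theorem fun_snd {f : α → β × γ} (hf : Primrec f) : Primrec fun a => (f a).2 :=
  snd.comp hf

@[fun_prop] theorem fun_pair {f : α → β} {g : α → γ} (hf : Primrec f) (hg : Primrec g) :
    Primrec fun a => (f a, g a) := hf.pair hg

@[fun_prop] theorem fun_inl {f : α → β} (hf : Primrec f) :
    Primrec fun a => (Sum.inl (f a) : β ⊕ γ) := sumInl.comp hf

@[fun_prop] theorem fun_inr {f : α → γ} (hf : Primrec f) :
    Primrec fun a => (Sum.inr (f a) : β ⊕ γ) := sumInr.comp hf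

@[fun_prop] theorem fun_some {f : α → β} (hf : Primrec f) : Primrec fun a => some (f a) :=
  option_some.comp hf

@[fun_prop] theorem fun_toList {f : α → Option β} (hf : Primrec f) :
    Primrec fun a => (f a).toList := optionToList.comp hf

@[fun_prop] theorem fun_encode {f : α → β} (hf : Primrec f) :
    Primrec fun a => Encodable.encode (f a) := Primrec.encode.comp hf

@[fun_prop] theorem fun_add {f g : α → ℕ} (hf : Primrec f) (hg : Primrec g) :
    Primrec fun a => f a + g a := nat_add.comp hf hg

@[fun_prop] theorem fun_sub {f g : α → ℕ} (hf : Primrec f) (hg : Primrec g) :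
    Primrec fun a => f a - g a := nat_sub.comp hf hg

@[fun_prop] theorem fun_two_pow {f : α → ℕ} (hf : Primrec f) : Primrec fun a => 2 ^ f a :=
  (Primrec.nat_iff.2 (Nat.Primrec.pow.comp ((Nat.Primrec.const 2).pair Nat.Primrec.id)) |>.of_eq
    fun n => by simp : Primrec fun n : ℕ => 2 ^ n).comp hf

@[fun_prop] theorem fun_not {f : α → Bool} (hf : Primrec f) : Primrec fun a => !f a :=
  Primrec.not.comp hf

@[fun_prop] theorem fun_cond {c : α → Bool} {f g : α → β} (hc : Primrec c) (hf : Primrec f)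
    (hg : Primrec g) : Primrec fun a => bif c a then f a else g a := cond hc hf hg

@[fun_prop] theorem fun_cons {f : α → β} {g : α → List β} (hf : Primrec f) (hg : Primrec g) :
    Primrec fun a => f a :: g a := list_cons.comp hf hg

@[fun_prop] theorem fun_append {f g : α → List β} (hf : Primrec f) (hg : Primrec g) :
    Primrec fun a => f a ++ g a := list_append.comp hf hg

@[fun_prop] theorem fun_length {f : α → List β} (hf : Primrec f) :
    Primrec fun a => (f a).length := list_length.comp hf

@[fun_prop] theorem fun_getElem? {f : α → List β} {g : α → ℕ} (hf : Primrec f) (hg : Primrec g) :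
    Primrec fun a => (f a)[g a]? := list_getElem?.comp hf hg

@[fun_prop] theorem fun_range {f : α → ℕ} (hf : Primrec f) : Primrec fun a => List.range (f a) :=
  list_range.comp hf

@[fun_prop] theorem fun_map {f : α → List β} {g : α → β → γ} (hf : Primrec f)
    (hg : Primrec fun p : α × β => g p.1 p.2) : Primrec fun a => (f a).map (g a) := list_map hf hg

@[fun_prop] theorem fun_flatMap {f : α → List β} {g : α → β → List γ} (hf : Primrec f)
    (hg : Primrec fun p : α × β => g p.1 p.2) : Primrec fun a => (f a).flatMap (g a) :=
  list_flatMap hf hg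

@[fun_prop] theorem fun_filter {f : α → List β} {p : α → β → Bool} (hf : Primrec f)
    (hp : Primrec fun x : α × β => p x.1 x.2) : Primrec fun a => (f a).filter (p a) := by
  -- Filtering replaces each element by a list of length at most one.
  have : Primrec fun a => (f a).flatMap fun b => bif p a b then [b] else [] := by fun_prop
  refine this.of_eq fun a => ?_
  induction f a with
  | nil => rfl
  | cons b l ih => cases h : p a b <;> simp [h, ih]

@[fun_prop] theorem fun_sum {f : α → List ℕ} (hf : Primrec f) : Primrec fun a => (f a).sum := by
  have : Primrec fun a => (f a).foldr (fun b s => b + s) 0 :=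
    list_foldr hf (const 0) (h := fun _ p => p.1 + p.2)
      (by show Primrec fun p : α × ℕ × ℕ => p.2.1 + p.2.2; fun_prop)
  exact this.of_eq fun a => rfl

@[fun_prop] theorem fun_replicate {f : α → ℕ} {g : α → β} (hf : Primrec f) (hg : Primrec g) :
    Primrec fun a => List.replicate (f a) (g a) := by
  have : Primrec fun a => (List.range (f a)).map fun _ => g a := by fun_prop
  exact this.of_eq fun a => by simp

@[fun_prop] theorem fun_decide_eq [DecidableEq β] {f g : α → β} [∀ a, Decidable (f a = g a)]
    (hf : Primrec f) (hg : Primrec g) : Primrec fun a => decide (f a = g a) :=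
  (Primrec.eq.comp hf hg).decide.of_eq fun a => by congr

@[fun_prop] theorem fun_decide_lt {f g : α → ℕ} (hf : Primrec f) (hg : Primrec g) :
    Primrec fun a => decide (f a < g a) := (nat_lt.comp hf hg).decide

@[fun_prop] theorem fun_decide_and {p q : α → Prop} [∀ a, Decidable (p a)] [∀ a, Decidable (q a)]
    [∀ a, Decidable (p a ∧ q a)] (hp : Primrec fun a => decide (p a))
    (hq : Primrec fun a => decide (q a)) : Primrec fun a => decide (p a ∧ q a) :=
  (Primrec.and.comp hp hq).of_eq fun a => by simp

@[fun_prop] theorem fun_decide_forall_mem {f : α → List β} {p : α → β → Prop}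
    [∀ a b, Decidable (p a b)] [∀ a, Decidable (∀ b ∈ f a, p a b)] (hf : Primrec f)
    (hp : Primrec fun x : α × β => decide (p x.1 x.2)) :
    Primrec fun a => decide (∀ b ∈ f a, p a b) := by
  -- A bounded universal statement holds when no counterexample survives filtering.
  have : Primrec fun a => decide (((f a).filter fun b => !decide (p a b)).length = 0) := by fun_prop
  exact this.of_eq fun a => by simp

@[fun_prop] theorem fun_decide_mem [DecidableEq β] {f : α → β} {l : α → List β}
    [∀ a, Decidable (f a ∈ l a)] (hf : Primrec f) (hl : Primrec l) :
    Primrec fun a => decide (f a ∈ l a) := by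
  have : Primrec fun a => !decide (((l a).filter fun b => decide (b = f a)).length = 0) := by
    fun_prop
  exact this.of_eq fun a => by simp; grind

@[fun_prop] theorem fun_testBit {f g : α → ℕ} (hf : Primrec f) (hg : Primrec g) :
    Primrec fun a => (f a).testBit (g a) :=
  (Primrec.eq.decide.comp (nat_mod.comp (nat_div.comp hf (fun_two_pow hg)) (const 2))
    (const 1)).of_eq fun a => by rw [Nat.testBit_eq_decide_div_mod_eq]

@[fun_prop] theorem fun_ite {p : α → Prop} [∀ a, Decidable (p a)] {f g : α → β}
    (hp : Primrec fun a => decide (p a)) (hf : Primrec f) (hg : Primrec g) :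
    Primrec fun a => if p a then f a else g a :=
  (cond hp hf hg).of_eq fun a => by by_cases h : p a <;> simp [h]

@[fun_prop] theorem fun_number {f : α → ℕ} {l : α → List β} (hf : Primrec f) (hl : Primrec l) :
    Primrec fun a => (l a).number (f a) := by
  unfold List.number
  fun_prop

end

/-! ### Fields and constructors of the encoded structures -/

section

variable {α S A : Type} [Primcodable α] [Primcodable S] [Primcodable A]

/-- The fields of an automaton as a tuple. -/
def _root_.WeightedAutomaton.equivProd :
    WeightedAutomaton S A ≃ List S × List (S × ℕ) × List (S × A × ℕ × S) where
  toFun M := (M.init, M.final, M.trans)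
  invFun t := ⟨t.1, t.2.1, t.2.2⟩

instance : Primcodable (WeightedAutomaton S A) := Primcodable.ofEquiv _ WeightedAutomaton.equivProd

theorem weightedAutomaton_equivProd {f : α → WeightedAutomaton S A} (hf : Primrec f) :
    Primrec fun a => WeightedAutomaton.equivProd (f a) := of_equiv.comp hf

@[fun_prop] theorem weightedAutomaton_init {f : α → WeightedAutomaton S A} (hf : Primrec f) :
    Primrec fun a => (f a).init := fun_fst (weightedAutomaton_equivProd hf)

@[fun_prop] theorem weightedAutomaton_final {f : α → WeightedAutomaton S A} (hf : Primrec f) :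
    Primrec fun a => (f a).final := fun_fst (fun_snd (weightedAutomaton_equivProd hf))

@[fun_prop] theorem weightedAutomaton_trans {f : α → WeightedAutomaton S A} (hf : Primrec f) :
    Primrec fun a => (f a).trans := fun_snd (fun_snd (weightedAutomaton_equivProd hf))

@[fun_prop] theorem weightedAutomaton_mk {f : α → List S} {g : α → List (S × ℕ)}
    {h : α → List (S × A × ℕ × S)} (hf : Primrec f) (hg : Primrec g) (hh : Primrec h) :
    Primrec fun a => WeightedAutomaton.mk (f a) (g a) (h a) :=
  (of_equiv_symm (e := WeightedAutomaton.equivProd)).comp (hf.pair (hg.pair hh))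

theorem transducerCode_equivProd {f : α → TransducerCode} (hf : Primrec f) :
    Primrec fun a => TransducerCode.equivProd (f a) := of_equiv.comp hf

@[fun_prop] theorem transducerCode_numStates {f : α → TransducerCode} (hf : Primrec f) :
    Primrec fun a => (f a).numStates := fun_fst (transducerCode_equivProd hf)

@[fun_prop] theorem transducerCode_init {f : α → TransducerCode} (hf : Primrec f) :
    Primrec fun a => (f a).init := fun_fst (fun_snd (transducerCode_equivProd hf))

@[fun_prop] theorem transducerCode_final {f : α → TransducerCode} (hf : Primrec f) :
    Primrec fun a => (f a).final := fun_fst (fun_snd (fun_snd (transducerCode_equivProd hf)))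

@[fun_prop] theorem transducerCode_trans {f : α → TransducerCode} (hf : Primrec f) :
    Primrec fun a => (f a).trans := fun_snd (fun_snd (fun_snd (transducerCode_equivProd hf)))

@[fun_prop] theorem transducerCode_mk {n : α → ℕ} {f : α → List ℕ} {g : α → List (ℕ × List Unit)}
    {h : α → List (ℕ × ℕ × List Unit × ℕ)} (hn : Primrec n) (hf : Primrec f) (hg : Primrec g)
    (hh : Primrec h) : Primrec fun a => TransducerCode.mk (n a) (f a) (g a) (h a) :=
  (of_equiv_symm (e := TransducerCode.equivProd)).comp (hn.pair (hf.pair (hg.pair hh)))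

theorem ocaCode_equivProd {f : α → OCACode} (hf : Primrec f) :
    Primrec fun a => OCACode.equivProd (f a) := of_equiv.comp hf

@[fun_prop] theorem ocaCode_numStates {f : α → OCACode} (hf : Primrec f) :
    Primrec fun a => (f a).numStates := fun_fst (ocaCode_equivProd hf)

@[fun_prop] theorem ocaCode_init {f : α → OCACode} (hf : Primrec f) :
    Primrec fun a => (f a).init := fun_fst (fun_snd (ocaCode_equivProd hf))

@[fun_prop] theorem ocaCode_final {f : α → OCACode} (hf : Primrec f) :
    Primrec fun a => (f a).final := fun_fst (fun_snd (fun_snd (ocaCode_equivProd hf)))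

@[fun_prop] theorem ocaCode_trans {f : α → OCACode} (hf : Primrec f) :
    Primrec fun a => (f a).trans := fun_snd (fun_snd (fun_snd (ocaCode_equivProd hf)))

@[fun_prop] theorem ocaCode_mk {n : α → ℕ} {f g : α → List ℕ}
    {h : α → List (ℕ × Option ℕ × Bool × ℕ × ℕ)} (hn : Primrec n) (hf : Primrec f) (hg : Primrec g)
    (hh : Primrec h) : Primrec fun a => OCACode.mk (n a) (f a) (g a) (h a) :=
  (of_equiv_symm (e := OCACode.equivProd)).comp (hn.pair (hf.pair (hg.pair hh)))

theorem synthesisInstance_equivProd {f : α → SynthesisInstance} (hf : Primrec f) :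
    Primrec fun a => SynthesisInstance.equivProd (f a) := of_equiv.comp hf

@[fun_prop] theorem synthesisInstance_numLetters {f : α → SynthesisInstance} (hf : Primrec f) :
    Primrec fun a => (f a).numLetters := fun_fst (synthesisInstance_equivProd hf)

@[fun_prop] theorem synthesisInstance_left {f : α → SynthesisInstance} (hf : Primrec f) :
    Primrec fun a => (f a).left := fun_fst (fun_snd (synthesisInstance_equivProd hf))

@[fun_prop] theorem synthesisInstance_right {f : α → SynthesisInstance} (hf : Primrec f) :
    Primrec fun a => (f a).right := fun_snd (fun_snd (synthesisInstance_equivProd hf))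

@[fun_prop] theorem synthesisInstance_mk {n : α → ℕ} {f g : α → TransducerCode} (hn : Primrec n)
    (hf : Primrec f) (hg : Primrec g) : Primrec fun a => SynthesisInstance.mk (n a) (f a) (g a) :=
  (of_equiv_symm (e := SynthesisInstance.equivProd)).comp (hn.pair (hf.pair hg))

theorem boundednessInstance_equivProd {f : α → BoundednessInstance} (hf : Primrec f) :
    Primrec fun a => BoundednessInstance.equivProd (f a) := of_equiv.comp hf

@[fun_prop] theorem boundednessInstance_numLetters {f : α → BoundednessInstance}
    (hf : Primrec f) : Primrec fun a => (f a).numLetters :=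
  fun_fst (boundednessInstance_equivProd hf)

@[fun_prop] theorem boundednessInstance_automaton {f : α → BoundednessInstance} (hf : Primrec f) :
    Primrec fun a => (f a).automaton := fun_snd (boundednessInstance_equivProd hf)

@[fun_prop] theorem boundednessInstance_mk {n : α → ℕ} {f : α → OCACode} (hn : Primrec n)
    (hf : Primrec f) : Primrec fun a => BoundednessInstance.mk (n a) (f a) :=
  (of_equiv_symm (e := BoundednessInstance.equivProd)).comp (hn.pair hf)

@[fun_prop] theorem weightedAutomaton_toCode {f : α → WeightedAutomaton S A} (hf : Primrec f) :
    Primrec fun a => (f a).toCode := by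
  unfold WeightedAutomaton.toCode
  fun_prop

@[fun_prop] theorem transducerCode_toWeighted {f : α → TransducerCode} {m : α → ℕ}
    (hf : Primrec f) (hm : Primrec m) : Primrec fun a => (f a).toWeighted (m a) := by
  unfold TransducerCode.toWeighted
  fun_prop

@[fun_prop] theorem ocaCode_rules {f : α → OCACode} {m : α → ℕ} (hf : Primrec f)
    (hm : Primrec m) : Primrec fun a => (f a).rules (m a) := by
  unfold OCACode.rules
  fun_prop

@[fun_prop] theorem ocaCode_ofLists {f g : α → List S}
    {h : α → List (S × Option ℕ × Bool × ℕ × S)} (hf : Primrec f) (hg : Primrec g)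
    (hh : Primrec h) : Primrec fun a => OCACode.ofLists (f a) (g a) (h a) := by
  unfold OCACode.ofLists
  fun_prop

end

end Primrec

namespace LagAutomaton

variable {α : Type} [Primcodable α] {f g : α → WeightedAutomaton ℕ ℕ}

@[fun_prop] theorem primrec_transLetters (hf : Primrec f) : Primrec fun a => transLetters (f a) := by
  unfold transLetters
  fun_prop

@[fun_prop] theorem primrec_finalLetters (hf : Primrec f) : Primrec fun a => finalLetters (f a) := by
  unfold finalLetters
  fun_prop

@[fun_prop] theorem primrec_numLetters (hf : Primrec f) : Primrec fun a => numLetters (f a) := by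
  unfold numLetters
  fun_prop

@[fun_prop] theorem primrec_bound (hf : Primrec f) (hg : Primrec g) :
    Primrec fun a => bound (f a) (g a) := by
  unfold bound
  fun_prop

@[fun_prop] theorem primrec_currents (hf : Primrec f) : Primrec fun a => currents (f a) := by
  unfold currents
  fun_prop

@[fun_prop] theorem primrec_plainTrans (hf : Primrec f) : Primrec fun a => plainTrans (f a) := by
  unfold plainTrans
  fun_prop

@[fun_prop] theorem primrec_simTrans (hf : Primrec f) (hg : Primrec g) :
    Primrec fun a => simTrans (f a) (g a) := by
  unfold simTrans
  fun_prop

@[fun_prop] theorem primrec_moves {q : α → Option ℕ} {b : α → Bool} {x y : α → ℕ × ℕ}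
    (hq : Primrec q) (hb : Primrec b) (hx : Primrec x) (hy : Primrec y) :
    Primrec fun a => moves (q a) (b a) (x a) (y a) := by
  unfold moves
  fun_prop

@[fun_prop] theorem primrec_silentTrans (hf : Primrec f) (hg : Primrec g) :
    Primrec fun a => silentTrans (f a) (g a) := by
  unfold silentTrans
  fun_prop

@[fun_prop] theorem primrec_trans (hf : Primrec f) (hg : Primrec g) :
    Primrec fun a => trans (f a) (g a) := by
  unfold trans
  fun_prop

@[fun_prop] theorem primrec_init (hf : Primrec f) (hg : Primrec g) :
    Primrec fun a => init (f a) (g a) := by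
  unfold init
  fun_prop

@[fun_prop] theorem primrec_final (hf : Primrec f) : Primrec fun a => final (f a) := by
  unfold final
  fun_prop

end LagAutomaton

namespace ErrorAutomaton

variable {α : Type} [Primcodable α] {f : α → OCACode} {m : α → ℕ}

@[fun_prop] theorem primrec_sourceSteps {r : α → CounterRule} (hr : Primrec r) (hm : Primrec m) :
    Primrec fun a => CounterRule.sourceSteps (r a) (m a) := by
  unfold CounterRule.sourceSteps
  fun_prop

@[fun_prop] theorem primrec_targetSteps {r : α → CounterRule} (hr : Primrec r) (hm : Primrec m) :
    Primrec fun a => CounterRule.targetSteps (r a) (m a) := by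
  unfold CounterRule.targetSteps
  fun_prop

@[fun_prop] theorem primrec_cells (hf : Primrec f) : Primrec fun a => cells (f a) := by
  unfold cells
  fun_prop

@[fun_prop] theorem primrec_letters (hf : Primrec f) (hm : Primrec m) :
    Primrec fun a => letters (f a) (m a) := by
  unfold letters
  fun_prop

@[fun_prop] theorem primrec_inits (hf : Primrec f) : Primrec fun a => inits (f a) := by
  unfold inits
  fun_prop

@[fun_prop] theorem primrec_finals (hf : Primrec f) : Primrec fun a => finals (f a) := by
  unfold finals
  fun_prop

@[fun_prop] theorem primrec_starts (hf : Primrec f) (hm : Primrec m) :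
    Primrec fun a => starts (f a) (m a) := by
  unfold starts
  fun_prop

@[fun_prop] theorem primrec_cellTrans (hf : Primrec f) : Primrec fun a => cellTrans (f a) := by
  unfold cellTrans
  fun_prop

@[fun_prop] theorem primrec_sepTrans (hf : Primrec f) (hm : Primrec m) :
    Primrec fun a => sepTrans (f a) (m a) := by
  unfold sepTrans
  fun_prop

@[fun_prop] theorem primrec_checkTrans (hf : Primrec f) (hm : Primrec m) :
    Primrec fun a => checkTrans (f a) (m a) := by
  unfold checkTrans
  fun_prop

@[fun_prop] theorem primrec_automaton (hf : Primrec f) (hm : Primrec m) :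
    Primrec fun a => automaton (f a) (m a) := by
  unfold automaton
  fun_prop

@[fun_prop] theorem primrec_copy (hf : Primrec f) (hm : Primrec m) :
    Primrec fun a => copy (f a) (m a) := by
  unfold copy
  fun_prop

end ErrorAutomaton

/-! ### The main theorem -/

/-- The reduction from synthesis to boundedness. -/
def SynthesisInstance.toBoundedness (x : SynthesisInstance) : BoundednessInstance where
  numLetters := LagAutomaton.numLetters (x.left.toWeighted x.numLetters)
  automaton := .ofLists
    (LagAutomaton.init (x.left.toWeighted x.numLetters) (x.right.toWeighted x.numLetters))
    (LagAutomaton.final (x.left.toWeighted x.numLetters))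
    (LagAutomaton.trans (x.left.toWeighted x.numLetters) (x.right.toWeighted x.numLetters))

/-- The reduction from boundedness to synthesis. -/
def BoundednessInstance.toSynthesis (x : BoundednessInstance) : SynthesisInstance where
  numLetters := ((ErrorAutomaton.letters x.automaton x.numLetters).map Encodable.encode).sum + 1
  left := (ErrorAutomaton.copy x.automaton x.numLetters).toCode
  right := (ErrorAutomaton.automaton x.automaton x.numLetters).toCode

theorem SynthesisInstance.computable_toBoundedness : Computable toBoundedness := by
  refine Primrec.to_comp ?_
  unfold toBoundedness
  fun_prop

theorem BoundednessInstance.computable_toSynthesis : Computable toSynthesis := by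
  refine Primrec.to_comp ?_
  unfold toSynthesis
  fun_prop

theorem SynthesisInstance.acceptsWithin_toBoundedness (x : SynthesisInstance) {C : Set ℕ}
    {w : List (Fin x.toBoundedness.numLetters)} :
    x.toBoundedness.oca.AcceptsWithin C w ↔ (LagAutomaton.automaton
      (x.left.toWeighted x.numLetters) (x.right.toWeighted x.numLetters)).AcceptsWithin C
      (w.map Fin.val) :=
  (OCACode.isCode_ofLists LagAutomaton.lt_numLetters_of_mem_trans).acceptsWithin_iff
    Encodable.encode_injective

/-- Words over `Fin n` are words whose letters are less than `n`. -/
theorem forall_list_fin {n : ℕ} {P : List ℕ → Prop} :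
    (∀ w : List (Fin n), P (w.map Fin.val)) ↔ ∀ w : List ℕ, (∀ i ∈ w, i < n) → P w := by
  constructor
  · intro h w hw
    obtain ⟨w, rfl⟩ : ∃ w' : List (Fin n), w'.map Fin.val = w := by
      rw [← Set.mem_range, Set.range_list_map, Fin.range_val]
      exact hw
    exact h w
  · intro h w
    refine h _ ?_
    simp only [List.mem_map]
    rintro _ ⟨i, _, rfl⟩
    exact i.2

/-- Universality comes from the counting mode and needs nothing from the instance. -/
theorem SynthesisInstance.promise_toBoundedness (x : SynthesisInstance) :
    languageBoundedness.promise x.toBoundedness := by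
  refine Set.eq_univ_of_forall fun w => x.acceptsWithin_toBoundedness.2 ?_
  exact forall_list_fin.2 (fun w hw => LagAutomaton.acceptsWithin_univ hw) w

theorem SynthesisInstance.yes_toBoundedness (x : SynthesisInstance) :
    rationalSynthesis.yes x ↔ languageBoundedness.yes x.toBoundedness := by
  refine ((TransducerCode.isCode_toWeighted _ _).hasRationalResynchronizer_iff
    (TransducerCode.isCode_toWeighted _ _) Function.injective_id Function.injective_id
    Function.injective_id).trans ?_
  rw [LagAutomaton.lagBounded_iff_acceptsWithin]
  refine exists_congr fun k => forall_list_fin.symm.trans (forall_congr' fun w => ?_)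
  exact x.acceptsWithin_toBoundedness.symm

theorem BoundednessInstance.encode_lt {x : BoundednessInstance} {a : ErrorAutomaton.Letter}
    (h : a ∈ ErrorAutomaton.letters x.automaton x.numLetters) :
    Encodable.encode a < x.toSynthesis.numLetters :=
  Nat.lt_succ_of_le (List.le_sum_map Encodable.encode h)

theorem ErrorAutomaton.Trans.mem_letters {c : OCACode} {m y : ℕ} {s s' : ErrorAutomaton.State}
    {a : ErrorAutomaton.Letter} (h : ErrorAutomaton.Trans c m s a y s') :
    a ∈ ErrorAutomaton.letters c m := by
  cases h <;> simp_all [ErrorAutomaton.letters, ErrorAutomaton.cells]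

theorem BoundednessInstance.isCode_copy (x : BoundednessInstance) :
    (ErrorAutomaton.copy x.automaton x.numLetters).IsCode x.toSynthesis.left
      x.toSynthesis.numLetters Encodable.encode Encodable.encode := by
  refine WeightedAutomaton.isCode_toCode _ ?_
  rintro t ht
  obtain ⟨a, ha, rfl⟩ := List.mem_map.1 ht
  exact encode_lt ha

theorem BoundednessInstance.isCode_automaton (x : BoundednessInstance) :
    (ErrorAutomaton.automaton x.automaton x.numLetters).IsCode x.toSynthesis.right
      x.toSynthesis.numLetters Encodable.encode Encodable.encode := by
  refine WeightedAutomaton.isCode_toCode _ ?_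
  rintro ⟨s, a, y, s'⟩ ht
  exact encode_lt (ErrorAutomaton.mem_trans_iff.1 ht).mem_letters

/-- The copying transducer outputs as many letters as it reads, and over one letter the length
determines the word. -/
theorem BoundednessInstance.functional_toSynthesis (x : BoundednessInstance) :
    x.toSynthesis.leftTransducer.Functional := by
  have key : ∀ u v, (u, v) ∈ x.toSynthesis.leftTransducer.relation → v.length = u.length := by
    rintro u v ⟨ρ, v', ⟨p, hp, q, hq, hr, hv⟩, e⟩
    obtain ⟨rfl, rfl⟩ := Prod.mk.inj e
    obtain ⟨s, hs, e⟩ := (x.isCode_copy.init _).1 ⟨hp, p.2⟩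
    obtain ⟨ρ₀, hρ, e⟩ := x.isCode_copy.path_of_run Encodable.encode_injective hr hv e
    obtain ⟨-, hv', u, rfl, -⟩ := ErrorAutomaton.path_copy_iff.1 hρ
    have e' : ρ.map (fun t => t.2.length) = u.map fun _ => 1 := by
      simpa [ErrorAutomaton.copied, Function.comp_def] using congrArg (List.map Prod.snd) e
    have hl : ρ.length = u.length := by simpa using congrArg List.length e'
    rw [List.length_append, hv', List.length_flatten, List.map_map, List.length_map]
    simp only [Function.comp_def, e']
    simp [hl]
  intro u v v' h h'
  exact List.eq_of_length_eq_unit ((key u v h).trans (key u v' h').symm)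

theorem BoundednessInstance.yes_toSynthesis (x : BoundednessInstance) :
    languageBoundedness.yes x ↔ rationalSynthesis.yes x.toSynthesis := by
  refine Iff.symm ((x.isCode_copy.hasRationalResynchronizer_iff x.isCode_automaton
    Encodable.encode_injective Encodable.encode_injective Encodable.encode_injective).trans ?_)
  rw [ErrorAutomaton.lagBounded_iff]
  refine exists_congr fun k => forall_list_fin.symm.trans (forall_congr' fun w => ?_)
  exact ((x.automaton.isCode_toLists _).acceptsWithin_iff Function.injective_id).symm

/-- Both variants share the two maps: the map to boundedness works for every instance, and the map
to synthesis always produces a functional left side. -/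
theorem mainTheorem5 :
    rationalSynthesis.InterReducible languageBoundedness ∧
      rationalSynthesisFunctional.InterReducible languageBoundedness :=
  ⟨⟨⟨_, SynthesisInstance.computable_toBoundedness,
      fun x _ => ⟨x.promise_toBoundedness, x.yes_toBoundedness⟩⟩,
    ⟨_, BoundednessInstance.computable_toSynthesis,
      fun x _ => ⟨⟨TransducerCode.realTime _ _, TransducerCode.realTime _ _⟩, x.yes_toSynthesis⟩⟩⟩,
    ⟨⟨_, SynthesisInstance.computable_toBoundedness,
      fun x _ => ⟨x.promise_toBoundedness, x.yes_toBoundedness⟩⟩,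
    ⟨_, BoundednessInstance.computable_toSynthesis,
      fun x _ => ⟨⟨TransducerCode.realTime _ _, TransducerCode.realTime _ _,
        x.functional_toSynthesis⟩, x.yes_toSynthesis⟩⟩⟩⟩
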